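/- Let $n\in\mathbb N$, $T,K,\tau\in\mathbb R$. For $\gamma\in\mathbb R$ put $\pi_\gamma(x)=(1+|x|^2)^{-\gamma}$, $x\in\mathbb R^n$. Let $\sigma\in\mathbb R^{n\times n}$ be such that $a:=\sigma\sigma^\top$ is invertible, with $\operatorname{tr}(a)=\tau$, and let $\mathcal A\varphi=-\frac12\sum_{i,j=1}^n a_{ij}\frac{\partial^2\varphi}{\partial x_i\partial x_j}$. Let $0\le t\le T$, let $g:[t,T]\times\mathbb R^n\to\mathbb R^n$ and $l:[t,T]\times\mathbb R^n\to\mathbb R$ be measurable, let $l_T:\mathbb R^n\to\mathbb R$ be differentiable, and suppose that for all $s\in[t,T]$, $x\in\mathbb R^n$ $$|g(s,x)|\le K(1+|x|),\quad |l(s,x)|\le K(1+|x|^2),\quad |l_T(x)|\le K(1+|x|^2),\quad |Dl_T(x)|\le K(1+|x|).$$ Let $\mathcal J$ be a strong solution of the linear backward parabolic problem $$-\frac{\partial\mathcal J}{\partial s}+\mathcal A\mathcal J-g\cdot D\mathcal J=l\ \text{ in }(t,T)\times\mathbb R^n,\qquad \mathcal J(T,x)=l_T(x),\ x\in\mathbb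 R^n,$$ that is, $\mathcal J$ is continuous on $[t,T]\times\mathbb R^n$, its weak derivatives $\partial_s\mathcal J$, $D\mathcal J$, $D^2\mathcal J$ exist and belong to $L^2_{loc}((t,T)\times\mathbb R^n)$, the equation holds almost everywhere, and the terminal condition holds for every $x$. Suppose also that $\mathcal J$ has at most polynomial growth at infinity: there are $M\in\mathbb R$ and $N\in\mathbb N$ with $|\mathcal J(s,x)|\le M(1+|x|)^N$ for all $(s,x)\in[t,T]\times\mathbb R^n$. Then, for every $\gamma>\frac n2+3$, $$|\mathcal J(s,x)|\le C_0(1+|x|^2)\quad\text{for all }(s,x)\in[t,T]\times\mathbb R^n,$$ $$\int_t^T\!\!\int_{\mathbb R^n}|D\mathcal J(s,x)|^2\pi_\gamma(x)\,dx\,ds\le C_1,\qquad \int_t^T\!\!\int_{\mathbb R^n}\Big|\frac{\partial\mathcal J}{\partial s}(s,x)\Big|^2\pi_{\gamma+1}(x)\,dx\,ds\le C_1,$$ where $C_0$ depends only on $n,T,K,\operatorname{tr}(a)$, and $C_1$ depends only on $n,T,K,\operatorname{tr}(a),\det(a),\gamma$; in particular, neither depends on $t$, $g$, $l$, $l_T$,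 $\mathcal J$, $M$ or $N$. -/

import Mathlib

open MeasureTheory Set
open scoped ContDiff

/-- The weight `π_γ(x) = (1 + |x|²)^(-γ)` on `ℝⁿ`. -/
noncomputable def polyWeight {n : ℕ} (γ : ℝ) (x : EuclideanSpace ℝ (Fin n)) : ℝ :=
  1 / (1 + ‖x‖ ^ 2) ^ γ

/-- The open time-space slab `(t, T) × ℝⁿ`. -/
def openSlab (n : ℕ) (t T : ℝ) : Set (ℝ × EuclideanSpace ℝ (Fin n)) :=
  Ioo t T ×ˢ univ

/-- `w ∈ L²_loc(Ω)`: square integrable on every compact subset of `Ω`. -/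
def IsL2Loc {n : ℕ} (Ω : Set (ℝ × EuclideanSpace ℝ (Fin n)))
    (w : ℝ × EuclideanSpace ℝ (Fin n) → ℝ) : Prop :=
  ∀ S : Set (ℝ × EuclideanSpace ℝ (Fin n)), IsCompact S → S ⊆ Ω →
    MemLp w 2 (volume.restrict S)

/-- `w` is the weak (distributional) derivative of `u` in the direction `v` on the open set `Ω`,
both functions being in `L²_loc(Ω)`. -/
def HasWeakDeriv {n : ℕ} (Ω : Set (ℝ × EuclideanSpace ℝ (Fin n)))
    (v : ℝ × EuclideanSpace ℝ (Fin n)) (u w : ℝ × EuclideanSpace ℝ (Fin n) → ℝ) : Prop :=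
  IsL2Loc Ω u ∧ IsL2Loc Ω w ∧
    ∀ φ : ℝ × EuclideanSpace ℝ (Fin n) → ℝ, ContDiff ℝ ∞ φ → HasCompactSupport φ →
      tsupport φ ⊆ Ω → ∫ z in Ω, u z * fderiv ℝ φ z v = -∫ z in Ω, w z * φ z

/-- The operator `𝒜φ = -½ ∑ᵢⱼ aᵢⱼ ∂²φ/∂xᵢ∂xⱼ`, as a function of the Hessian `H` of `φ`. -/
noncomputable def diffusionOp {n : ℕ} (a H : Matrix (Fin n) (Fin n) ℝ) : ℝ :=
  -(1 / 2) * ∑ i, ∑ j, a i j * H i j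

/-- `J` is a strong solution of the backward Cauchy problem
`-∂J/∂s + 𝒜J - g · DJ = l` on `(t, T) × ℝⁿ`, `J(T, ·) = lT`:
`J` is continuous on `[t, T] × ℝⁿ`, it has the weak derivatives `Js = ∂J/∂s`, `DJ = D_x J`,
`HJ = D_x² J` in `L²_loc((t, T) × ℝⁿ)`, the equation holds almost everywhere, and the terminal
condition holds everywhere. -/
structure IsStrongSolution {n : ℕ} (a : Matrix (Fin n) (Fin n) ℝ)
    (g : ℝ × EuclideanSpace ℝ (Fin n) → EuclideanSpace ℝ (Fin n))
    (l : ℝ × EuclideanSpace ℝ (Fin n) → ℝ) (lT : EuclideanSpace ℝ (Fin n) → ℝ) (t T : ℝ)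
    (J Js : ℝ × EuclideanSpace ℝ (Fin n) → ℝ)
    (DJ : ℝ × EuclideanSpace ℝ (Fin n) → EuclideanSpace ℝ (Fin n))
    (HJ : ℝ × EuclideanSpace ℝ (Fin n) → Matrix (Fin n) (Fin n) ℝ) : Prop where
  continuousOn : ContinuousOn J (Icc t T ×ˢ univ)
  weakDeriv_time : HasWeakDeriv (openSlab n t T) (1, 0) J Js
  weakDeriv_space : ∀ i, HasWeakDeriv (openSlab n t T) (0, EuclideanSpace.single i 1)
    J (fun z => DJ z i)
  weakDeriv_hess : ∀ i j, HasWeakDeriv (openSlab n t T) (0, EuclideanSpace.single j 1)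
    (fun z => DJ z i) (fun z => HJ z i j)
  equation : ∀ᵐ z ∂(volume.restrict (openSlab n t T)),
    -Js z + diffusionOp a (HJ z) - inner ℝ (g z) (DJ z) = l z
  terminal : ∀ x, J (T, x) = lT x

/-! The equation has constant second-order coefficients, so mollification commutes with `-∂ₛ + 𝒜`.
All estimates are made on smooth mollified functions, whose image under `-∂ₛ + 𝒜` is the
mollification of `l + g · DJ` (`IsStrongSolution.parabolicOp_mollify`). Multiplying by `B'(u) χ` and
integrating by parts gives one identity, `integral_energy_identity`, which drives both the maximum
principle and the energy estimates.

Quadratic growth. With `B(r) = max(r, 0)³` the identity yields the comparison principle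
`IsStrongSolution.le_of_supersolution`. The function `K e^{β(T-s)} (1 + |x|²)` is a supersolution
for a rate `β` depending on `n`, `K` and `tr a` only. A small multiple of a similar barrier of high
degree beats the polynomial growth of `J` at infinity and is then sent to zero, so `M` and `N`
disappear. The ellipticity constant enters only qualitatively here, hence `C₀` does not involve `det
a`.

Gradient. With `B(r) = r²/2` and weight `π_γ` the identity is a Caccioppoli inequality. The worst
term after absorbing the drift is of order `|g|² J² ≲ (1 + |x|²)³`, which is integrable against
`π_γ` exactly because `γ > n/2 + 3`. The cutoff in time contributes with a good sign where it rises,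
so nothing is needed at the initial time. Where it falls, near `T`, the total mass of its derivative
is one and the quadratic bound suffices.

Time derivative. The right side `l + g · DJ` is square integrable with weight `π_{γ+1}`, the linear
growth of `g` costing one power of `1 + |x|²`. The Caccioppoli inequality for `∂ᵢJ`
(`caccioppoli_fderiv`) then bounds the Hessian, and the equation bounds `∂ₛJ`. The delicate term is
`|∂ᵢJ|²` near the terminal time, where only the continuity of `J` is known. There the time scale of
the mollifier is chosen much smaller than its space scale, so that `J` may be replaced by `l_T`
under the differentiated kernel, and the growth of `Dl_T` takes over
(`IsStrongSolution.exists_mollifierSeq`).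

Uniformity in `σ` comes from compactness: trace and determinant of `σσᵀ` control the ellipticity
constant (`exists_ellipticity`). -/

section

open Filter Topology

set_option linter.unusedSectionVars false

/-! ### Convolution with a smooth kernel. -/

section Mollify

variable {V : Type*} [NormedAddCommGroup V] [NormedSpace ℝ V] [FiniteDimensional ℝ V]
  [MeasureSpace V] [BorelSpace V] [(volume : Measure V).IsAddHaarMeasure]

/-- The convolution of `f` with the kernel `κ`. -/
noncomputable def mollify (κ f : V → ℝ) (z : V) : ℝ := ∫ y, f y * κ (z - y)

theorem mollify_eq_convolution (κ f : V → ℝ) :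
    mollify κ f = convolution f κ (ContinuousLinearMap.lsmul ℝ ℝ) volume := by
  ext z
  simp [mollify, convolution]

theorem mollify_eq_integral_sub (κ f : V → ℝ) (z : V) :
    mollify κ f z = ∫ h, κ h * f (z - h) := by
  rw [mollify_eq_convolution, convolution_eq_swap]
  simp [mul_comm]

theorem contDiff_mollify {κ f : V → ℝ} (hκ : ContDiff ℝ ∞ κ) (hc : HasCompactSupport κ)
    (hf : LocallyIntegrable f) : ContDiff ℝ ∞ (mollify κ f) := by
  rw [mollify_eq_convolution]
  exact hc.contDiff_convolution_right _ hf hκ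

theorem fderiv_mollify {κ f : V → ℝ} (hκ : ContDiff ℝ ∞ κ) (hc : HasCompactSupport κ)
    (hf : LocallyIntegrable f) (v z : V) :
    fderiv ℝ (mollify κ f) z v = mollify (fun y => fderiv ℝ κ y v) f z := by
  have h1 : ContDiff ℝ 1 κ := hκ.of_le (by simp)
  rw [mollify_eq_convolution, mollify_eq_convolution,
    (hc.hasFDerivAt_convolution_right (ContinuousLinearMap.lsmul ℝ ℝ) hf h1 z).fderiv]
  exact convolution_precompR_apply _ hf (hc.fderiv ℝ) (h1.continuous_fderiv one_ne_zero) z v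

theorem contDiff_fderiv_apply {f : V → ℝ} (hf : ContDiff ℝ ∞ f) (v : V) :
    ContDiff ℝ ∞ (fun z => fderiv ℝ f z v) :=
  (hf.fderiv_right (m := ∞) (by simp)).clm_apply contDiff_const

theorem HasCompactSupport.fderiv_apply' {f : V → ℝ} (hf : HasCompactSupport f) (v : V) :
    HasCompactSupport (fun z => fderiv ℝ f z v) :=
  (hf.fderiv ℝ).comp_left (g := fun L : V →L[ℝ] ℝ => L v) (by simp)

/-- Continuity of translations in `L²`: a translation is composition with a measure preserving map
that depends continuously on the shift, and such compositions act continuously on `Lp`. -/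
theorem tendsto_integral_sub_translate_sq {f : V → ℝ} (hf : MemLp f 2) :
    Tendsto (fun h => ∫ z, (f (z - h) - f z) ^ 2) (𝓝 0) (𝓝 0) := by
  have : Fact ((1 : ENNReal) ≤ 2) := ⟨by norm_num⟩
  let g : V → C(V, V) := fun h => ⟨fun z => z - h, by fun_prop⟩
  have hmp : ∀ h, MeasurePreserving (g h) (volume : Measure V) volume := fun h =>
    measurePreserving_sub_right volume h
  have hg : Tendsto g (𝓝 0) (𝓝 (g 0)) := by
    have : Continuous g := by
      refine ContinuousMap.continuous_of_continuous_uncurry g ?_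
      change Continuous (fun p : V × V => p.2 - p.1)
      fun_prop
    exact this.tendsto 0
  have key := (tendsto_const_nhds (x := hf.toLp f)).compMeasurePreservingLp hg hmp (hmp 0)
    (by norm_num)
  have h0 : Lp.compMeasurePreserving (g 0) (hmp 0) (hf.toLp f) = hf.toLp f := by
    rw [Lp.toLp_compMeasurePreserving hf (hmp 0)]
    congr 1
    ext z
    simp [g]
  rw [h0] at key
  have key2 := (tendsto_iff_norm_sub_tendsto_zero.1 key).pow 2
  simp only [ne_eq, OfNat.ofNat_ne_zero, not_false_eq_true, zero_pow] at key2
  refine key2.congr fun h => ?_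
  rw [Lp.toLp_compMeasurePreserving hf (hmp h), ← MemLp.toLp_sub, ← real_inner_self_eq_norm_sq,
    L2.inner_def]
  refine integral_congr_ae ?_
  filter_upwards [((hf.comp_measurePreserving (hmp h)).sub hf).coeFn_toLp] with z hz
  rw [hz]
  simp [g, sq]

/-- Jensen's inequality for the probability measure with density `κ`, followed by Tonelli: the `L²`
error of mollification is an average of `L²` errors of translations over the support of `κ`. -/
theorem lintegral_mollify_sub_sq_le {κ f : V → ℝ} (hκ : Continuous κ) (hκ0 : ∀ z, 0 ≤ κ z)
    (hκ1 : ∫ z, κ z = 1) (hc : HasCompactSupport κ) (hf : MemLp f 2) {η : ℝ}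
    (h : ∀ h, κ h ≠ 0 → ∫ z, (f (z - h) - f z) ^ 2 ≤ η) :
    ∫⁻ z, ENNReal.ofReal ((mollify κ f z - f z) ^ 2) ≤ ENNReal.ofReal η := by
  have hκi : Integrable κ := hκ.integrable_of_hasCompactSupport hc
  have hfl : LocallyIntegrable f := hf.locallyIntegrable (by norm_num)
  have hmeas : AEStronglyMeasurable (fun p : V × V => f (p.1 - p.2) - f p.1)
      ((volume : Measure V).prod volume) := by
    refine AEStronglyMeasurable.sub ?_ ?_
    · exact hf.1.comp_quasiMeasurePreserving
        (quasiMeasurePreserving_sub_of_right_invariant volume volume)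
    · exact hf.1.comp_fst
  have hjensen : ∀ᵐ z : V, ENNReal.ofReal ((mollify κ f z - f z) ^ 2) ≤
      ∫⁻ h, ENNReal.ofReal (κ h) * ENNReal.ofReal ((f (z - h) - f z) ^ 2) := by
    filter_upwards [hmeas.prodMk_left] with z hz
    -- For this measure, Jensen is the monotonicity of `L^p` norms between exponents 1 and 2.
    let ν : Measure V := volume.withDensity fun h => ENNReal.ofReal (κ h)
    have hκm : Measurable fun h => ENNReal.ofReal (κ h) := hκ.measurable.ennreal_ofReal
    have : IsProbabilityMeasure ν := ⟨by
      rw [withDensity_apply _ MeasurableSet.univ, Measure.restrict_univ,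
        ← ofReal_integral_eq_lintegral_ofReal hκi (ae_of_all _ hκ0), hκ1, ENNReal.ofReal_one]⟩
    have hzν : AEStronglyMeasurable (fun h => f (z - h) - f z) ν :=
      hz.mono_ac (withDensity_absolutelyContinuous _ _)
    have e1 : mollify κ f z - f z = ∫ h, (f (z - h) - f z) ∂ν := by
      rw [integral_withDensity_eq_integral_toReal_smul hκm (ae_of_all _ fun _ => by simp)]
      simp only [ENNReal.toReal_ofReal (hκ0 _), smul_eq_mul]
      have i1 : Integrable fun h => κ h * f (z - h) := by
        have := (hc.convolutionExists_left (ContinuousLinearMap.lsmul ℝ ℝ) hκ hfl z)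
        simpa [ConvolutionExistsAt] using this
      simp only [mul_sub]
      rw [integral_sub i1 (hκi.mul_const _), integral_mul_const, hκ1, mollify_eq_integral_sub]
      ring
    have e2 : ‖∫ h, (f (z - h) - f z) ∂ν‖ₑ ≤ eLpNorm (fun h => f (z - h) - f z) 2 ν := by
      refine (enorm_integral_le_lintegral_enorm _).trans ?_
      rw [← eLpNorm_one_eq_lintegral_enorm]
      exact eLpNorm_le_eLpNorm_of_exponent_le (by norm_num) hzν
    have e3 : ENNReal.ofReal ((mollify κ f z - f z) ^ 2) = ‖∫ h, (f (z - h) - f z) ∂ν‖ₑ ^ 2 := by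
      rw [← e1, ← sq_abs, ENNReal.ofReal_pow (abs_nonneg _), ← Real.norm_eq_abs,
        ofReal_norm]
    have e4 : eLpNorm (fun h => f (z - h) - f z) 2 ν ^ 2 =
        ∫⁻ h, ENNReal.ofReal (κ h) * ENNReal.ofReal ((f (z - h) - f z) ^ 2) := by
      have := eLpNorm_nnreal_pow_eq_lintegral (f := fun h => f (z - h) - f z) (μ := ν)
        (p := 2) (by norm_num)
      simp only [NNReal.coe_ofNat, ENNReal.rpow_ofNat, ENNReal.coe_ofNat] at this
      rw [this, lintegral_withDensity_eq_lintegral_mul₀' hκm.aemeasurable]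
      · refine lintegral_congr fun h => ?_
        simp only [Pi.mul_apply]
        congr 1
        rw [← sq_abs (f (z - h) - f z), ENNReal.ofReal_pow (abs_nonneg _), ← Real.norm_eq_abs,
          ofReal_norm]
      · exact (hzν.enorm.pow_const 2)
    rw [e3, ← e4]
    gcongr
  refine (lintegral_mono_ae hjensen).trans ?_
  rw [lintegral_lintegral_swap]
  · have hbd : ∀ h, ∫⁻ z, ENNReal.ofReal (κ h) * ENNReal.ofReal ((f (z - h) - f z) ^ 2) ≤
        ENNReal.ofReal (κ h) * ENNReal.ofReal η := by
      intro y
      by_cases hy : κ y = 0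
      · simp [hy]
      rw [lintegral_const_mul' _ _ ENNReal.ofReal_ne_top,
        ← ofReal_integral_eq_lintegral_ofReal _ (ae_of_all _ fun z => sq_nonneg _)]
      · gcongr
        exact h y hy
      · exact ((hf.comp_measurePreserving (measurePreserving_sub_right volume y)).sub hf).integrable_sq
    refine (lintegral_mono hbd).trans ?_
    rw [lintegral_mul_const' _ _ ENNReal.ofReal_ne_top,
      ← ofReal_integral_eq_lintegral_ofReal hκi (ae_of_all _ hκ0), hκ1]
    simp
  · have m1 : AEMeasurable (fun p : V × V => ENNReal.ofReal (κ p.2))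
        ((volume : Measure V).prod volume) :=
      (hκ.measurable.ennreal_ofReal.comp measurable_snd).aemeasurable
    exact m1.mul (hmeas.aemeasurable.pow_const 2).ennreal_ofReal

theorem memLp_mollify_sub {κ f : V → ℝ} (hκ : ContDiff ℝ ∞ κ) (hκ0 : ∀ z, 0 ≤ κ z)
    (hκ1 : ∫ z, κ z = 1) (hc : HasCompactSupport κ) (hf : MemLp f 2) {η : ℝ}
    (h : ∀ h, κ h ≠ 0 → ∫ z, (f (z - h) - f z) ^ 2 ≤ η) :
    MemLp (fun z => mollify κ f z - f z) 2 ∧ ∫ z, (mollify κ f z - f z) ^ 2 ≤ η := by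
  have hfl : LocallyIntegrable f := hf.locallyIntegrable (by norm_num)
  have key := lintegral_mollify_sub_sq_le hκ.continuous hκ0 hκ1 hc hf h
  have hm : AEStronglyMeasurable (fun z => mollify κ f z - f z) volume :=
    (contDiff_mollify hκ hc hfl).continuous.aestronglyMeasurable.sub hf.1
  have hη : 0 ≤ η := by
    obtain ⟨y, hy⟩ : ∃ y, κ y ≠ 0 := by
      by_contra! hcon
      simp [hcon] at hκ1
    exact (integral_nonneg fun _ => sq_nonneg _).trans (h y hy)
  have hi : Integrable fun z => (mollify κ f z - f z) ^ 2 := by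
    refine ⟨hm.pow 2, ?_⟩
    rw [hasFiniteIntegral_iff_ofReal (ae_of_all _ fun _ => sq_nonneg _)]
    exact key.trans_lt ENNReal.ofReal_lt_top
  refine ⟨(memLp_two_iff_integrable_sq hm).2 hi, ?_⟩
  rw [← ofReal_integral_eq_lintegral_ofReal hi (ae_of_all _ fun _ => sq_nonneg _)] at key
  exact (ENNReal.ofReal_le_ofReal_iff hη).1 key

theorem abs_mollify_sub_le {κ f : V → ℝ} (hκ : Continuous κ) (hκ0 : ∀ z, 0 ≤ κ z)
    (hκ1 : ∫ z, κ z = 1) (hc : HasCompactSupport κ) (hf : LocallyIntegrable f) {z : V} {c η : ℝ}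
    (h : ∀ h, κ h ≠ 0 → |f (z - h) - c| ≤ η) : |mollify κ f z - c| ≤ η := by
  have hκi : Integrable κ := hκ.integrable_of_hasCompactSupport hc
  have i1 : Integrable fun h => κ h * f (z - h) := by
    have := (hc.convolutionExists_left (ContinuousLinearMap.lsmul ℝ ℝ) hκ hf z)
    simpa [ConvolutionExistsAt] using this
  have e1 : mollify κ f z - c = ∫ h, κ h * (f (z - h) - c) := by
    simp only [mul_sub]
    rw [integral_sub i1 (hκi.mul_const _), integral_mul_const, hκ1, mollify_eq_integral_sub]
    ring
  have e2 : η = ∫ h, κ h * η := by rw [integral_mul_const, hκ1, one_mul]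
  rw [e1, ← Real.norm_eq_abs, e2]
  refine norm_integral_le_of_norm_le (hκi.mul_const _) (ae_of_all _ fun y => ?_)
  rw [norm_mul, Real.norm_eq_abs, Real.norm_eq_abs, abs_of_nonneg (hκ0 y)]
  by_cases hy : κ y = 0
  · simp [hy]
  · exact mul_le_mul_of_nonneg_left (h y hy) (hκ0 y)

end Mollify
-- Mollifiers in time and space, and weak derivatives.
instance isAddHaarMeasure_volume_prod (n : ℕ) :
    (volume : Measure (ℝ × EuclideanSpace ℝ (Fin n))).IsAddHaarMeasure := by
  rw [Measure.volume_eq_prod]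
  infer_instance

/-- The time direction in `ℝ × ℝⁿ`. -/
abbrev dirT (n : ℕ) : ℝ × EuclideanSpace ℝ (Fin n) := (1, 0)

/-- The `i`-th space direction in `ℝ × ℝⁿ`. -/
noncomputable abbrev dirX {n : ℕ} (i : Fin n) : ℝ × EuclideanSpace ℝ (Fin n) :=
  (0, EuclideanSpace.single i 1)

/-- A smooth probability density on `ℝ × ℝⁿ` supported in `[-δ, δ] × closedBall 0 ε`. -/
structure IsMollifier {n : ℕ} (κ : ℝ × EuclideanSpace ℝ (Fin n) → ℝ) (δ ε : ℝ) : Prop where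
  contDiff : ContDiff ℝ ∞ κ
  hasCompactSupport : HasCompactSupport κ
  nonneg : ∀ z, 0 ≤ κ z
  integral_eq_one : ∫ z, κ z = 1
  supp : ∀ z, κ z ≠ 0 → |z.1| ≤ δ ∧ ‖z.2‖ ≤ ε

/-- The box `[s - δ, s + δ] × closedBall x ε` around `(s, x)`. -/
def box {n : ℕ} (z : ℝ × EuclideanSpace ℝ (Fin n)) (δ ε : ℝ) :
    Set (ℝ × EuclideanSpace ℝ (Fin n)) :=
  Icc (z.1 - δ) (z.1 + δ) ×ˢ Metric.closedBall z.2 ε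

theorem isCompact_box {n : ℕ} (z : ℝ × EuclideanSpace ℝ (Fin n)) (δ ε : ℝ) :
    IsCompact (box z δ ε) :=
  isCompact_Icc.prod (isCompact_closedBall _ _)

theorem sub_mem_box_iff {n : ℕ} {z y : ℝ × EuclideanSpace ℝ (Fin n)} {δ ε : ℝ} :
    z - y ∈ box 0 δ ε ↔ y ∈ box z δ ε := by
  simp only [box, mem_prod, mem_Icc, Prod.fst_sub, Prod.snd_sub, Prod.fst_zero, Prod.snd_zero,
    Metric.mem_closedBall, dist_eq_norm, zero_sub, zero_add, sub_zero]
  rw [norm_sub_rev y.2 z.2]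
  constructor <;> rintro ⟨⟨h1, h2⟩, h3⟩ <;> refine ⟨⟨?_, ?_⟩, h3⟩ <;> linarith

theorem IsMollifier.support_subset {n : ℕ} {κ : ℝ × EuclideanSpace ℝ (Fin n) → ℝ} {δ ε : ℝ}
    (h : IsMollifier κ δ ε) : Function.support κ ⊆ box 0 δ ε := by
  intro z hz
  obtain ⟨h1, h2⟩ := h.supp z hz
  rw [abs_le] at h1
  simpa [box, h2] using h1

theorem support_fderiv_apply_subset {n : ℕ} {k : ℝ × EuclideanSpace ℝ (Fin n) → ℝ}
    {S : Set (ℝ × EuclideanSpace ℝ (Fin n))} (hS : IsClosed S) (hk : Function.support k ⊆ S)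
    (v : ℝ × EuclideanSpace ℝ (Fin n)) :
    Function.support (fun z => fderiv ℝ k z v) ⊆ S := by
  intro z hz
  have : z ∈ Function.support (fderiv ℝ k) := fun h => hz (by simp [h])
  exact closure_minimal hk hS (support_fderiv_subset ℝ this)

/-- Only values in the box around `z` matter, so extending by zero outside `G` is harmless and the
domain of integration may be changed at will. -/
theorem mollify_indicator_eq_setIntegral {n : ℕ} {k f : ℝ × EuclideanSpace ℝ (Fin n) → ℝ}
    {δ ε : ℝ} (hk : Function.support k ⊆ box 0 δ ε) {z : ℝ × EuclideanSpace ℝ (Fin n)}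
    {G Ω : Set (ℝ × EuclideanSpace ℝ (Fin n))} (hΩ : MeasurableSet Ω)
    (hG : box z δ ε ⊆ G) (hG' : box z δ ε ⊆ Ω) :
    mollify k (G.indicator f) z = ∫ y in Ω, f y * k (z - y) := by
  rw [← integral_indicator hΩ]
  refine integral_congr_ae (ae_of_all _ fun y => ?_)
  by_cases hy : k (z - y) = 0
  · simp [hy, Set.indicator]
  · have : y ∈ box z δ ε := sub_mem_box_iff.1 (hk hy)
    simp [Set.indicator, hG this, hG' this]

theorem measurableSet_openSlab (n : ℕ) (t T : ℝ) : MeasurableSet (openSlab n t T) :=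
  measurableSet_Ioo.prod MeasurableSet.univ

/-- The translate and reflection `y ↦ k (z - y)` is an admissible test function; the sign from the
reflection cancels the sign in the definition of the weak derivative. The kernel `k` need not be a
mollifier, so that derivatives of mollifiers are allowed too. -/
theorem mollify_fderiv_eq_of_hasWeakDeriv {n : ℕ} {t T : ℝ}
    {v : ℝ × EuclideanSpace ℝ (Fin n)} {u w k : ℝ × EuclideanSpace ℝ (Fin n) → ℝ}
    (hu : HasWeakDeriv (openSlab n t T) v u w) (hk : ContDiff ℝ ∞ k)
    {δ ε : ℝ} (hks : Function.support k ⊆ box 0 δ ε) {z : ℝ × EuclideanSpace ℝ (Fin n)}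
    {G : Set (ℝ × EuclideanSpace ℝ (Fin n))} (hG : box z δ ε ⊆ G)
    (hΩ : box z δ ε ⊆ openSlab n t T) :
    mollify (fun y => fderiv ℝ k y v) (G.indicator u) z = mollify k (G.indicator w) z := by
  have hcl : IsClosed (box z δ ε) := (isCompact_box z δ ε).isClosed
  have hsupp : Function.support (fun y => k (z - y)) ⊆ box z δ ε := fun y hy =>
    sub_mem_box_iff.1 (hks hy)
  have hts : tsupport (fun y => k (z - y)) ⊆ box z δ ε := closure_minimal hsupp hcl
  have hφ : ContDiff ℝ ∞ (fun y => k (z - y)) := hk.comp (contDiff_const.sub contDiff_id)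
  have key := hu.2.2 (fun y => k (z - y)) hφ
    (HasCompactSupport.of_support_subset_isCompact (isCompact_box z δ ε) hsupp) (hts.trans hΩ)
  have hd : ∀ y, fderiv ℝ (fun y => k (z - y)) y v = -fderiv ℝ k (z - y) v := by
    intro y
    have h1 : HasFDerivAt (fun y => k (z - y)) _ y :=
      ((hk.differentiable (by simp)) (z - y)).hasFDerivAt.comp y
        ((hasFDerivAt_const z y).sub (hasFDerivAt_id y))
    rw [h1.fderiv]
    simp
  simp only [hd, mul_neg, integral_neg] at key
  rw [mollify_indicator_eq_setIntegral (support_fderiv_apply_subset (isCompact_box _ _ _).isClosed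
      hks v) (measurableSet_openSlab n t T) hG hΩ,
    mollify_indicator_eq_setIntegral hks (measurableSet_openSlab n t T) hG hΩ]
  linarith

/-- The matrix of second space derivatives. -/
noncomputable def hessX {n : ℕ} (u : ℝ × EuclideanSpace ℝ (Fin n) → ℝ)
    (z : ℝ × EuclideanSpace ℝ (Fin n)) : Matrix (Fin n) (Fin n) ℝ :=
  fun i j => fderiv ℝ (fun y => fderiv ℝ u y (dirX j)) z (dirX i)

/-- The operator `-∂ₛ + 𝒜`. -/
noncomputable def parabolicOp {n : ℕ} (a : Matrix (Fin n) (Fin n) ℝ)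
    (u : ℝ × EuclideanSpace ℝ (Fin n) → ℝ) (z : ℝ × EuclideanSpace ℝ (Fin n)) : ℝ :=
  -fderiv ℝ u z (dirT n) + diffusionOp a (hessX u z)

section

variable {n : ℕ} {a : Matrix (Fin n) (Fin n) ℝ} {t T : ℝ}
  {g : ℝ × EuclideanSpace ℝ (Fin n) → EuclideanSpace ℝ (Fin n)}
  {l : ℝ × EuclideanSpace ℝ (Fin n) → ℝ} {lT : EuclideanSpace ℝ (Fin n) → ℝ}
  {J Js : ℝ × EuclideanSpace ℝ (Fin n) → ℝ}
  {DJ : ℝ × EuclideanSpace ℝ (Fin n) → EuclideanSpace ℝ (Fin n)}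
  {HJ : ℝ × EuclideanSpace ℝ (Fin n) → Matrix (Fin n) (Fin n) ℝ}
  {κ : ℝ × EuclideanSpace ℝ (Fin n) → ℝ} {δ ε : ℝ}
  {G : Set (ℝ × EuclideanSpace ℝ (Fin n))} {z : ℝ × EuclideanSpace ℝ (Fin n)}

theorem fderiv_mollify_eq_of_hasWeakDeriv {v : ℝ × EuclideanSpace ℝ (Fin n)}
    {u w : ℝ × EuclideanSpace ℝ (Fin n) → ℝ}
    (hu : HasWeakDeriv (openSlab n t T) v u w) (hκ : IsMollifier κ δ ε)
    (hl : LocallyIntegrable (G.indicator u)) (hG : box z δ ε ⊆ G)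
    (hΩ : box z δ ε ⊆ openSlab n t T) :
    fderiv ℝ (mollify κ (G.indicator u)) z v = mollify κ (G.indicator w) z := by
  rw [fderiv_mollify hκ.contDiff hκ.hasCompactSupport hl]
  exact mollify_fderiv_eq_of_hasWeakDeriv hu hκ.contDiff hκ.support_subset hG hΩ

/-- Both derivatives are put on the kernel and then taken off one at a time: first onto `J`, giving
`DJ`, then onto `DJ`, giving `HJ`. -/
theorem IsStrongSolution.hessX_mollify (hJ : IsStrongSolution a g l lT t T J Js DJ HJ)
    (hκ : IsMollifier κ δ ε) (hl : LocallyIntegrable (G.indicator J)) (hG : box z δ ε ⊆ G)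
    (hΩ : box z δ ε ⊆ openSlab n t T) (i j : Fin n) :
    hessX (mollify κ (G.indicator J)) z i j = mollify κ (G.indicator fun y => HJ y i j) z := by
  have h1 : (fun y => fderiv ℝ (mollify κ (G.indicator J)) y (dirX j)) =
      mollify (fun y => fderiv ℝ κ y (dirX j)) (G.indicator J) := by
    ext y
    exact fderiv_mollify hκ.contDiff hκ.hasCompactSupport hl _ _
  have hc1 := contDiff_fderiv_apply hκ.contDiff (dirX j)
  rw [hessX, h1, fderiv_mollify hc1 (hκ.hasCompactSupport.fderiv_apply' _) hl,
    mollify_fderiv_eq_of_hasWeakDeriv (hJ.weakDeriv_space i) hc1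
      (support_fderiv_apply_subset (isCompact_box _ _ _).isClosed hκ.support_subset _) hG hΩ,
    mollify_fderiv_eq_of_hasWeakDeriv (hJ.weakDeriv_hess i j) hκ.contDiff hκ.support_subset hG hΩ]

theorem integrableOn_mul_of_isL2Loc {w k : ℝ × EuclideanSpace ℝ (Fin n) → ℝ}
    {Ω S : Set (ℝ × EuclideanSpace ℝ (Fin n))} (hw : IsL2Loc Ω w) (hk : Continuous k)
    (hS : IsCompact S) (hSΩ : S ⊆ Ω) : IntegrableOn (fun y => w y * k y) S := by
  have : IntegrableOn w S := by
    have : IsFiniteMeasure (volume.restrict S) := ⟨by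
      rw [Measure.restrict_apply_univ]; exact hS.measure_lt_top⟩
    exact (hw S hS hSΩ).integrable (by norm_num)
  exact this.mul_continuousOn hk.continuousOn hS

/-- Constant coefficients commute with convolution. The drift is not mollified separately: the
product `g · DJ` stays inside, and no regularity of `g` is required. -/
theorem IsStrongSolution.parabolicOp_mollify (hJ : IsStrongSolution a g l lT t T J Js DJ HJ)
    (hκ : IsMollifier κ δ ε) (hl : LocallyIntegrable (G.indicator J)) (hG : box z δ ε ⊆ G)
    (hΩ : box z δ ε ⊆ openSlab n t T) :
    parabolicOp a (mollify κ (G.indicator J)) z =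
      mollify κ (G.indicator fun y => l y + inner ℝ (g y) (DJ y)) z := by
  have hbm : MeasurableSet (box z δ ε) := (isCompact_box z δ ε).measurableSet
  have hbox := fun f : ℝ × EuclideanSpace ℝ (Fin n) → ℝ =>
    mollify_indicator_eq_setIntegral (f := f) hκ.support_subset hbm hG subset_rfl
  have hkc : Continuous fun y => κ (z - y) := hκ.contDiff.continuous.comp (by fun_prop)
  have hint : ∀ w, IsL2Loc (openSlab n t T) w →
      IntegrableOn (fun y => w y * κ (z - y)) (box z δ ε) := fun w hw =>
    integrableOn_mul_of_isL2Loc hw hkc (isCompact_box z δ ε) hΩ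
  have hHi := fun i j => hint _ (hJ.weakDeriv_hess i j).2.1
  rw [parabolicOp, fderiv_mollify_eq_of_hasWeakDeriv hJ.weakDeriv_time hκ hl hG hΩ]
  unfold diffusionOp
  simp only [hJ.hessX_mollify hκ hl hG hΩ, hbox]
  have h2 : ∫ y in box z δ ε, (l y + inner ℝ (g y) (DJ y)) * κ (z - y) =
      ∫ y in box z δ ε, (-(Js y * κ (z - y)) +
        -(1 / 2) * ∑ i, ∑ j, a i j * (HJ y i j * κ (z - y))) := by
    refine integral_congr_ae ?_
    filter_upwards [ae_restrict_of_ae_restrict_of_subset hΩ hJ.equation] with y hy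
    have : l y + inner ℝ (g y) (DJ y) = -Js y + diffusionOp a (HJ y) := by linarith
    rw [this, diffusionOp, add_mul, neg_mul, mul_assoc, Finset.sum_mul]
    simp only [Finset.sum_mul, mul_assoc]
  have hsum : IntegrableOn (fun y => ∑ i, ∑ j, a i j * (HJ y i j * κ (z - y))) (box z δ ε) :=
    integrable_finsetSum _ fun i _ => integrable_finsetSum _ fun j _ => (hHi i j).const_mul _
  have h3 : ∫ y in box z δ ε, (-(Js y * κ (z - y)) +
        -(1 / 2) * ∑ i, ∑ j, a i j * (HJ y i j * κ (z - y))) =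
      (∫ y in box z δ ε, -(Js y * κ (z - y))) +
        ∫ y in box z δ ε, -(1 / 2) * ∑ i, ∑ j, a i j * (HJ y i j * κ (z - y)) :=
    integral_add (hint _ hJ.weakDeriv_time.2.1).neg (hsum.const_mul _)
  rw [h2, h3, integral_neg, integral_const_mul, integral_finsetSum]
  · congr 2
    refine Finset.sum_congr rfl fun i _ => ?_
    rw [integral_finsetSum]
    · simp only [integral_const_mul]
    · exact fun j _ => (hHi i j).const_mul _
  · exact fun i _ => integrable_finsetSum _ fun j _ => (hHi i j).const_mul _

end

/-! ### Mollifying sequences and their convergence. -/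

/-- The kernel is a product of a time bump and a space bump, so the `L¹` norm of its space
derivatives sees only `ε`. That `C` precedes `δ` is what later allows `δ` to be chosen in terms of
`C`. -/
theorem exists_isMollifier {n : ℕ} {ε : ℝ} (hε : 0 < ε) :
    ∃ C : ℝ, 0 ≤ C ∧ ∀ δ : ℝ, 0 < δ → ∃ κ : ℝ × EuclideanSpace ℝ (Fin n) → ℝ,
      IsMollifier κ δ ε ∧ ∀ i, ∫ z, |fderiv ℝ κ z (dirX i)| ≤ C := by
  let β : ContDiffBump (0 : EuclideanSpace ℝ (Fin n)) := ⟨ε / 2, ε, by linarith, by linarith⟩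
  let b : EuclideanSpace ℝ (Fin n) → ℝ := β.normed volume
  refine ⟨∑ i, ∫ x, |fderiv ℝ b x (EuclideanSpace.single i 1)|,
    Finset.sum_nonneg fun i _ => integral_nonneg fun _ => abs_nonneg _, fun δ hδ => ?_⟩
  let α : ContDiffBump (0 : ℝ) := ⟨δ / 2, δ, by linarith, by linarith⟩
  let c : ℝ → ℝ := α.normed volume
  have hc : ContDiff ℝ ∞ c := α.contDiff_normed
  have hb : ContDiff ℝ ∞ b := β.contDiff_normed
  have hc0 : ∀ s, 0 ≤ c s := α.nonneg_normed
  have hsupp : ∀ z : ℝ × EuclideanSpace ℝ (Fin n), c z.1 * b z.2 ≠ 0 →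
      |z.1| ≤ δ ∧ ‖z.2‖ ≤ ε := by
    intro z hz
    have h1 : z.1 ∈ Function.support (α.normed volume) := left_ne_zero_of_mul hz
    have h2 : z.2 ∈ Function.support (β.normed volume) := right_ne_zero_of_mul hz
    rw [ContDiffBump.support_normed_eq] at h1 h2
    simp only [Metric.mem_ball, dist_zero_right, Real.norm_eq_abs] at h1 h2
    exact ⟨h1.le, h2.le⟩
  refine ⟨fun z => c z.1 * b z.2, ⟨?_, ?_, ?_, ?_, hsupp⟩, ?_⟩
  · exact (hc.comp contDiff_fst).mul (hb.comp contDiff_snd)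
  · refine HasCompactSupport.of_support_subset_isCompact (isCompact_box 0 δ ε) fun z hz => ?_
    obtain ⟨h1, h2⟩ := hsupp z hz
    rw [abs_le] at h1
    simpa [box, h2] using h1
  · exact fun z => mul_nonneg (hc0 _) (β.nonneg_normed _)
  · rw [Measure.volume_eq_prod, integral_prod_mul, α.integral_normed, β.integral_normed, one_mul]
  · intro i
    have hd : ∀ z : ℝ × EuclideanSpace ℝ (Fin n), fderiv ℝ (fun z => c z.1 * b z.2) z (dirX i) =
        c z.1 * fderiv ℝ b z.2 (EuclideanSpace.single i 1) := by
      intro z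
      have d1 : HasFDerivAt (fun z : ℝ × EuclideanSpace ℝ (Fin n) => c z.1) _ z :=
        ((hc.differentiable (by simp)) z.1).hasFDerivAt.comp z hasFDerivAt_fst
      have d2 : HasFDerivAt (fun z : ℝ × EuclideanSpace ℝ (Fin n) => b z.2) _ z :=
        ((hb.differentiable (by simp)) z.2).hasFDerivAt.comp z hasFDerivAt_snd
      have d3 : HasFDerivAt (fun z => c z.1 * b z.2) _ z := d1.mul d2
      rw [d3.fderiv]
      simp
    simp only [hd, abs_mul, abs_of_nonneg (hc0 _)]
    rw [Measure.volume_eq_prod,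
      integral_prod_mul c fun x => |fderiv ℝ b x (EuclideanSpace.single i 1)|, α.integral_normed,
      one_mul]
    exact Finset.single_le_sum
      (f := fun i => ∫ x, |fderiv ℝ b x (EuclideanSpace.single i 1)|)
      (fun i _ => integral_nonneg fun _ => abs_nonneg _) (Finset.mem_univ i)

/-- A sequence of mollifiers whose supports shrink to the origin. -/
structure IsMollifierSeq {n : ℕ} (κ : ℕ → ℝ × EuclideanSpace ℝ (Fin n) → ℝ) (δ ε : ℕ → ℝ) :
    Prop where
  isMollifier : ∀ k, IsMollifier (κ k) (δ k) (ε k)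
  tendsto_time : Tendsto δ atTop (𝓝 0)
  tendsto_space : Tendsto ε atTop (𝓝 0)

theorem exists_isMollifierSeq (n : ℕ) :
    ∃ κ : ℕ → ℝ × EuclideanSpace ℝ (Fin n) → ℝ, ∃ δ ε : ℕ → ℝ, IsMollifierSeq κ δ ε := by
  have h : ∀ k : ℕ, ∃ κ : ℝ × EuclideanSpace ℝ (Fin n) → ℝ,
      IsMollifier κ (1 / ((k : ℝ) + 1)) (1 / ((k : ℝ) + 1)) := fun k => by
    obtain ⟨C, -, hC⟩ := exists_isMollifier (n := n) (ε := 1 / ((k : ℝ) + 1)) (by positivity)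
    obtain ⟨κ, hκ, -⟩ := hC (1 / ((k : ℝ) + 1)) (by positivity)
    exact ⟨κ, hκ⟩
  choose κ hκ using h
  exact ⟨κ, _, _, hκ, tendsto_one_div_add_atTop_nhds_zero_nat,
    tendsto_one_div_add_atTop_nhds_zero_nat⟩

section

variable {n : ℕ} {κ : ℕ → ℝ × EuclideanSpace ℝ (Fin n) → ℝ} {δ ε : ℕ → ℝ}

theorem IsMollifierSeq.eventually_small (hκ : IsMollifierSeq κ δ ε)
    {P : ℝ × EuclideanSpace ℝ (Fin n) → Prop} (hP : ∀ᶠ h in 𝓝 0, P h) :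
    ∀ᶠ k in atTop, ∀ h, h ∈ box 0 (δ k) (ε k) → P h := by
  obtain ⟨r, hr, hP⟩ := Metric.eventually_nhds_iff.1 hP
  filter_upwards [hκ.tendsto_time.eventually_lt_const hr,
    hκ.tendsto_space.eventually_lt_const hr] with k h1 h2 h hh
  apply hP
  simp only [box, mem_prod, mem_Icc, Metric.mem_closedBall, dist_zero_right, Prod.fst_zero,
    Prod.snd_zero, zero_sub, zero_add] at hh
  rw [dist_zero_right, Prod.norm_def, max_lt_iff, Real.norm_eq_abs, abs_lt]
  exact ⟨⟨by linarith, by linarith⟩, by linarith⟩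

theorem IsMollifierSeq.eventually_box_subset (hκ : IsMollifierSeq κ δ ε)
    {S G : Set (ℝ × EuclideanSpace ℝ (Fin n))} (hS : IsCompact S) (hG : IsOpen G) (hSG : S ⊆ G) :
    ∀ᶠ k in atTop, ∀ z ∈ S, box z (δ k) (ε k) ⊆ G := by
  obtain ⟨r, hr, hrG⟩ := hS.exists_thickening_subset_open hG hSG
  filter_upwards [hκ.eventually_small (P := fun h => ‖h‖ < r)
    (Metric.eventually_nhds_iff.2 ⟨r, hr, fun h hh => by simpa using hh⟩)] with k hk z hz y hy
  refine hrG (Metric.mem_thickening_iff.2 ⟨z, hz, ?_⟩)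
  rw [dist_comm, dist_eq_norm]
  exact hk _ (sub_mem_box_iff.2 hy)

theorem IsMollifierSeq.tendsto_L2 (hκ : IsMollifierSeq κ δ ε)
    {f : ℝ × EuclideanSpace ℝ (Fin n) → ℝ} (hf : MemLp f 2) {η : ℝ} (hη : 0 < η) :
    ∀ᶠ k in atTop, MemLp (fun z => mollify (κ k) f z - f z) 2 ∧
      ∫ z, (mollify (κ k) f z - f z) ^ 2 ≤ η := by
  filter_upwards [hκ.eventually_small
    ((tendsto_integral_sub_translate_sq hf).eventually_lt_const hη)] with k hk
  have h := hκ.isMollifier k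
  exact memLp_mollify_sub h.contDiff h.nonneg h.integral_eq_one h.hasCompactSupport hf
    fun y hy => (hk y (h.support_subset hy)).le

theorem IsMollifierSeq.eventually_abs_sub_le (hκ : IsMollifierSeq κ δ ε)
    {f : ℝ × EuclideanSpace ℝ (Fin n) → ℝ} {S G : Set (ℝ × EuclideanSpace ℝ (Fin n))}
    (hS : IsCompact S) (hG : IsOpen G) (hSG : S ⊆ G) (hf : ContinuousOn f G)
    (hl : LocallyIntegrable (G.indicator f)) {η : ℝ} (hη : 0 < η) :
    ∀ᶠ k in atTop, ∀ z ∈ S, |mollify (κ k) (G.indicator f) z - f z| ≤ η := by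
  have hunif : ∀ᶠ h in 𝓝 (0 : ℝ × EuclideanSpace ℝ (Fin n)),
      ∀ z ∈ S, |G.indicator f (z - h) - f z| ≤ η := by
    have hcont : ∀ z ∈ S, ContinuousAt (G.indicator f) z := fun z hz =>
      (hf.continuousAt (hG.mem_nhds (hSG hz))).congr
        ((eqOn_indicator.symm.eventuallyEq_of_mem (hG.mem_nhds (hSG hz))))
    have hu := hS.uniformContinuousAt_of_continuousAt (G.indicator f) hcont
      (Metric.dist_mem_uniformity hη)
    obtain ⟨r, hr, hru⟩ := Metric.mem_uniformity_dist.1 hu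
    refine Metric.eventually_nhds_iff.2 ⟨r, hr, fun h hh z hz => ?_⟩
    have := hru (a := z) (b := z - h) (by simpa [dist_eq_norm] using hh) hz
    simp only [mem_ofPred_eq, Real.dist_eq, indicator_of_mem (hSG hz)] at this
    rw [abs_sub_comm]
    exact this.le
  filter_upwards [hκ.eventually_small hunif] with k hk z hz
  have h := hκ.isMollifier k
  exact abs_mollify_sub_le h.contDiff.continuous h.nonneg h.integral_eq_one h.hasCompactSupport hl
    fun y hy => hk y (h.support_subset hy) z hz

end

/-! ### Quadratic forms and uniform ellipticity. -/

/-- The bilinear form `∑ᵢⱼ aᵢⱼ ξᵢ ηⱼ`. -/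
noncomputable def quadForm {n : ℕ} (a : Matrix (Fin n) (Fin n) ℝ) (ξ η : Fin n → ℝ) : ℝ :=
  ∑ i, ∑ j, a i j * (ξ i * η j)

theorem quadForm_mul_transpose {n : ℕ} (σ : Matrix (Fin n) (Fin n) ℝ) (ξ : Fin n → ℝ) :
    quadForm (σ * σ.transpose) ξ ξ = ∑ k, (∑ i, σ i k * ξ i) ^ 2 := by
  have h : ∀ k, (∑ i, σ i k * ξ i) ^ 2 = ∑ i, ∑ j, σ i k * ξ i * (σ j k * ξ j) := fun k => by
    rw [sq, Finset.sum_mul_sum]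
  simp only [quadForm, Matrix.mul_apply, Matrix.transpose_apply, h, Finset.sum_mul]
  conv_rhs => rw [Finset.sum_comm]
  refine Finset.sum_congr rfl fun i _ => ?_
  conv_rhs => rw [Finset.sum_comm]
  refine Finset.sum_congr rfl fun j _ => Finset.sum_congr rfl fun k _ => ?_
  ring

theorem sq_entry_le_trace {n : ℕ} (σ : Matrix (Fin n) (Fin n) ℝ) (i j : Fin n) :
    σ i j ^ 2 ≤ (σ * σ.transpose).trace := by
  have : (σ * σ.transpose).trace = ∑ i, ∑ j, σ i j ^ 2 := by
    simp [Matrix.trace, Matrix.mul_apply, sq]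
  rw [this]
  calc σ i j ^ 2 ≤ ∑ j, σ i j ^ 2 :=
        Finset.single_le_sum (f := fun j => σ i j ^ 2) (fun _ _ => sq_nonneg _) (Finset.mem_univ j)
    _ ≤ _ := Finset.single_le_sum (f := fun i => ∑ j, σ i j ^ 2)
        (fun _ _ => Finset.sum_nonneg fun _ _ => sq_nonneg _) (Finset.mem_univ i)

theorem trace_mul_transpose_nonneg {n : ℕ} (σ : Matrix (Fin n) (Fin n) ℝ) :
    0 ≤ (σ * σ.transpose).trace := by
  simp only [Matrix.trace, Matrix.diag, Matrix.mul_apply, Matrix.transpose_apply]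
  exact Finset.sum_nonneg fun _ _ => Finset.sum_nonneg fun _ _ => mul_self_nonneg _

theorem abs_mul_transpose_le_trace {n : ℕ} (σ : Matrix (Fin n) (Fin n) ℝ) (i j : Fin n) :
    |(σ * σ.transpose) i j| ≤ (σ * σ.transpose).trace := by
  have hrow : ∀ i, ∑ k, σ i k ^ 2 ≤ (σ * σ.transpose).trace := fun i => by
    have : (σ * σ.transpose).trace = ∑ i, ∑ j, σ i j ^ 2 := by
      simp [Matrix.trace, Matrix.mul_apply, sq]
    rw [this]
    exact Finset.single_le_sum (f := fun i => ∑ j, σ i j ^ 2)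
        (fun _ _ => Finset.sum_nonneg fun _ _ => sq_nonneg _) (Finset.mem_univ i)
  rw [Matrix.mul_apply]
  calc |∑ k, σ i k * σ.transpose k j| ≤ ∑ k, |σ i k * σ j k| := Finset.abs_sum_le_sum_abs _ _
    _ ≤ ∑ k, (σ i k ^ 2 + σ j k ^ 2) / 2 := Finset.sum_le_sum fun k _ => by
        rw [abs_le]
        constructor <;> nlinarith [sq_nonneg (σ i k + σ j k), sq_nonneg (σ i k - σ j k)]
    _ = ((∑ k, σ i k ^ 2) + ∑ k, σ j k ^ 2) / 2 := by
        rw [← Finset.sum_div, Finset.sum_add_distrib]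
    _ ≤ _ := by linarith [hrow i, hrow j]

theorem abs_quadForm_le {n : ℕ} {a : Matrix (Fin n) (Fin n) ℝ} {τ : ℝ}
    (ha : ∀ i j, |a i j| ≤ τ) (ξ η : Fin n → ℝ) {c : ℝ} (hc : 0 < c) :
    |quadForm a ξ η| ≤ τ * n * (c * ∑ i, ξ i ^ 2 + 1 / (4 * c) * ∑ i, η i ^ 2) := by
  have hterm : ∀ i j, |a i j * (ξ i * η j)| ≤ τ * (c * ξ i ^ 2 + 1 / (4 * c) * η j ^ 2) := by
    intro i j
    have hτ : 0 ≤ τ := (abs_nonneg _).trans (ha i j)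
    rw [abs_mul]
    refine mul_le_mul (ha i j) ?_ (abs_nonneg _) hτ
    have h1 : (0 : ℝ) ≤ 1 / (4 * c) * (2 * c * ξ i - η j) ^ 2 := by positivity
    have h2 : (0 : ℝ) ≤ 1 / (4 * c) * (2 * c * ξ i + η j) ^ 2 := by positivity
    have e1 : 1 / (4 * c) * (2 * c * ξ i - η j) ^ 2 =
      c * ξ i ^ 2 + 1 / (4 * c) * η j ^ 2 - ξ i * η j := by field_simp; ring
    have e2 : 1 / (4 * c) * (2 * c * ξ i + η j) ^ 2 =
      c * ξ i ^ 2 + 1 / (4 * c) * η j ^ 2 + ξ i * η j := by field_simp; ring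
    rw [abs_le]
    constructor <;> linarith
  calc |quadForm a ξ η| ≤ ∑ i, ∑ j, |a i j * (ξ i * η j)| :=
        (Finset.abs_sum_le_sum_abs _ _).trans
          (Finset.sum_le_sum fun _ _ => Finset.abs_sum_le_sum_abs _ _)
    _ ≤ ∑ i, ∑ j, τ * (c * ξ i ^ 2 + 1 / (4 * c) * η j ^ 2) :=
        Finset.sum_le_sum fun i _ => Finset.sum_le_sum fun j _ => hterm i j
    _ = _ := by
        simp only [← Finset.mul_sum, Finset.sum_add_distrib, Finset.sum_const, Finset.card_univ,
          Fintype.card_fin, nsmul_eq_mul]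
        ring

/-- Since `tr(σσᵀ)` is the sum of the squared entries of `σ`, the pairs of an admissible `σ` and a
unit vector `ξ` form a compact set. On it `|σᵀξ|²` is continuous and, as `d ≠ 0`, positive; its
minimum is the constant. Homogeneity removes the normalisation of `ξ`. -/
theorem exists_ellipticity (n : ℕ) (τ d : ℝ) (hd : d ≠ 0) :
    ∃ c : ℝ, 0 < c ∧ ∀ σ : Matrix (Fin n) (Fin n) ℝ, (σ * σ.transpose).trace = τ →
      (σ * σ.transpose).det = d → ∀ ξ : Fin n → ℝ,
        c * ∑ i, ξ i ^ 2 ≤ quadForm (σ * σ.transpose) ξ ξ := by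
  let S : Set (Matrix (Fin n) (Fin n) ℝ × (Fin n → ℝ)) :=
    {p | (p.1 * p.1.transpose).trace = τ ∧ (p.1 * p.1.transpose).det = d ∧ ∑ i, p.2 i ^ 2 = 1}
  have hclosed : IsClosed S := by
    refine IsClosed.inter ?_ (IsClosed.inter ?_ ?_)
    · exact isClosed_eq (by fun_prop) continuous_const
    · exact isClosed_eq (by fun_prop) continuous_const
    · exact isClosed_eq (by fun_prop) continuous_const
  have hcompact : IsCompact S := by
    have hbox : IsCompact ((Set.univ.pi fun _ : Fin n => Set.univ.pi fun _ : Fin n =>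
        Icc (-√τ) (√τ)) ×ˢ (Set.univ.pi fun _ : Fin n => Icc (-1 : ℝ) 1)) :=
      (isCompact_univ_pi fun _ => isCompact_univ_pi fun _ => isCompact_Icc).prod
        (isCompact_univ_pi fun _ => isCompact_Icc)
    refine hbox.of_isClosed_subset hclosed ?_
    rintro ⟨σ, ξ⟩ ⟨h1, -, h3⟩
    refine ⟨fun i _ j _ => ?_, fun i _ => ?_⟩
    · rw [mem_Icc, ← abs_le]
      exact Real.abs_le_sqrt (h1 ▸ sq_entry_le_trace σ i j)
    · have : ξ i ^ 2 ≤ 1 := by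
        rw [← h3]
        exact Finset.single_le_sum (f := fun i => ξ i ^ 2) (fun _ _ => sq_nonneg _)
          (Finset.mem_univ i)
      rw [mem_Icc, ← abs_le]
      exact abs_le_one_iff_mul_self_le_one.2 (by simpa [sq] using this)
  have hcont : Continuous fun p : Matrix (Fin n) (Fin n) ℝ × (Fin n → ℝ) =>
      quadForm (p.1 * p.1.transpose) p.2 p.2 := by
    simp only [quadForm_mul_transpose]
    have : ∀ i k, Continuous fun p : Matrix (Fin n) (Fin n) ℝ × (Fin n → ℝ) => p.1 i k :=
      fun i k => (continuous_apply k).comp ((continuous_apply i).comp continuous_fst)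
    fun_prop
  have hpos : ∀ p ∈ S, 0 < quadForm (p.1 * p.1.transpose) p.2 p.2 := by
    rintro ⟨σ, ξ⟩ ⟨-, h2, h3⟩
    simp only at h2 h3 ⊢
    rw [quadForm_mul_transpose]
    refine lt_of_le_of_ne (Finset.sum_nonneg fun _ _ => sq_nonneg _) fun h0 => ?_
    rw [eq_comm, Finset.sum_eq_zero_iff_of_nonneg fun _ _ => sq_nonneg _] at h0
    have hv : σ.transpose.mulVec ξ = 0 := by
      ext k
      have := h0 k (Finset.mem_univ k)
      simpa [Matrix.mulVec, dotProduct] using this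
    have hξ : ξ = 0 := by
      refine Matrix.eq_zero_of_mulVec_eq_zero (M := σ * σ.transpose) (h2 ▸ hd) ?_
      rw [← Matrix.mulVec_mulVec, hv, Matrix.mulVec_zero]
    simp [hξ] at h3
  obtain ⟨c, hc, hcS⟩ : ∃ c : ℝ, 0 < c ∧ ∀ p ∈ S, c ≤ quadForm (p.1 * p.1.transpose) p.2 p.2 := by
    rcases S.eq_empty_or_nonempty with h | h
    · exact ⟨1, one_pos, by simp [h]⟩
    · obtain ⟨p, hp, hmin⟩ := hcompact.exists_isMinOn h hcont.continuousOn
      exact ⟨_, hpos p hp, fun q hq => hmin hq⟩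
  refine ⟨c, hc, fun σ h1 h2 ξ => ?_⟩
  rcases (Finset.sum_nonneg fun i (_ : i ∈ Finset.univ) => sq_nonneg (ξ i)).eq_or_lt with h0 | h0
  · rw [← h0, mul_zero, quadForm_mul_transpose]
    exact Finset.sum_nonneg fun _ _ => sq_nonneg _
  · set r := √(∑ i, ξ i ^ 2) with hr
    have hr0 : 0 < r := Real.sqrt_pos.2 h0
    have hr2 : r ^ 2 = ∑ i, ξ i ^ 2 := Real.sq_sqrt h0.le
    have hmem : ((σ, fun i => r⁻¹ * ξ i) : Matrix (Fin n) (Fin n) ℝ × (Fin n → ℝ)) ∈ S := by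
      refine ⟨h1, h2, ?_⟩
      simp only [mul_pow, ← Finset.mul_sum, ← hr2]
      field_simp
    have := hcS _ hmem
    have e : quadForm (σ * σ.transpose) (fun i => r⁻¹ * ξ i) (fun i => r⁻¹ * ξ i) =
        (r ^ 2)⁻¹ * quadForm (σ * σ.transpose) ξ ξ := by
      simp only [quadForm, Finset.mul_sum]
      refine Finset.sum_congr rfl fun i _ => Finset.sum_congr rfl fun j _ => ?_
      field_simp
    simp only [e] at this
    rw [← hr2]
    rw [inv_mul_eq_div, le_div_iff₀ (by positivity)] at this
    exact this

/-! ### The energy identity. -/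

/-- The space gradient, in coordinates. -/
noncomputable def gradX {n : ℕ} (u : ℝ × EuclideanSpace ℝ (Fin n) → ℝ)
    (z : ℝ × EuclideanSpace ℝ (Fin n)) : Fin n → ℝ := fun i => fderiv ℝ u z (dirX i)

/-- Integration by parts against the constant function 1. -/
theorem integral_fderiv_apply_eq_zero {n : ℕ} {f : ℝ × EuclideanSpace ℝ (Fin n) → ℝ}
    {f' : ℝ × EuclideanSpace ℝ (Fin n) → (ℝ × EuclideanSpace ℝ (Fin n)) →L[ℝ] ℝ}
    {v : ℝ × EuclideanSpace ℝ (Fin n)} (hf : ∀ z, HasFDerivAt f (f' z) z)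
    (hi : Integrable f) (hi' : Integrable fun z => f' z v) : ∫ z, f' z v = 0 := by
  have := integral_bilinear_hasFDerivAt_right_eq_neg_left_of_integrable
    (μ := (volume : Measure (ℝ × EuclideanSpace ℝ (Fin n))))
    (B := ContinuousLinearMap.mul ℝ ℝ) (f := fun _ => (1 : ℝ)) (f' := fun _ => 0) (g := f) (g' := f')
    (v := v) (by simp) (by simpa using hi') (by simpa using hi)
    (fun z _ => hasFDerivAt_const _ _) (fun z _ => hf z)
  simpa using this

/-- The integrand is the sum of exact derivatives `∂ₛ(B(u) χ) + ½ ∑ aᵢⱼ ∂ᵢ(∂ⱼu B₁(u) χ)`, each of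
compact support. The function `B` is left free because the power 2 serves the energy estimates and a
power of the positive part the maximum principle. -/
theorem integral_energy_identity {n : ℕ} (a : Matrix (Fin n) (Fin n) ℝ)
    {u χ : ℝ × EuclideanSpace ℝ (Fin n) → ℝ} (hu : ContDiff ℝ ∞ u) (hχ : ContDiff ℝ ∞ χ)
    (hc : HasCompactSupport χ) {B B₁ B₂ : ℝ → ℝ} (hB : ∀ r, HasDerivAt B (B₁ r) r)
    (hB₁ : ∀ r, HasDerivAt B₁ (B₂ r) r) (hB₂ : Continuous B₂) :
    Integrable (fun z => B (u z) * fderiv ℝ χ z (dirT n) +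
      1 / 2 * (B₂ (u z) * quadForm a (gradX u z) (gradX u z) * χ z) +
      1 / 2 * (B₁ (u z) * quadForm a (gradX χ z) (gradX u z)) -
      parabolicOp a u z * B₁ (u z) * χ z) ∧
    ∫ z, (B (u z) * fderiv ℝ χ z (dirT n) +
      1 / 2 * (B₂ (u z) * quadForm a (gradX u z) (gradX u z) * χ z) +
      1 / 2 * (B₁ (u z) * quadForm a (gradX χ z) (gradX u z)) -
      parabolicOp a u z * B₁ (u z) * χ z) = 0 := by
  have cu := hu.continuous
  have cχ := hχ.continuous
  have cB : Continuous B := continuous_iff_continuousAt.2 fun r => (hB r).continuousAt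
  have cB₁ : Continuous B₁ := continuous_iff_continuousAt.2 fun r => (hB₁ r).continuousAt
  have du : ∀ v, ContDiff ℝ ∞ fun z => fderiv ℝ u z v := contDiff_fderiv_apply hu
  have dχ : ∀ v, ContDiff ℝ ∞ fun z => fderiv ℝ χ z v := contDiff_fderiv_apply hχ
  have cdu := fun v => (du v).continuous
  have cdχ := fun v => (dχ v).continuous
  have cddu := fun v w => (contDiff_fderiv_apply (du v) w).continuous
  have hu' : ∀ z, HasFDerivAt u (fderiv ℝ u z) z := fun z =>
    (hu.differentiable (by simp) z).hasFDerivAt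
  have hχ' : ∀ z, HasFDerivAt χ (fderiv ℝ χ z) z := fun z =>
    (hχ.differentiable (by simp) z).hasFDerivAt
  have hdu' : ∀ v z, HasFDerivAt (fun y => fderiv ℝ u y v)
      (fderiv ℝ (fun y => fderiv ℝ u y v) z) z := fun v z =>
    ((du v).differentiable (by simp) z).hasFDerivAt
  have hBu : ∀ z, HasFDerivAt (fun y => B (u y)) (B₁ (u z) • fderiv ℝ u z) z := fun z =>
    (hB (u z)).comp_hasFDerivAt z (hu' z)
  have hB₁u : ∀ z, HasFDerivAt (fun y => B₁ (u y)) (B₂ (u z) • fderiv ℝ u z) z := fun z =>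
    (hB₁ (u z)).comp_hasFDerivAt z (hu' z)
  have hint : ∀ f : ℝ × EuclideanSpace ℝ (Fin n) → ℝ, Continuous f →
      Integrable (fun z => f z * χ z) := fun f hf =>
    (hf.mul cχ).integrable_of_hasCompactSupport hc.mul_left
  have hint' : ∀ (f : ℝ × EuclideanSpace ℝ (Fin n) → ℝ) v, Continuous f →
      Integrable (fun z => f z * fderiv ℝ χ z v) := fun f v hf =>
    (hf.mul (cdχ v)).integrable_of_hasCompactSupport (hc.fderiv_apply' v).mul_left
  -- the two divergence terms
  have h1 : Integrable (fun z => B (u z) * fderiv ℝ χ z (dirT n) +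
      B₁ (u z) * fderiv ℝ u z (dirT n) * χ z) ∧ ∫ z, (B (u z) * fderiv ℝ χ z (dirT n) +
      B₁ (u z) * fderiv ℝ u z (dirT n) * χ z) = 0 := by
    have hi := (hint' (fun z => B (u z)) (dirT n) (by fun_prop)).add
      (hint (fun z => B₁ (u z) * fderiv ℝ u z (dirT n))
        ((cB₁.comp cu).mul (cdu _)))
    refine ⟨hi, ?_⟩
    have e : ∀ z, (B (u z) • fderiv ℝ χ z + χ z • (B₁ (u z) • fderiv ℝ u z)) (dirT n) =
        B (u z) * fderiv ℝ χ z (dirT n) + B₁ (u z) * fderiv ℝ u z (dirT n) * χ z := by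
      intro z
      simp only [add_apply, smul_apply, smul_eq_mul]
      ring
    have := integral_fderiv_apply_eq_zero (v := dirT n) (fun z => (hBu z).mul (hχ' z))
      (hint (fun z => B (u z)) (by fun_prop)) (by simp only [e]; exact hi)
    simpa only [e] using this
  have h2 : ∀ i j, Integrable (fun z => fderiv ℝ (fun y => fderiv ℝ u y (dirX j)) z (dirX i) *
        B₁ (u z) * χ z + fderiv ℝ u z (dirX j) * B₂ (u z) * fderiv ℝ u z (dirX i) * χ z +
        fderiv ℝ u z (dirX j) * B₁ (u z) * fderiv ℝ χ z (dirX i)) ∧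
      ∫ z, (fderiv ℝ (fun y => fderiv ℝ u y (dirX j)) z (dirX i) *
        B₁ (u z) * χ z + fderiv ℝ u z (dirX j) * B₂ (u z) * fderiv ℝ u z (dirX i) * χ z +
        fderiv ℝ u z (dirX j) * B₁ (u z) * fderiv ℝ χ z (dirX i)) = 0 := by
    intro i j
    have hi := ((hint (fun z => fderiv ℝ (fun y => fderiv ℝ u y (dirX j)) z (dirX i) * B₁ (u z))
      ((cddu _ _).mul (cB₁.comp cu))).add (hint (fun z => fderiv ℝ u z (dirX j) * B₂ (u z) *
      fderiv ℝ u z (dirX i)) (((cdu _).mul (hB₂.comp cu)).mul (cdu _)))).add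
      (hint' (fun z => fderiv ℝ u z (dirX j) * B₁ (u z)) (dirX i) ((cdu _).mul (cB₁.comp cu)))
    refine ⟨hi, ?_⟩
    have hd := fun z => ((hdu' (dirX j) z).mul (hB₁u z)).mul (hχ' z)
    have := integral_fderiv_apply_eq_zero (v := dirX i) hd
      (hint (fun z => fderiv ℝ u z (dirX j) * B₁ (u z)) ((cdu _).mul (cB₁.comp cu)))
      (by
        refine hi.congr (ae_of_all _ fun z => ?_)
        simp only [Pi.add_apply, Pi.mul_apply, add_apply,
          smul_apply, smul_eq_mul]
        ring)
    rw [← this]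
    refine integral_congr_ae (ae_of_all _ fun z => ?_)
    simp only [Pi.mul_apply, add_apply,
      smul_apply, smul_eq_mul]
    ring
  have hsum : Integrable (fun z => ∑ i, ∑ j, a i j *
      (fderiv ℝ (fun y => fderiv ℝ u y (dirX j)) z (dirX i) *
        B₁ (u z) * χ z + fderiv ℝ u z (dirX j) * B₂ (u z) * fderiv ℝ u z (dirX i) * χ z +
        fderiv ℝ u z (dirX j) * B₁ (u z) * fderiv ℝ χ z (dirX i))) :=
    integrable_finsetSum _ fun i _ => integrable_finsetSum _ fun j _ => ((h2 i j).1.const_mul _)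
  have e : ∀ z, (B (u z) * fderiv ℝ χ z (dirT n) +
      1 / 2 * (B₂ (u z) * quadForm a (gradX u z) (gradX u z) * χ z) +
      1 / 2 * (B₁ (u z) * quadForm a (gradX χ z) (gradX u z)) -
      parabolicOp a u z * B₁ (u z) * χ z) = (B (u z) * fderiv ℝ χ z (dirT n) +
      B₁ (u z) * fderiv ℝ u z (dirT n) * χ z) + 1 / 2 * ∑ i, ∑ j, a i j *
      (fderiv ℝ (fun y => fderiv ℝ u y (dirX j)) z (dirX i) *
        B₁ (u z) * χ z + fderiv ℝ u z (dirX j) * B₂ (u z) * fderiv ℝ u z (dirX i) * χ z +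
        fderiv ℝ u z (dirX j) * B₁ (u z) * fderiv ℝ χ z (dirX i)) := by
    intro z
    have s1 : ∑ i, ∑ j, a i j *
      (fderiv ℝ (fun y => fderiv ℝ u y (dirX j)) z (dirX i) *
        B₁ (u z) * χ z + fderiv ℝ u z (dirX j) * B₂ (u z) * fderiv ℝ u z (dirX i) * χ z +
        fderiv ℝ u z (dirX j) * B₁ (u z) * fderiv ℝ χ z (dirX i)) =
        (∑ i, ∑ j, a i j * hessX u z i j) * (B₁ (u z) * χ z) +
        B₂ (u z) * quadForm a (gradX u z) (gradX u z) * χ z +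
        B₁ (u z) * quadForm a (gradX χ z) (gradX u z) := by
      simp only [quadForm, Finset.mul_sum, Finset.sum_mul, ← Finset.sum_add_distrib, hessX, gradX]
      refine Finset.sum_congr rfl fun i _ => Finset.sum_congr rfl fun j _ => ?_
      ring
    rw [s1, parabolicOp, diffusionOp]
    ring
  simp only [e]
  refine ⟨h1.1.add (hsum.const_mul _), ?_⟩
  rw [integral_add h1.1 (hsum.const_mul _), h1.2, zero_add, integral_const_mul, integral_finsetSum]
  · rw [Finset.sum_eq_zero, mul_zero]
    intro i _
    rw [integral_finsetSum]
    · refine Finset.sum_eq_zero fun j _ => ?_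
      rw [integral_const_mul, (h2 i j).2, mul_zero]
    · exact fun j _ => (h2 i j).1.const_mul _
  · exact fun i _ => integrable_finsetSum _ fun j _ => (h2 i j).1.const_mul _

/-! ### Polynomial weights and cutoffs in space. -/

theorem contDiff_one_add_norm_sq_rpow {n : ℕ} (p : ℝ) :
    ContDiff ℝ ∞ fun x : EuclideanSpace ℝ (Fin n) => (1 + ‖x‖ ^ 2) ^ p :=
  (contDiff_const.add (contDiff_norm_sq ℝ)).rpow_const_of_ne fun x => by positivity

theorem abs_fderiv_one_add_norm_sq_rpow_le {n : ℕ} (p : ℝ) (x v : EuclideanSpace ℝ (Fin n)) :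
    |fderiv ℝ (fun x : EuclideanSpace ℝ (Fin n) => (1 + ‖x‖ ^ 2) ^ p) x v| ≤
      |p| * (1 + ‖x‖ ^ 2) ^ p * ‖v‖ := by
  have hq : 0 < 1 + ‖x‖ ^ 2 := by positivity
  have h1 : HasFDerivAt (fun x : EuclideanSpace ℝ (Fin n) => 1 + ‖x‖ ^ 2)
      (2 • innerSL ℝ x) x := (hasStrictFDerivAt_norm_sq x).hasFDerivAt.const_add 1
  have h2 := h1.rpow_const (p := p) (Or.inl hq.ne')
  rw [h2.fderiv]
  simp only [smul_apply, innerSL_apply_apply, smul_eq_mul, nsmul_eq_mul, Nat.cast_ofNat]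
  rw [abs_mul, abs_mul, abs_of_pos (Real.rpow_pos_of_pos hq (p - 1)),
    Real.rpow_sub_one hq.ne', abs_mul, abs_two]
  have h3 : |inner ℝ x v| ≤ ‖x‖ * ‖v‖ := abs_real_inner_le_norm x v
  have h4 : 2 * ‖x‖ ≤ 1 + ‖x‖ ^ 2 := by nlinarith [sq_nonneg (‖x‖ - 1)]
  have h5 : (0 : ℝ) ≤ |p| * ((1 + ‖x‖ ^ 2) ^ p / (1 + ‖x‖ ^ 2)) := by positivity
  calc |p| * ((1 + ‖x‖ ^ 2) ^ p / (1 + ‖x‖ ^ 2)) * (2 * |inner ℝ x v|)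
      ≤ |p| * ((1 + ‖x‖ ^ 2) ^ p / (1 + ‖x‖ ^ 2)) * ((1 + ‖x‖ ^ 2) * ‖v‖) := by
        refine mul_le_mul_of_nonneg_left ?_ h5
        nlinarith [norm_nonneg v, mul_le_mul_of_nonneg_right h4 (norm_nonneg v)]
    _ = _ := by field_simp

theorem polyWeight_pos {n : ℕ} (γ : ℝ) (x : EuclideanSpace ℝ (Fin n)) : 0 < polyWeight γ x := by
  unfold polyWeight; positivity

theorem polyWeight_eq_rpow_sq {n : ℕ} (γ : ℝ) (x : EuclideanSpace ℝ (Fin n)) :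
    polyWeight γ x = ((1 + ‖x‖ ^ 2) ^ (-γ / 2)) ^ 2 := by
  have hq : 0 < 1 + ‖x‖ ^ 2 := by positivity
  rw [polyWeight, ← Real.rpow_natCast ((1 + ‖x‖ ^ 2) ^ (-γ / 2)) 2,
    ← Real.rpow_mul hq.le, one_div, ← Real.rpow_neg hq.le]
  congr 1
  push_cast
  ring

theorem continuous_polyWeight {n : ℕ} (γ : ℝ) :
    Continuous (polyWeight γ : EuclideanSpace ℝ (Fin n) → ℝ) := by
  have : (polyWeight γ : EuclideanSpace ℝ (Fin n) → ℝ) =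
      fun x => ((1 + ‖x‖ ^ 2) ^ (-γ / 2)) ^ 2 := funext (polyWeight_eq_rpow_sq γ)
  rw [this]
  exact (contDiff_one_add_norm_sq_rpow _).continuous.pow 2

theorem polyWeight_le_one {n : ℕ} {γ : ℝ} (hγ : 0 ≤ γ) (x : EuclideanSpace ℝ (Fin n)) :
    polyWeight γ x ≤ 1 := by
  rw [polyWeight, div_le_one (by positivity)]
  exact Real.one_le_rpow (by nlinarith [sq_nonneg ‖x‖]) hγ

theorem polyWeight_add_one {n : ℕ} (γ : ℝ) (x : EuclideanSpace ℝ (Fin n)) :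
    (1 + ‖x‖ ^ 2) * polyWeight (γ + 1) x = polyWeight γ x := by
  have hq : 0 < 1 + ‖x‖ ^ 2 := by positivity
  rw [polyWeight, polyWeight, Real.rpow_add_one hq.ne']
  field_simp

/-- The product is `(1 + |x|²)^(-(γ-3))`, integrable when `2γ - 6 > n`; this is where the threshold
for `γ` comes from. -/
theorem integrable_pow_three_mul_polyWeight {n : ℕ} {γ : ℝ} (hγ : (n : ℝ) / 2 + 3 < γ) :
    Integrable fun x : EuclideanSpace ℝ (Fin n) => (1 + ‖x‖ ^ 2) ^ 3 * polyWeight γ x := by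
  have h := integrable_rpow_neg_one_add_norm_sq (E := EuclideanSpace ℝ (Fin n))
    (μ := volume) (r := 2 * γ - 6) (by rw [finrank_euclideanSpace_fin]; linarith)
  refine h.congr (ae_of_all _ fun x => ?_)
  have hq : 0 < 1 + ‖x‖ ^ 2 := by positivity
  simp only [polyWeight]
  rw [show -(2 * γ - 6) / 2 = (3 : ℕ) - γ by push_cast; ring, Real.rpow_sub hq, Real.rpow_natCast]
  ring

/-- `Y` is a dilated bump times the square root of the weight. A derivative of the bump gains `1/R ≤
1`, and a derivative of a power of `1 + |x|²` is bounded by a multiple of that power, so `C` does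
not depend on `R`. Working with `Y²` makes `D(Y²) = 2Y DY` splittable by Young's inequality. -/
theorem exists_spaceCutoff (n : ℕ) (γ : ℝ) :
    ∃ C : ℝ, 0 ≤ C ∧ ∀ R : ℝ, 1 ≤ R → ∃ Y : EuclideanSpace ℝ (Fin n) → ℝ,
      ContDiff ℝ ∞ Y ∧ (∀ x, Y x ≠ 0 → ‖x‖ ≤ 2 * R) ∧ (∀ x, Y x ^ 2 ≤ polyWeight γ x) ∧
      (∀ x, ‖x‖ ≤ R → Y x ^ 2 = polyWeight γ x) ∧
      ∀ x, ∑ i, fderiv ℝ Y x (EuclideanSpace.single i 1) ^ 2 ≤ C * polyWeight γ x := by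
  let ζ : ContDiffBump (0 : EuclideanSpace ℝ (Fin n)) := ⟨1, 2, one_pos, one_lt_two⟩
  have hζ : ContDiff ℝ ∞ ζ := ζ.contDiff
  obtain ⟨b, hb⟩ : ∃ b, ∀ x, ‖fderiv ℝ ζ x‖ ≤ b :=
    (hζ.continuous_fderiv (by simp)).bounded_above_of_compact_support
      (ζ.hasCompactSupport.fderiv ℝ)
  have hb0 : 0 ≤ b := (norm_nonneg _).trans (hb 0)
  refine ⟨n * (b + |-γ / 2|) ^ 2, by positivity, fun R hR => ?_⟩
  have hR0 : 0 < R := by linarith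
  have hp := contDiff_one_add_norm_sq_rpow (n := n) (-γ / 2)
  have hζR : ContDiff ℝ ∞ fun x => ζ (R⁻¹ • x) := hζ.comp (contDiff_const_smul _)
  have hζ01 : ∀ x, 0 ≤ ζ x ∧ ζ x ≤ 1 := fun x => ⟨ζ.nonneg, ζ.le_one⟩
  have hp0 : ∀ x : EuclideanSpace ℝ (Fin n), 0 ≤ (1 + ‖x‖ ^ 2) ^ (-γ / 2) := fun x => by positivity
  refine ⟨fun x => ζ (R⁻¹ • x) * (1 + ‖x‖ ^ 2) ^ (-γ / 2), hζR.mul hp, ?_, ?_, ?_, ?_⟩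
  · intro x hx
    have h1 : R⁻¹ • x ∈ Function.support ζ := left_ne_zero_of_mul hx
    rw [ζ.support_eq, Metric.mem_ball, dist_zero_right, norm_smul, norm_inv, Real.norm_eq_abs,
      abs_of_pos hR0, inv_mul_lt_iff₀ hR0] at h1
    have : ζ.rOut = 2 := rfl
    rw [this] at h1
    linarith
  · intro x
    rw [mul_pow, polyWeight_eq_rpow_sq]
    exact mul_le_of_le_one_left (sq_nonneg _) (pow_le_one₀ (hζ01 _).1 (hζ01 _).2)
  · intro x hx
    have h1 : ζ (R⁻¹ • x) = 1 := by
      refine ζ.one_of_mem_closedBall ?_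
      rw [Metric.mem_closedBall, dist_zero_right, norm_smul, norm_inv, Real.norm_eq_abs,
        abs_of_pos hR0, inv_mul_le_iff₀ hR0]
      simpa [ζ] using hx
    simp only [h1, one_mul, polyWeight_eq_rpow_sq]
  · intro x
    have hbound : ∀ i : Fin n, fderiv ℝ (fun x => ζ (R⁻¹ • x) * (1 + ‖x‖ ^ 2) ^ (-γ / 2)) x
        (EuclideanSpace.single i 1) ^ 2 ≤ (b + |-γ / 2|) ^ 2 * polyWeight γ x := by
      intro i
      have hn : ‖(EuclideanSpace.single i 1 : EuclideanSpace ℝ (Fin n))‖ = 1 := by simp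
      have d1 : HasFDerivAt (fun x => ζ (R⁻¹ • x))
          ((fderiv ℝ ζ (R⁻¹ • x)).comp (R⁻¹ • ContinuousLinearMap.id ℝ _)) x :=
        ((hζ.differentiable (by simp)) _).hasFDerivAt.comp x ((hasFDerivAt_id x).const_smul R⁻¹)
      have d2 := ((hp.differentiable (by simp)) x).hasFDerivAt
      have d3 : HasFDerivAt (fun x => ζ (R⁻¹ • x) * (1 + ‖x‖ ^ 2) ^ (-γ / 2)) _ x := d1.mul d2
      rw [polyWeight_eq_rpow_sq, ← mul_pow]
      refine sq_le_sq' (abs_le.1 ?_).1 (abs_le.1 ?_).2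
      all_goals
        rw [d3.fderiv]
        simp only [add_apply, smul_apply, smul_eq_mul,
          ContinuousLinearMap.comp_apply, ContinuousLinearMap.id_apply, map_smul]
        have e1 := abs_fderiv_one_add_norm_sq_rpow_le (-γ / 2) x (EuclideanSpace.single i 1)
        rw [hn, mul_one] at e1
        have e2 : |fderiv ℝ ζ (R⁻¹ • x) (EuclideanSpace.single i 1)| ≤ b := by
          refine ((fderiv ℝ ζ (R⁻¹ • x)).le_opNorm _).trans ?_
          rw [hn, mul_one]
          exact hb _
        have e3 : |R⁻¹| ≤ 1 := by
          rw [abs_of_pos (by positivity)]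
          exact inv_le_one_of_one_le₀ hR
        refine (abs_add_le _ _).trans ?_
        rw [abs_mul, abs_mul, abs_mul, abs_of_nonneg (hζ01 _).1, abs_of_nonneg (hp0 x)]
        have e4 : |R⁻¹| * |fderiv ℝ ζ (R⁻¹ • x) (EuclideanSpace.single i 1)| ≤ 1 * b :=
          mul_le_mul e3 e2 (abs_nonneg _) zero_le_one
        have e5 := mul_le_mul (hζ01 (R⁻¹ • x)).2 e1 (abs_nonneg _) zero_le_one
        have e6 := mul_le_mul_of_nonneg_left e4 (hp0 x)
        nlinarith
    calc _ ≤ ∑ _i : Fin n, (b + |-γ / 2|) ^ 2 * polyWeight γ x :=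
          Finset.sum_le_sum fun i _ => hbound i
      _ = _ := by simp; ring

/-! ### Cutoffs in time. -/

/-- A smooth monotone function equal to `0` on `(-∞, a]` and to `1` on `[b, ∞)`. -/
noncomputable def riseCut (a b s : ℝ) : ℝ := Real.smoothTransition ((s - a) / (b - a))

theorem contDiff_riseCut (a b : ℝ) : ContDiff ℝ ∞ (riseCut a b) :=
  (Real.smoothTransition.contDiff (n := ⊤)).comp
    ((contDiff_id.sub contDiff_const).div_const _)

theorem riseCut_nonneg (a b s : ℝ) : 0 ≤ riseCut a b s := Real.smoothTransition.nonneg _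

theorem riseCut_le_one (a b s : ℝ) : riseCut a b s ≤ 1 := Real.smoothTransition.le_one _

section

variable {a b : ℝ}

theorem riseCut_of_le (hab : a < b) {s : ℝ} (hs : s ≤ a) : riseCut a b s = 0 :=
  Real.smoothTransition.zero_of_nonpos
    (div_nonpos_of_nonpos_of_nonneg (by linarith) (by linarith))

theorem riseCut_of_ge (hab : a < b) {s : ℝ} (hs : b ≤ s) : riseCut a b s = 1 :=
  Real.smoothTransition.one_of_one_le ((one_le_div (by linarith)).2 (by linarith))

theorem riseCut_monotone (hab : a < b) : Monotone (riseCut a b) := fun s t h =>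
  Real.smoothTransition.monotone (by
    have : 0 < b - a := by linarith
    gcongr)

theorem deriv_riseCut_nonneg (hab : a < b) (s : ℝ) : 0 ≤ deriv (riseCut a b) s :=
  (riseCut_monotone hab).deriv_nonneg

theorem deriv_riseCut_eq_zero (hab : a < b) {s : ℝ} (hs : s ∉ Icc a b) :
    deriv (riseCut a b) s = 0 := by
  rw [mem_Icc, not_and_or, not_le, not_le] at hs
  rcases hs with h | h
  · have : riseCut a b =ᶠ[𝓝 s] fun _ => 0 := by
      filter_upwards [Iio_mem_nhds h] with r hr using riseCut_of_le hab (le_of_lt hr)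
    rw [this.deriv_eq, deriv_const]
  · have : riseCut a b =ᶠ[𝓝 s] fun _ => 1 := by
      filter_upwards [Ioi_mem_nhds h] with r hr using riseCut_of_ge hab (le_of_lt hr)
    rw [this.deriv_eq, deriv_const]

theorem hasCompactSupport_deriv_riseCut (hab : a < b) : HasCompactSupport (deriv (riseCut a b)) :=
  HasCompactSupport.intro isCompact_Icc fun _ hs => deriv_riseCut_eq_zero hab hs

theorem integrable_deriv_riseCut (hab : a < b) : Integrable (deriv (riseCut a b)) :=
  ((contDiff_riseCut a b).continuous_deriv (by simp)).integrable_of_hasCompactSupport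
    (hasCompactSupport_deriv_riseCut hab)

theorem integral_deriv_riseCut (hab : a < b) : ∫ s, deriv (riseCut a b) s = 1 := by
  have h := integral_of_hasDerivAt_of_tendsto (f := riseCut a b) (f' := deriv (riseCut a b))
    (m := 0) (n := 1)
    (fun s => ((contDiff_riseCut a b).differentiable (by simp) s).hasDerivAt)
    (integrable_deriv_riseCut hab)
    (tendsto_const_nhds.congr' <| by
      filter_upwards [eventually_le_atBot a] with s hs using (riseCut_of_le hab hs).symm)
    (tendsto_const_nhds.congr' <| by
      filter_upwards [eventually_ge_atTop b] with s hs using (riseCut_of_ge hab hs).symm)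
  simpa using h

end

/-- A smooth cutoff in time, rising on `[a, b]` and falling on `[c, d]`. -/
noncomputable def timeCut (a b c d s : ℝ) : ℝ := riseCut a b s * (1 - riseCut c d s)

theorem contDiff_timeCut (a b c d : ℝ) : ContDiff ℝ ∞ (timeCut a b c d) :=
  (contDiff_riseCut a b).mul (contDiff_const.sub (contDiff_riseCut c d))

theorem timeCut_nonneg (a b c d s : ℝ) : 0 ≤ timeCut a b c d s :=
  mul_nonneg (riseCut_nonneg _ _ _) (by linarith [riseCut_le_one c d s])

theorem timeCut_le_one (a b c d s : ℝ) : timeCut a b c d s ≤ 1 :=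
  mul_le_one₀ (riseCut_le_one _ _ _) (by linarith [riseCut_le_one c d s])
    (by linarith [riseCut_nonneg c d s])

theorem timeCut_support {a b c d s : ℝ} (hab : a < b) (hcd : c < d)
    (hs : timeCut a b c d s ≠ 0) : s ∈ Icc a d := by
  by_contra h
  rw [mem_Icc, not_and_or, not_le, not_le] at h
  apply hs
  rcases h with h | h
  · rw [timeCut, riseCut_of_le hab h.le, zero_mul]
  · rw [timeCut, riseCut_of_ge hcd h.le, sub_self, mul_zero]

theorem timeCut_eq_one {a b c d s : ℝ} (hab : a < b) (hcd : c < d) (hs : s ∈ Icc b c) :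
    timeCut a b c d s = 1 := by
  rw [timeCut, riseCut_of_ge hab hs.1, riseCut_of_le hcd hs.2]
  norm_num

theorem hasCompactSupport_timeCut {a b c d : ℝ} (hab : a < b) (hcd : c < d) :
    HasCompactSupport (timeCut a b c d) :=
  HasCompactSupport.of_support_subset_isCompact isCompact_Icc fun _ hs =>
    timeCut_support hab hcd hs

theorem deriv_timeCut (a b c d s : ℝ) : deriv (timeCut a b c d) s =
    deriv (riseCut a b) s * (1 - riseCut c d s) - riseCut a b s * deriv (riseCut c d) s := by
  have h1 := ((contDiff_riseCut a b).differentiable (by simp) s).hasDerivAt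
  have h2 := ((contDiff_riseCut c d).differentiable (by simp) s).hasDerivAt
  have h3 : HasDerivAt (timeCut a b c d) _ s := h1.mul (h2.const_sub 1)
  rw [h3.deriv]
  ring

/-- In the backward problem a rising cutoff has the favourable sign, so its derivative can be
dropped. Hence no estimate depends on how steeply the cutoff rises near the initial time. -/
theorem neg_deriv_riseCut_le_deriv_timeCut {a b c d : ℝ} (hab : a < b) (hcd : c < d) (s : ℝ) :
    -deriv (riseCut c d) s ≤ deriv (timeCut a b c d) s := by
  rw [deriv_timeCut]
  have h1 := deriv_riseCut_nonneg hab s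
  have h2 := deriv_riseCut_nonneg hcd s
  have h3 := riseCut_le_one a b s
  have h4 := riseCut_le_one c d s
  nlinarith [mul_nonneg h1 (sub_nonneg.2 h4), mul_nonneg h2 (sub_nonneg.2 h3)]

section

variable {n : ℕ} {θ : ℝ → ℝ} {X : EuclideanSpace ℝ (Fin n) → ℝ}

theorem contDiff_prod_mul (hθ : ContDiff ℝ ∞ θ) (hX : ContDiff ℝ ∞ X) :
    ContDiff ℝ ∞ fun z : ℝ × EuclideanSpace ℝ (Fin n) => θ z.1 * X z.2 :=
  (hθ.comp contDiff_fst).mul (hX.comp contDiff_snd)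

theorem hasCompactSupport_prod_mul (hθ : HasCompactSupport θ) (hX : HasCompactSupport X) :
    HasCompactSupport fun z : ℝ × EuclideanSpace ℝ (Fin n) => θ z.1 * X z.2 :=
  HasCompactSupport.intro (hθ.isCompact.prod hX.isCompact) fun z hz => by
    rw [mem_prod, not_and_or] at hz
    rcases hz with h | h
    · simp [image_eq_zero_of_notMem_tsupport h]
    · simp [image_eq_zero_of_notMem_tsupport h]

theorem hasFDerivAt_prod_mul (hθ : ContDiff ℝ ∞ θ) (hX : ContDiff ℝ ∞ X)
    (z : ℝ × EuclideanSpace ℝ (Fin n)) :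
    HasFDerivAt (fun z : ℝ × EuclideanSpace ℝ (Fin n) => θ z.1 * X z.2)
      (θ z.1 • (fderiv ℝ X z.2).comp (ContinuousLinearMap.snd ℝ ℝ (EuclideanSpace ℝ (Fin n))) +
        X z.2 • (fderiv ℝ θ z.1).comp (ContinuousLinearMap.fst ℝ ℝ (EuclideanSpace ℝ (Fin n)))) z :=
  (((hθ.differentiable (by simp)) z.1).hasFDerivAt.comp z hasFDerivAt_fst).mul
    (((hX.differentiable (by simp)) z.2).hasFDerivAt.comp z hasFDerivAt_snd)

theorem fderiv_prod_mul_dirX (hθ : ContDiff ℝ ∞ θ) (hX : ContDiff ℝ ∞ X)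
    (z : ℝ × EuclideanSpace ℝ (Fin n)) (i : Fin n) :
    fderiv ℝ (fun z : ℝ × EuclideanSpace ℝ (Fin n) => θ z.1 * X z.2) z (dirX i) =
      θ z.1 * fderiv ℝ X z.2 (EuclideanSpace.single i 1) := by
  rw [(hasFDerivAt_prod_mul hθ hX z).fderiv]
  simp

theorem fderiv_prod_mul_dirT (hθ : ContDiff ℝ ∞ θ) (hX : ContDiff ℝ ∞ X)
    (z : ℝ × EuclideanSpace ℝ (Fin n)) :
    fderiv ℝ (fun z : ℝ × EuclideanSpace ℝ (Fin n) => θ z.1 * X z.2) z (dirT n) =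
      deriv θ z.1 * X z.2 := by
  rw [(hasFDerivAt_prod_mul hθ hX z).fderiv]
  simp [mul_comm]

end

/-! ### The Caccioppoli inequality. -/

/-- The squared length of the gradient of a function on `ℝⁿ`. -/
noncomputable def gradSq {n : ℕ} (Y : EuclideanSpace ℝ (Fin n) → ℝ)
    (x : EuclideanSpace ℝ (Fin n)) : ℝ :=
  ∑ i, fderiv ℝ Y x (EuclideanSpace.single i 1) ^ 2

theorem gradSq_nonneg {n : ℕ} (Y : EuclideanSpace ℝ (Fin n) → ℝ)
    (x : EuclideanSpace ℝ (Fin n)) : 0 ≤ gradSq Y x :=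
  Finset.sum_nonneg fun _ _ => sq_nonneg _

theorem continuous_gradSq {n : ℕ} {Y : EuclideanSpace ℝ (Fin n) → ℝ} (hY : ContDiff ℝ ∞ Y) :
    Continuous (gradSq Y) :=
  continuous_finsetSum _ fun _ _ => (contDiff_fderiv_apply hY _).continuous.pow 2

theorem hasCompactSupport_gradSq {n : ℕ} {Y : EuclideanSpace ℝ (Fin n) → ℝ}
    (hY : HasCompactSupport Y) : HasCompactSupport (gradSq Y) :=
  HasCompactSupport.intro (hY.fderiv ℝ).isCompact fun x hx => by
    have h : fderiv ℝ Y x = 0 := image_eq_zero_of_notMem_tsupport hx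
    simp [gradSq, h]

theorem contDiff_parabolicOp {n : ℕ} (a : Matrix (Fin n) (Fin n) ℝ)
    {u : ℝ × EuclideanSpace ℝ (Fin n) → ℝ} (hu : ContDiff ℝ ∞ u) :
    ContDiff ℝ ∞ (parabolicOp a u) := by
  unfold parabolicOp diffusionOp hessX
  refine (contDiff_fderiv_apply hu _).neg.add (contDiff_const.mul ?_)
  exact ContDiff.sum fun i _ => ContDiff.sum fun j _ =>
    contDiff_const.mul (contDiff_fderiv_apply (contDiff_fderiv_apply hu _) _)

theorem integral_le_integral_add_three {α : Type*} [MeasurableSpace α] {μ : Measure α}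
    {f f₁ f₂ f₃ h : α → ℝ} (hf : Integrable f μ) (hf₁ : Integrable f₁ μ) (hf₂ : Integrable f₂ μ)
    (hf₃ : Integrable f₃ μ) (hh : Integrable h μ) (h0 : ∫ z, h z ∂μ = 0)
    (hle : ∀ᵐ z ∂μ, f z ≤ f₁ z + f₂ z + f₃ z + h z) :
    ∫ z, f z ∂μ ≤ (∫ z, f₁ z ∂μ) + (∫ z, f₂ z ∂μ) + ∫ z, f₃ z ∂μ := by
  have i1 : Integrable (fun z => f₁ z + f₂ z) μ := hf₁.add hf₂
  have i2 : Integrable (fun z => f₁ z + f₂ z + f₃ z) μ := i1.add hf₃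
  calc ∫ z, f z ∂μ ≤ ∫ z, (f₁ z + f₂ z + f₃ z + h z) ∂μ := integral_mono_ae hf (i2.add hh) hle
    _ = _ := by rw [integral_add i2 hh, integral_add i1 hf₃, integral_add hf₁ hf₂, h0, add_zero]

/-- The constant in front of the lower order term in the Caccioppoli inequality. -/
noncomputable def cacConst (n : ℕ) (τ c : ℝ) : ℝ := τ * n * ((2 * (τ * n) + 1) / c)

/-- A Caccioppoli inequality for smooth functions, with weight `Y²` in space. -/
theorem caccioppoli {n : ℕ} {a : Matrix (Fin n) (Fin n) ℝ} {τ c : ℝ} (hc : 0 < c)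
    (ha : ∀ i j, |a i j| ≤ τ) (hτ : 0 ≤ τ)
    (hell : ∀ ξ : Fin n → ℝ, c * ∑ i, ξ i ^ 2 ≤ quadForm a ξ ξ)
    {u : ℝ × EuclideanSpace ℝ (Fin n) → ℝ} (hu : ContDiff ℝ ∞ u)
    {Y : EuclideanSpace ℝ (Fin n) → ℝ} (hY : ContDiff ℝ ∞ Y) (hYc : HasCompactSupport Y)
    {s₁ s₂ s₃ s₄ : ℝ} (h₁₂ : s₁ < s₂) (h₃₄ : s₃ < s₄) :
    ∫ z : ℝ × EuclideanSpace ℝ (Fin n),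
        3 / 8 * c * (∑ i, gradX u z i ^ 2) * (timeCut s₁ s₂ s₃ s₄ z.1 * Y z.2 ^ 2) ≤
      (∫ z : ℝ × EuclideanSpace ℝ (Fin n), 1 / 2 * u z ^ 2 *
        (deriv (riseCut s₃ s₄) z.1 * Y z.2 ^ 2)) +
      (∫ z : ℝ × EuclideanSpace ℝ (Fin n), cacConst n τ c * u z ^ 2 *
        (timeCut s₁ s₂ s₃ s₄ z.1 * gradSq Y z.2)) +
      ∫ z : ℝ × EuclideanSpace ℝ (Fin n), parabolicOp a u z * u z *
        (timeCut s₁ s₂ s₃ s₄ z.1 * Y z.2 ^ 2) := by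
  set θ := timeCut s₁ s₂ s₃ s₄ with hθdef
  have hθ : ContDiff ℝ ∞ θ := contDiff_timeCut _ _ _ _
  have hθc : HasCompactSupport θ := hasCompactSupport_timeCut h₁₂ h₃₄
  have hY2 : ContDiff ℝ ∞ fun x => Y x ^ 2 := hY.pow 2
  have hY2c : HasCompactSupport fun x => Y x ^ 2 :=
    hYc.comp_left (g := fun r : ℝ => r ^ 2) (by simp)
  have hχ := contDiff_prod_mul hθ hY2
  have hχc := hasCompactSupport_prod_mul hθc hY2c
  have hdr : Continuous (deriv (riseCut s₃ s₄)) :=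
    (contDiff_riseCut s₃ s₄).continuous_deriv (by simp)
  have hgu : Continuous fun z => ∑ i, gradX u z i ^ 2 :=
    continuous_finsetSum _ fun i _ => (contDiff_fderiv_apply hu _).continuous.pow 2
  obtain ⟨hi, h0⟩ := integral_energy_identity a hu hχ hχc (B := fun r => r ^ 2 / 2)
    (B₁ := fun r => r) (B₂ := fun _ => 1)
    (fun r => by simpa using (hasDerivAt_pow 2 r).div_const 2) (fun r => hasDerivAt_id r)
    continuous_const
  have i1 : Integrable fun z : ℝ × EuclideanSpace ℝ (Fin n) => 1 / 2 * u z ^ 2 *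
        (deriv (riseCut s₃ s₄) z.1 * Y z.2 ^ 2) := by
    refine Continuous.integrable_of_hasCompactSupport ?_ (hasCompactSupport_prod_mul
      (hasCompactSupport_deriv_riseCut h₃₄) hY2c).mul_left
    exact (continuous_const.mul (hu.continuous.pow 2)).mul
      ((hdr.comp continuous_fst).mul (hY2.continuous.comp continuous_snd))
  have i2 : Integrable fun z : ℝ × EuclideanSpace ℝ (Fin n) => cacConst n τ c * u z ^ 2 *
        (θ z.1 * gradSq Y z.2) := by
    refine Continuous.integrable_of_hasCompactSupport ?_ (hasCompactSupport_prod_mul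
      hθc (hasCompactSupport_gradSq hYc)).mul_left
    exact (continuous_const.mul (hu.continuous.pow 2)).mul
      ((hθ.continuous.comp continuous_fst).mul ((continuous_gradSq hY).comp continuous_snd))
  have i3 : Integrable fun z : ℝ × EuclideanSpace ℝ (Fin n) => parabolicOp a u z * u z *
        (θ z.1 * Y z.2 ^ 2) := by
    refine Continuous.integrable_of_hasCompactSupport ?_ hχc.mul_left
    exact ((contDiff_parabolicOp a hu).continuous.mul hu.continuous).mul hχ.continuous
  have i4 : Integrable fun z : ℝ × EuclideanSpace ℝ (Fin n) =>
      3 / 8 * c * (∑ i, gradX u z i ^ 2) * (θ z.1 * Y z.2 ^ 2) := by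
    refine Continuous.integrable_of_hasCompactSupport ?_ hχc.mul_left
    exact (continuous_const.mul hgu).mul hχ.continuous
  refine integral_le_integral_add_three i4 i1 i2 i3 hi h0 (ae_of_all _ fun z => ?_)
  have hθ0 : 0 ≤ θ z.1 := timeCut_nonneg _ _ _ _ _
  simp only [fderiv_prod_mul_dirT hθ hY2]
  have hgrad : ∀ i, gradX (fun z : ℝ × EuclideanSpace ℝ (Fin n) => θ z.1 * Y z.2 ^ 2) z i =
      2 * (θ z.1 * Y z.2) * fderiv ℝ Y z.2 (EuclideanSpace.single i 1) := by
    intro i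
    have hd : HasFDerivAt (fun x => Y x ^ 2) _ z.2 :=
      ((hY.differentiable (by simp)) z.2).hasFDerivAt.pow 2
    rw [gradX, fderiv_prod_mul_dirX hθ hY2, hd.fderiv]
    simp
    ring
  have hq : u z * quadForm a (gradX (fun z : ℝ × EuclideanSpace ℝ (Fin n) =>
      θ z.1 * Y z.2 ^ 2) z) (gradX u z) = 2 * θ z.1 * quadForm a
        (fun i => u z * fderiv ℝ Y z.2 (EuclideanSpace.single i 1))
        (fun i => Y z.2 * gradX u z i) := by
    simp only [quadForm, hgrad, Finset.mul_sum]
    refine Finset.sum_congr rfl fun i _ => Finset.sum_congr rfl fun j _ => ?_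
    ring
  rw [hq]
  have hτn : 0 ≤ τ * n := by positivity
  -- The Young parameter leaves at most `c / 8` in front of the gradient (`hkey`), which reduces the
  -- ellipticity term `c / 2` to `3c / 8`. The summand 1 keeps the parameter positive when `τ * n =
  -- 0`.
  have hyoung := abs_quadForm_le ha (fun i => u z * fderiv ℝ Y z.2 (EuclideanSpace.single i 1))
        (fun i => Y z.2 * gradX u z i) (c := (2 * (τ * n) + 1) / c) (by positivity)
  simp only [mul_pow, ← Finset.mul_sum] at hyoung
  have hkey : τ * n * (1 / (4 * ((2 * (τ * n) + 1) / c))) ≤ c / 8 := by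
    have : τ * n * (1 / (4 * ((2 * (τ * n) + 1) / c))) =
      c / 8 * ((2 * (τ * n)) / (2 * (τ * n) + 1)) := by field_simp; ring
    rw [this]
    refine mul_le_of_le_one_right (by positivity) ?_
    rw [div_le_one (by positivity)]
    linarith
  have hell' := hell (gradX u z)
  have hdθ := neg_deriv_riseCut_le_deriv_timeCut h₁₂ h₃₄ z.1
  have hp1 := mul_le_mul_of_nonneg_left hell' (mul_nonneg hθ0 (sq_nonneg (Y z.2)))
  have hp2 := mul_le_mul_of_nonneg_left hdθ (mul_nonneg (sq_nonneg (u z)) (sq_nonneg (Y z.2)))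
  have hG0 : 0 ≤ ∑ i, gradX u z i ^ 2 := Finset.sum_nonneg fun _ _ => sq_nonneg _
  have hp3 := mul_le_mul_of_nonneg_left (neg_abs_le (quadForm a
        (fun i => u z * fderiv ℝ Y z.2 (EuclideanSpace.single i 1))
        (fun i => Y z.2 * gradX u z i))) hθ0
  have hp4 := mul_le_mul_of_nonneg_left hyoung hθ0
  have hp5 := mul_le_mul_of_nonneg_right hkey
    (mul_nonneg (mul_nonneg hθ0 (sq_nonneg (Y z.2))) hG0)
  have e1 : τ * n * ((2 * (τ * n) + 1) / c * (u z ^ 2 * gradSq Y z.2) +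
      1 / (4 * ((2 * (τ * n) + 1) / c)) * (Y z.2 ^ 2 * ∑ i, gradX u z i ^ 2)) =
      cacConst n τ c * (u z ^ 2 * gradSq Y z.2) + (τ * n * (1 / (4 * ((2 * (τ * n) + 1) / c)))) *
        (Y z.2 ^ 2 * ∑ i, gradX u z i ^ 2) := by
    unfold cacConst; ring
  change _ ≤ θ z.1 * (τ * n * ((2 * (τ * n) + 1) / c * (u z ^ 2 * gradSq Y z.2) +
      1 / (4 * ((2 * (τ * n) + 1) / c)) * (Y z.2 ^ 2 * ∑ i, gradX u z i ^ 2))) at hp4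
  rw [e1] at hp4
  simp only [← hθdef] at hp2
  linarith

/-! ### Local approximation of a strong solution. -/

/-- The bounded cylinder `(t, T) × ball 0 R`. -/
def slabBall (n : ℕ) (t T R : ℝ) : Set (ℝ × EuclideanSpace ℝ (Fin n)) :=
  Ioo t T ×ˢ Metric.ball 0 R

theorem isOpen_slabBall (n : ℕ) (t T R : ℝ) : IsOpen (slabBall n t T R) :=
  isOpen_Ioo.prod Metric.isOpen_ball

theorem slabBall_subset_openSlab (n : ℕ) (t T R : ℝ) : slabBall n t T R ⊆ openSlab n t T :=
  prod_mono subset_rfl (subset_univ _)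

theorem slabBall_subset_compact (n : ℕ) (t T R : ℝ) :
    slabBall n t T R ⊆ Icc t T ×ˢ Metric.closedBall 0 R :=
  prod_mono Ioo_subset_Icc_self Metric.ball_subset_closedBall

/-- Pointwise `|f| ≤ ρ + f²/ρ`. The free `ρ` turns smallness in `L²` into smallness in `L¹` on a set
of finite measure. -/
theorem integral_abs_le_of_sq {α : Type*} [MeasurableSpace α] {μ : Measure α} [IsFiniteMeasure μ]
    {f : α → ℝ} (hf : MemLp f 2 μ) {ρ : ℝ} (hρ : 0 < ρ) :
    Integrable (fun x => |f x|) μ ∧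
      ∫ x, |f x| ∂μ ≤ ρ * μ.real univ + (∫ x, f x ^ 2 ∂μ) / ρ := by
  have h1 : Integrable (fun x => |f x|) μ := (hf.integrable (by norm_num)).abs
  refine ⟨h1, ?_⟩
  have h2 : Integrable (fun x => f x ^ 2 / ρ) μ := hf.integrable_sq.div_const _
  calc ∫ x, |f x| ∂μ ≤ ∫ x, (ρ + f x ^ 2 / ρ) ∂μ := by
        refine integral_mono h1 ((integrable_const _).add h2) fun x => ?_
        have : f x ^ 2 / ρ = |f x| ^ 2 / ρ := by rw [sq_abs]
        simp only [this]
        have e : ρ + |f x| ^ 2 / ρ - |f x| = ((ρ - |f x|) ^ 2 + ρ * |f x|) / ρ := by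
          field_simp; ring
        have : 0 ≤ ((ρ - |f x|) ^ 2 + ρ * |f x|) / ρ := by positivity
        linarith
    _ = _ := by
        rw [integral_add (integrable_const _) h2, integral_const, integral_div, smul_eq_mul,
          mul_comm]

section

variable {n : ℕ} {κ : ℕ → ℝ × EuclideanSpace ℝ (Fin n) → ℝ} {δ ε : ℕ → ℝ}

/-- `w` may fail to be square integrable on `G`, so it is truncated to a compact set between `S` and
`G`; on `S`, once the kernel is small, the two truncations have the same mollification. -/
theorem IsMollifierSeq.eventually_local_L2 (hκ : IsMollifierSeq κ δ ε)
    {w : ℝ × EuclideanSpace ℝ (Fin n) → ℝ} {t T : ℝ} (hw : IsL2Loc (openSlab n t T) w)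
    {S G : Set (ℝ × EuclideanSpace ℝ (Fin n))} (hS : IsCompact S) (hG : IsOpen G) (hSG : S ⊆ G)
    (hGΩ : G ⊆ openSlab n t T) {η : ℝ} (hη : 0 < η) :
    ∀ᶠ k in atTop, MemLp (fun z => mollify (κ k) (G.indicator w) z - w z) 2 (volume.restrict S) ∧
      ∫ z in S, (mollify (κ k) (G.indicator w) z - w z) ^ 2 ≤ η := by
  obtain ⟨S', hS'c, hSS', hS'G⟩ := exists_compact_between hS hG hSG
  have hmem : MemLp (S'.indicator w) 2 :=
    (memLp_indicator_iff_restrict hS'c.measurableSet).2 (hw S' hS'c (hS'G.trans hGΩ))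
  filter_upwards [hκ.tendsto_L2 hmem hη,
    hκ.eventually_box_subset hS isOpen_interior hSS'] with k ⟨h1, h2⟩ h3
  have heq : ∀ z ∈ S, mollify (κ k) (S'.indicator w) z - S'.indicator w z =
      mollify (κ k) (G.indicator w) z - w z := by
    intro z hz
    have hb := (h3 z hz).trans interior_subset
    rw [mollify_indicator_eq_setIntegral (hκ.isMollifier k).support_subset
        (measurableSet_openSlab n t T) hb (hb.trans (hS'G.trans hGΩ)),
      mollify_indicator_eq_setIntegral (hκ.isMollifier k).support_subset
        (measurableSet_openSlab n t T) (hb.trans hS'G) (hb.trans (hS'G.trans hGΩ)),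
      indicator_of_mem (interior_subset (hSS' hz))]
  refine ⟨((h1.restrict S).ae_eq ?_), ?_⟩
  · exact (ae_restrict_iff' hS.measurableSet).2 (ae_of_all _ heq)
  · calc _ = ∫ z in S, (mollify (κ k) (S'.indicator w) z - S'.indicator w z) ^ 2 :=
          setIntegral_congr_fun hS.measurableSet fun z hz => by simp only [heq z hz]
      _ ≤ ∫ z, (mollify (κ k) (S'.indicator w) z - S'.indicator w z) ^ 2 :=
          setIntegral_le_integral h1.integrable_sq (ae_of_all _ fun _ => sq_nonneg _)
      _ ≤ η := h2

theorem IsMollifierSeq.eventually_local_L1 (hκ : IsMollifierSeq κ δ ε)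
    {w : ℝ × EuclideanSpace ℝ (Fin n) → ℝ} {t T : ℝ} (hw : IsL2Loc (openSlab n t T) w)
    {S G : Set (ℝ × EuclideanSpace ℝ (Fin n))} (hS : IsCompact S) (hG : IsOpen G) (hSG : S ⊆ G)
    (hGΩ : G ⊆ openSlab n t T) {η : ℝ} (hη : 0 < η) :
    ∀ᶠ k in atTop, IntegrableOn (fun z => |mollify (κ k) (G.indicator w) z - w z|) S ∧
      ∫ z in S, |mollify (κ k) (G.indicator w) z - w z| ≤ η := by
  have : IsFiniteMeasure (volume.restrict S) := ⟨by
    rw [Measure.restrict_apply_univ]; exact hS.measure_lt_top⟩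
  set v := (volume.restrict S).real univ with hv
  have hv0 : 0 ≤ v := measureReal_nonneg
  -- Makes `ρ * v` at most `η / 2`; the `L²` tolerance `ρ * (η / 2)` below is chosen so that
  -- division by `ρ` gives the other half.
  set ρ := η / (2 * (v + 1)) with hρ
  have hρ0 : 0 < ρ := by positivity
  filter_upwards [hκ.eventually_local_L2 hw hS hG hSG hGΩ (η := ρ * (η / 2)) (by positivity)]
    with k ⟨h1, h2⟩
  obtain ⟨h3, h4⟩ := integral_abs_le_of_sq h1 hρ0
  refine ⟨h3, h4.trans ?_⟩
  have e1 : (∫ z in S, (mollify (κ k) (G.indicator w) z - w z) ^ 2) / ρ ≤ η / 2 := by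
    rw [div_le_iff₀ hρ0, mul_comm]; exact h2
  have e2 : ρ * v ≤ η / 2 := by
    have : ρ * v = η / 2 * (v / (v + 1)) := by rw [hρ]; field_simp
    rw [this]
    exact mul_le_of_le_one_right (by positivity) ((div_le_one (by positivity)).2 (by linarith))
  linarith

end

section

variable {n : ℕ} {a : Matrix (Fin n) (Fin n) ℝ} {t T : ℝ}
  {g : ℝ × EuclideanSpace ℝ (Fin n) → EuclideanSpace ℝ (Fin n)}
  {l : ℝ × EuclideanSpace ℝ (Fin n) → ℝ} {lT : EuclideanSpace ℝ (Fin n) → ℝ}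
  {J Js : ℝ × EuclideanSpace ℝ (Fin n) → ℝ}
  {DJ : ℝ × EuclideanSpace ℝ (Fin n) → EuclideanSpace ℝ (Fin n)}
  {HJ : ℝ × EuclideanSpace ℝ (Fin n) → Matrix (Fin n) (Fin n) ℝ}

theorem IsL2Loc.neg {Ω : Set (ℝ × EuclideanSpace ℝ (Fin n))}
    {w : ℝ × EuclideanSpace ℝ (Fin n) → ℝ} (h : IsL2Loc Ω w) : IsL2Loc Ω fun z => -w z :=
  fun S hS hSΩ => (h S hS hSΩ).neg

theorem HasWeakDeriv.neg {Ω : Set (ℝ × EuclideanSpace ℝ (Fin n))}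
    {v : ℝ × EuclideanSpace ℝ (Fin n)} {u w : ℝ × EuclideanSpace ℝ (Fin n) → ℝ}
    (h : HasWeakDeriv Ω v u w) : HasWeakDeriv Ω v (fun z => -u z) fun z => -w z := by
  refine ⟨h.1.neg, h.2.1.neg, fun φ h1 h2 h3 => ?_⟩
  simp only [neg_mul, integral_neg]
  rw [h.2.2 φ h1 h2 h3]

theorem IsStrongSolution.neg (hJ : IsStrongSolution a g l lT t T J Js DJ HJ) :
    IsStrongSolution a g (fun z => -l z) (fun x => -lT x) t T (fun z => -J z) (fun z => -Js z)
      (fun z => -DJ z) (fun z => -HJ z) where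
  continuousOn := hJ.continuousOn.neg
  weakDeriv_time := hJ.weakDeriv_time.neg
  weakDeriv_space i := (hJ.weakDeriv_space i).neg
  weakDeriv_hess i j := (hJ.weakDeriv_hess i j).neg
  equation := by
    filter_upwards [hJ.equation] with z hz
    rw [← hz]
    simp only [diffusionOp, Matrix.neg_apply, mul_neg, Finset.sum_neg_distrib, inner_neg_right]
    ring
  terminal x := by rw [hJ.terminal x]

/-- By the equation this function coincides almost everywhere with a combination of `Js` and the
entries of `HJ`, which are in `L²_loc`. -/
theorem IsStrongSolution.isL2Loc_rhs (hJ : IsStrongSolution a g l lT t T J Js DJ HJ) :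
    IsL2Loc (openSlab n t T) fun z => l z + inner ℝ (g z) (DJ z) := by
  intro S hS hSΩ
  have h1 : MemLp (fun z => -Js z + -(1 / 2) * ∑ i, ∑ j, a i j * HJ z i j) 2
      (volume.restrict S) := by
    refine (hJ.weakDeriv_time.2.1 S hS hSΩ).neg.add (MemLp.const_mul ?_ _)
    exact memLp_finsetSum _ fun i _ => memLp_finsetSum _ fun j _ =>
      ((hJ.weakDeriv_hess i j).2.1 S hS hSΩ).const_mul _
  refine h1.ae_eq ?_
  filter_upwards [ae_restrict_of_ae_restrict_of_subset hSΩ hJ.equation] with z hz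
  rw [diffusionOp] at hz
  linarith

theorem IsStrongSolution.integrable_indicator
    (hJ : IsStrongSolution a g l lT t T J Js DJ HJ) (R : ℝ) :
    Integrable ((slabBall n t T R).indicator J) := by
  rw [integrable_indicator_iff (isOpen_slabBall n t T R).measurableSet]
  refine IntegrableOn.mono_set ?_ (slabBall_subset_compact n t T R)
  exact (hJ.continuousOn.mono (prod_mono subset_rfl (subset_univ _))).integrableOn_compact
    (isCompact_Icc.prod (isCompact_closedBall _ _))

theorem IsStrongSolution.continuousOn_slabBall
    (hJ : IsStrongSolution a g l lT t T J Js DJ HJ) (R : ℝ) :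
    ContinuousOn J (slabBall n t T R) :=
  hJ.continuousOn.mono ((slabBall_subset_compact n t T R).trans
    (prod_mono subset_rfl (subset_univ _)))

end

/-! ### The maximum principle. -/

theorem gradX_sub {n : ℕ} {u v : ℝ × EuclideanSpace ℝ (Fin n) → ℝ} (hu : ContDiff ℝ ∞ u)
    (hv : ContDiff ℝ ∞ v) (z : ℝ × EuclideanSpace ℝ (Fin n)) (i : Fin n) :
    gradX (fun y => u y - v y) z i = gradX u z i - gradX v z i := by
  unfold gradX
  rw [fderiv_fun_sub (hu.differentiable (by simp) z) (hv.differentiable (by simp) z)]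
  rfl

theorem parabolicOp_sub {n : ℕ} (a : Matrix (Fin n) (Fin n) ℝ)
    {u v : ℝ × EuclideanSpace ℝ (Fin n) → ℝ} (hu : ContDiff ℝ ∞ u)
    (hv : ContDiff ℝ ∞ v) (z : ℝ × EuclideanSpace ℝ (Fin n)) :
    parabolicOp a (fun y => u y - v y) z = parabolicOp a u z - parabolicOp a v z := by
  have h1 : ∀ w, (fun y => fderiv ℝ (fun y => u y - v y) y w) =
      fun y => fderiv ℝ u y w - fderiv ℝ v y w := fun w => by
    ext y
    rw [fderiv_fun_sub (hu.differentiable (by simp) y) (hv.differentiable (by simp) y)]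
    rfl
  have h2 : ∀ i j, hessX (fun y => u y - v y) z i j = hessX u z i j - hessX v z i j := by
    intro i j
    unfold hessX
    rw [h1, fderiv_fun_sub ((contDiff_fderiv_apply hu _).differentiable (by simp) z)
      ((contDiff_fderiv_apply hv _).differentiable (by simp) z)]
    rfl
  unfold parabolicOp diffusionOp
  simp only [h2, congrFun (h1 _) z, mul_sub, Finset.sum_sub_distrib]
  ring

theorem hasDerivAt_max_pow (m : ℕ) (hm : 2 ≤ m) (r : ℝ) :
    HasDerivAt (fun r : ℝ => max r 0 ^ m) (m * max r 0 ^ (m - 1)) r := by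
  rcases lt_trichotomy r 0 with h | h | h
  · have : (fun r : ℝ => max r 0 ^ m) =ᶠ[𝓝 r] fun _ => 0 := by
      filter_upwards [Iio_mem_nhds h] with s hs
      rw [max_eq_right (le_of_lt hs), zero_pow (by omega)]
    rw [max_eq_right h.le, zero_pow (by omega), mul_zero]
    exact (hasDerivAt_const r (0 : ℝ)).congr_of_eventuallyEq this
  · subst h
    rw [max_self, zero_pow (by omega), mul_zero, hasDerivAt_iff_isLittleO]
    simp only [max_self, sub_zero, smul_zero]
    rw [zero_pow (by omega)]
    simp only [sub_zero]
    have h1 : (fun r : ℝ => max r 0 ^ m) =O[𝓝 0] fun r => r ^ m := by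
      refine Asymptotics.isBigO_of_le _ fun s => ?_
      rw [norm_pow, norm_pow, Real.norm_eq_abs, Real.norm_eq_abs]
      refine pow_le_pow_left₀ (abs_nonneg _) ?_ m
      rw [abs_of_nonneg (le_max_right _ _)]
      exact max_le (le_abs_self _) (abs_nonneg _)
    have h2 : (fun r : ℝ => r ^ m) =o[𝓝 0] fun r : ℝ => r := by
      simpa using Asymptotics.isLittleO_pow_pow (𝕜 := ℝ) (m := 1) (n := m) (by omega)
    exact h1.trans_isLittleO h2
  · have : (fun r : ℝ => max r 0 ^ m) =ᶠ[𝓝 r] fun r => r ^ m := by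
      filter_upwards [Ioi_mem_nhds h] with s hs
      rw [max_eq_left (le_of_lt hs)]
    rw [max_eq_left h.le]
    exact (hasDerivAt_pow m r).congr_of_eventuallyEq this

/-- With `p = w₊` and the choice `B = w₊³`, the drift term is absorbed exactly by the dissipation `½
· 6p · a(Dw, Dw)`; the remainder is a multiple of `p³`, left for an exponential weight in time. -/
theorem mul_sum_le_of_ellipticity {n : ℕ} {c Gb p : ℝ} (hc : 0 < c) (hp : 0 ≤ p)
    (g ξ : Fin n → ℝ) (hg : ∑ i, g i ^ 2 ≤ Gb ^ 2) :
    (∑ i, g i * ξ i) * (3 * p ^ 2) ≤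
      3 * p * (c * ∑ i, ξ i ^ 2) + 3 * Gb ^ 2 / (4 * c) * p ^ 3 := by
  have h1 : (∑ i, g i * ξ i) * p ≤ c * (∑ i, ξ i ^ 2) + (∑ i, g i ^ 2) * (p ^ 2 / (4 * c)) := by
    rw [Finset.sum_mul, Finset.sum_mul, Finset.mul_sum, ← Finset.sum_add_distrib]
    refine Finset.sum_le_sum fun i _ => ?_
    have : c * ξ i ^ 2 + g i ^ 2 * (p ^ 2 / (4 * c)) - g i * ξ i * p =
        (2 * c * ξ i - g i * p) ^ 2 / (4 * c) := by field_simp; ring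
    have h0 : 0 ≤ (2 * c * ξ i - g i * p) ^ 2 / (4 * c) := by positivity
    linarith
  have h2 : (∑ i, g i ^ 2) * (p ^ 2 / (4 * c)) ≤ Gb ^ 2 * (p ^ 2 / (4 * c)) :=
    mul_le_mul_of_nonneg_right hg (by positivity)
  have h3 := mul_le_mul_of_nonneg_left (h1.trans (add_le_add_right h2 _))
    (by positivity : 0 ≤ 3 * p)
  have e : 3 * p * (c * (∑ i, ξ i ^ 2) + Gb ^ 2 * (p ^ 2 / (4 * c))) =
      3 * p * (c * ∑ i, ξ i ^ 2) + 3 * Gb ^ 2 / (4 * c) * p ^ 3 := by field_simp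
  rw [← e]
  calc _ = 3 * p * ((∑ i, g i * ξ i) * p) := by ring
    _ ≤ _ := h3

section

variable {n : ℕ} {a : Matrix (Fin n) (Fin n) ℝ} {t T : ℝ}
  {g : ℝ × EuclideanSpace ℝ (Fin n) → EuclideanSpace ℝ (Fin n)}
  {l : ℝ × EuclideanSpace ℝ (Fin n) → ℝ} {lT : EuclideanSpace ℝ (Fin n) → ℝ}
  {J Js : ℝ × EuclideanSpace ℝ (Fin n) → ℝ}
  {DJ : ℝ × EuclideanSpace ℝ (Fin n) → EuclideanSpace ℝ (Fin n)}
  {HJ : ℝ × EuclideanSpace ℝ (Fin n) → Matrix (Fin n) (Fin n) ℝ}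

theorem inner_eq_sum_mul (x y : EuclideanSpace ℝ (Fin n)) : inner ℝ x y = ∑ i, x i * y i := by
  rw [PiLp.inner_apply]
  exact Finset.sum_congr rfl fun i _ => by simp [mul_comm]

/-- The error made when the equation is tested on an approximation of the solution. -/
noncomputable def approxError (a : Matrix (Fin n) (Fin n) ℝ)
    (g : ℝ × EuclideanSpace ℝ (Fin n) → EuclideanSpace ℝ (Fin n))
    (l : ℝ × EuclideanSpace ℝ (Fin n) → ℝ)
    (DJ : ℝ × EuclideanSpace ℝ (Fin n) → EuclideanSpace ℝ (Fin n)) (Gb : ℝ)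
    (v : ℝ × EuclideanSpace ℝ (Fin n) → ℝ) (z : ℝ × EuclideanSpace ℝ (Fin n)) : ℝ :=
  |parabolicOp a v z - (l z + inner ℝ (g z) (DJ z))| + Gb * ∑ i, |gradX v z i - DJ z i|

theorem abs_parabolicOp_sub_le {Gb : ℝ} {v : ℝ × EuclideanSpace ℝ (Fin n) → ℝ}
    {z : ℝ × EuclideanSpace ℝ (Fin n)} (hg : ‖g z‖ ≤ Gb) :
    |parabolicOp a v z - l z - ∑ i, g z i * gradX v z i| ≤ approxError a g l DJ Gb v z := by
  have h1 : |∑ i, g z i * (gradX v z i - DJ z i)| ≤ Gb * ∑ i, |gradX v z i - DJ z i| := by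
    rw [Finset.mul_sum]
    refine (Finset.abs_sum_le_sum_abs _ _).trans (Finset.sum_le_sum fun i _ => ?_)
    rw [abs_mul]
    refine mul_le_mul_of_nonneg_right ?_ (abs_nonneg _)
    exact (PiLp.norm_apply_le (g z) i).trans hg
  have h2 : parabolicOp a v z - l z - ∑ i, g z i * gradX v z i =
      (parabolicOp a v z - (l z + inner ℝ (g z) (DJ z))) -
        ∑ i, g z i * (gradX v z i - DJ z i) := by
    simp only [mul_sub, Finset.sum_sub_distrib, inner_eq_sum_mul]
    ring
  rw [h2]
  exact (abs_sub _ _).trans (add_le_add_right h1 _)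

theorem approxError_nonneg {Gb : ℝ} (hG : 0 ≤ Gb) {v : ℝ × EuclideanSpace ℝ (Fin n) → ℝ}
    {z : ℝ × EuclideanSpace ℝ (Fin n)} : 0 ≤ approxError a g l DJ Gb v z :=
  add_nonneg (abs_nonneg _) (mul_nonneg hG (Finset.sum_nonneg fun _ _ => abs_nonneg _))

/-- On compact sets both parts of the error are `L¹` distances between an `L²_loc` function and its
mollification, namely of `l + g · DJ` and of the components of `DJ`. -/
theorem IsStrongSolution.eventually_approxError
    (hJ : IsStrongSolution a g l lT t T J Js DJ HJ)
    {κ : ℕ → ℝ × EuclideanSpace ℝ (Fin n) → ℝ} {δ ε : ℕ → ℝ} (hκ : IsMollifierSeq κ δ ε)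
    {S : Set (ℝ × EuclideanSpace ℝ (Fin n))} (hS : IsCompact S) {R : ℝ}
    (hSR : S ⊆ slabBall n t T R) {Gb : ℝ} (hG : 0 ≤ Gb) {η : ℝ} (hη : 0 < η) :
    ∀ᶠ k in atTop, IntegrableOn (approxError a g l DJ Gb
        (mollify (κ k) ((slabBall n t T R).indicator J))) S ∧
      ∫ z in S, approxError a g l DJ Gb (mollify (κ k) ((slabBall n t T R).indicator J)) z ≤ η := by
  have hop := isOpen_slabBall n t T R
  have hΩ := slabBall_subset_openSlab n t T R
  have hl := (hJ.integrable_indicator R).locallyIntegrable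
  have hη' : 0 < η / (2 * (Gb * n + 1)) := by positivity
  have hgrad := eventually_all.2 fun i =>
    hκ.eventually_local_L1 (hJ.weakDeriv_space i).2.1 hS hop hSR hΩ hη'
  filter_upwards [hκ.eventually_local_L1 hJ.isL2Loc_rhs hS hop hSR hΩ (half_pos hη), hgrad,
    hκ.eventually_box_subset hS hop hSR] with k ⟨h1, h2⟩ h3 h4
  have heq : ∀ z ∈ S, approxError a g l DJ Gb
      (mollify (κ k) ((slabBall n t T R).indicator J)) z =
      |mollify (κ k) ((slabBall n t T R).indicator fun z => l z + inner ℝ (g z) (DJ z)) z -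
        (l z + inner ℝ (g z) (DJ z))| + Gb * ∑ i,
        |mollify (κ k) ((slabBall n t T R).indicator fun z => DJ z i) z - DJ z i| := by
    intro z hz
    have hb := h4 z hz
    rw [approxError, hJ.parabolicOp_mollify (hκ.isMollifier k) hl hb (hb.trans hΩ)]
    simp only [gradX, fderiv_mollify_eq_of_hasWeakDeriv (hJ.weakDeriv_space _) (hκ.isMollifier k)
      hl hb (hb.trans hΩ)]
  have i2 : IntegrableOn (fun z => ∑ i,
        |mollify (κ k) ((slabBall n t T R).indicator fun z => DJ z i) z - DJ z i|) S :=
    integrable_finsetSum _ fun i _ => (h3 i).1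
  have hi : IntegrableOn (fun z =>
      |mollify (κ k) ((slabBall n t T R).indicator fun z => l z + inner ℝ (g z) (DJ z)) z -
        (l z + inner ℝ (g z) (DJ z))| + Gb * ∑ i,
        |mollify (κ k) ((slabBall n t T R).indicator fun z => DJ z i) z - DJ z i|) S :=
    h1.add (i2.const_mul _)
  refine ⟨(integrableOn_congr_fun heq hS.measurableSet).2 hi, ?_⟩
  rw [setIntegral_congr_fun hS.measurableSet heq, integral_add h1 (i2.const_mul _),
    integral_const_mul, integral_finsetSum _ fun i _ => (h3 i).1]
  have h5 : ∑ i, ∫ z in S,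
      |mollify (κ k) ((slabBall n t T R).indicator fun z => DJ z i) z - DJ z i| ≤
      n * (η / (2 * (Gb * n + 1))) := by
    refine (Finset.sum_le_sum fun i _ => (h3 i).2).trans ?_
    simp
  have h6 : Gb * (n * (η / (2 * (Gb * n + 1)))) ≤ η / 2 := by
    have : Gb * (n * (η / (2 * (Gb * n + 1)))) = η / 2 * ((Gb * n) / (Gb * n + 1)) := by
      field_simp
    rw [this]
    exact mul_le_of_le_one_right (by positivity) ((div_le_one (by positivity)).2 (by linarith))
  linarith [mul_le_mul_of_nonneg_left h5 hG]

/-- A maximum principle: a strong solution lies below a smooth strict supersolution which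
dominates it at the terminal time and near infinity. -/
theorem IsStrongSolution.le_of_supersolution
    (hJ : IsStrongSolution a g l lT t T J Js DJ HJ) {c : ℝ} (hc : 0 < c)
    (hell : ∀ ξ : Fin n → ℝ, c * ∑ i, ξ i ^ 2 ≤ quadForm a ξ ξ)
    (hg : ∀ R : ℝ, ∃ Gb : ℝ, ∀ s ∈ Icc t T, ∀ x, ‖x‖ ≤ R → ‖g (s, x)‖ ≤ Gb)
    {ψ : ℝ × EuclideanSpace ℝ (Fin n) → ℝ} (hψ : ContDiff ℝ ∞ ψ)
    (hsup : ∀ z ∈ openSlab n t T, l z + ∑ i, g z i * gradX ψ z i ≤ parabolicOp a ψ z)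
    (hT : ∀ x, lT x < ψ (T, x)) {R : ℝ} (hR1 : 1 ≤ R)
    (hR : ∀ s ∈ Icc t T, ∀ x, R ≤ ‖x‖ → J (s, x) < ψ (s, x)) :
    ∀ z ∈ openSlab n t T, J z ≤ ψ z := by
  rintro ⟨s₀, x₀⟩ hz₀
  by_contra! hcon
  have hs₀ : s₀ ∈ Ioo t T := hz₀.1
  have hx₀ : ‖x₀‖ < R := by
    by_contra! h
    exact (hR s₀ (Ioo_subset_Icc_self hs₀) x₀ h).not_gt hcon
  have hwc : ContinuousOn (fun z => J z - ψ z) (Icc t T ×ˢ univ) :=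
    hJ.continuousOn.sub hψ.continuous.continuousOn
  -- the last time at which the solution touches the supersolution
  obtain ⟨b, hb0, hbT, hb⟩ : ∃ b, s₀ ≤ b ∧ b < T ∧ ∀ s ∈ Icc t T, b < s → ∀ x,
      J (s, x) < ψ (s, x) := by
    have hKc : IsCompact (Icc t T ×ˢ Metric.closedBall (0 : EuclideanSpace ℝ (Fin n)) R) :=
      isCompact_Icc.prod (isCompact_closedBall _ _)
    have hA : IsCompact {z ∈ Icc t T ×ˢ Metric.closedBall (0 : EuclideanSpace ℝ (Fin n)) R |
        (fun z => J z - ψ z) z ∈ Ici 0} := by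
      refine hKc.of_isClosed_subset ?_ (sep_subset _ _)
      exact (hwc.mono (prod_mono subset_rfl (subset_univ _))).preimage_isClosed_of_isClosed
        hKc.isClosed isClosed_Ici
    have hmem : (s₀, x₀) ∈ {z ∈ Icc t T ×ˢ Metric.closedBall (0 : EuclideanSpace ℝ (Fin n)) R |
        (fun z => J z - ψ z) z ∈ Ici 0} := by
      refine ⟨⟨Ioo_subset_Icc_self hs₀, by simpa using hx₀.le⟩, ?_⟩
      simp only [mem_Ici]
      linarith
    obtain ⟨z₁, hz₁, hmax⟩ := hA.exists_isMaxOn ⟨_, hmem⟩ continuous_fst.continuousOn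
    refine ⟨z₁.1, hmax hmem, ?_, ?_⟩
    · refine lt_of_le_of_ne hz₁.1.1.2 fun h => ?_
      have h1 : J (T, z₁.2) = lT z₁.2 := hJ.terminal _
      have h2 := hT z₁.2
      have h3 : 0 ≤ J z₁ - ψ z₁ := hz₁.2
      rw [show z₁ = (T, z₁.2) from Prod.ext h rfl] at h3
      linarith
    · intro s hs hbs x
      by_contra! h
      have hxR : ‖x‖ < R := by
        by_contra! h'
        exact (hR s hs x h').not_ge h
      have : (s, x) ∈ {z ∈ Icc t T ×ˢ Metric.closedBall (0 : EuclideanSpace ℝ (Fin n)) R |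
          (fun z => J z - ψ z) z ∈ Ici 0} := by
        refine ⟨⟨hs, by simpa using hxR.le⟩, ?_⟩
        simp only [mem_Ici]
        linarith
      exact (hmax this).not_gt hbs
  obtain ⟨Gb', hGb'⟩ := hg (R + 1)
  set Gb := max Gb' 0 with hGbdef
  have hGb0 : 0 ≤ Gb := le_max_right _ _
  -- cutoff functions
  set s₁ := (t + s₀) / 2 with hs₁
  -- Both `s₃` and `s₄` lie strictly between `b` and `T`, so the time cutoff falls only where the
  -- solution is already below `ψ`.
  set s₃ := (2 * b + T) / 3 with hs₃
  set s₄ := (b + 2 * T) / 3 with hs₄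
  have hts : t < s₀ := hs₀.1
  have h12 : s₁ < s₀ := by rw [hs₁]; linarith
  have h34 : s₃ < s₄ := by rw [hs₃, hs₄]; linarith
  have hts1 : t < s₁ := by rw [hs₁]; linarith
  have hs4T : s₄ < T := by rw [hs₄]; linarith
  have hbs3 : b < s₃ := by rw [hs₃]; linarith
  -- The first summand compensates the remainder of the drift; the 1 produces the integral of `w₊³
  -- χ` that is to be bounded.
  set Λ := 3 * Gb ^ 2 / (4 * c) + 1 with hΛ
  have hΛ0 : 0 ≤ Λ := by positivity
  let θ : ℝ → ℝ := fun s => Real.exp (Λ * s) * timeCut s₁ s₀ s₃ s₄ s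
  have hexp : ContDiff ℝ ∞ fun s : ℝ => Real.exp (Λ * s) :=
    Real.contDiff_exp.comp (contDiff_const.mul contDiff_id)
  have hθ : ContDiff ℝ ∞ θ := hexp.mul (contDiff_timeCut _ _ _ _)
  have hθc : HasCompactSupport θ := (hasCompactSupport_timeCut h12 h34).mul_left
  let X : ContDiffBump (0 : EuclideanSpace ℝ (Fin n)) :=
    ⟨R, R + 1, by linarith, by linarith⟩
  have hX : ContDiff ℝ ∞ X := X.contDiff
  let χ : ℝ × EuclideanSpace ℝ (Fin n) → ℝ := fun z => θ z.1 * X z.2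
  have hχ : ContDiff ℝ ∞ χ := contDiff_prod_mul hθ hX
  have hχc : HasCompactSupport χ := hasCompactSupport_prod_mul hθc X.hasCompactSupport
  have hθ0 : ∀ s, 0 ≤ θ s := fun s => mul_nonneg (Real.exp_pos _).le (timeCut_nonneg _ _ _ _ _)
  have hχ0 : ∀ z, 0 ≤ χ z := fun z => mul_nonneg (hθ0 _) X.nonneg
  let S : Set (ℝ × EuclideanSpace ℝ (Fin n)) := Icc s₁ s₄ ×ˢ Metric.closedBall 0 (R + 1)
  have hScomp : IsCompact S := isCompact_Icc.prod (isCompact_closedBall _ _)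
  have hSG : S ⊆ slabBall n t T (R + 2) := prod_mono
    (fun s hs => ⟨hts1.trans_le hs.1, hs.2.trans_lt hs4T⟩)
    (Metric.closedBall_subset_ball (by linarith))
  have hSI : S ⊆ Icc t T ×ˢ univ := prod_mono
    (fun s hs => ⟨hts1.le.trans hs.1, hs.2.trans hs4T.le⟩) (subset_univ _)
  have hχS : Function.support χ ⊆ S := by
    intro z hz
    refine ⟨timeCut_support h12 h34 (right_ne_zero_of_mul (left_ne_zero_of_mul hz)), ?_⟩
    have : z.2 ∈ Function.support X := right_ne_zero_of_mul hz
    rw [X.support_eq] at this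
    exact Metric.ball_subset_closedBall this
  have hGbS : ∀ z ∈ S, ‖g z‖ ≤ Gb := fun z hz =>
    (hGb' z.1 (hSI hz).1 z.2 (by simpa using hz.2)).trans (le_max_left _ _)
  -- the part of `S` where the derivatives of the cutoffs are harmful
  let Sb : Set (ℝ × EuclideanSpace ℝ (Fin n)) := S ∩ {z | s₃ ≤ z.1 ∨ R ≤ ‖z.2‖}
  have hSbc : IsCompact Sb := by
    refine hScomp.inter_right ?_
    exact (isClosed_le continuous_const continuous_fst).union
      (isClosed_le continuous_const (continuous_norm.comp continuous_snd))
  have hSbneg : ∀ z ∈ Sb, J z - ψ z < 0 := by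
    rintro ⟨s, x⟩ ⟨hzS, h | h⟩
    · exact sub_neg.2 (hb s (hSI hzS).1 (hbs3.trans_le h) x)
    · exact sub_neg.2 (hR s (hSI hzS).1 x h)
  obtain ⟨ρ, hρ0, hρ⟩ : ∃ ρ > 0, ∀ z ∈ Sb, J z - ψ z ≤ -ρ := by
    rcases Sb.eq_empty_or_nonempty with h | h
    · exact ⟨1, one_pos, by simp [h]⟩
    · obtain ⟨z₁, hz₁, hmax⟩ := hSbc.exists_isMaxOn h
        (hwc.mono (inter_subset_left.trans hSI))
      exact ⟨-(J z₁ - ψ z₁), by linarith [hSbneg z₁ hz₁], fun z hz => by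
        have := hmax hz
        simp only [mem_ofPred_eq] at this
        linarith⟩
  -- upper bounds on `S`
  obtain ⟨W, hW⟩ := (hScomp.bddAbove_image (hwc.mono hSI))
  have hW' : ∀ z ∈ S, J z - ψ z ≤ W := fun z hz => hW (mem_image_of_mem _ hz)
  obtain ⟨Cχ, hCχ⟩ := hχ.continuous.bounded_above_of_compact_support hχc
  have hCχ' : ∀ z, χ z ≤ Cχ := fun z => (le_abs_self _).trans (hCχ z)
  have hCχ0 : 0 ≤ Cχ := (hχ0 0).trans (hCχ' 0)
  have hχz : 0 < χ (s₀, x₀) := by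
    have e1 : timeCut s₁ s₀ s₃ s₄ s₀ = 1 :=
      timeCut_eq_one h12 h34 ⟨le_rfl, hb0.trans hbs3.le⟩
    have e2 : X x₀ = 1 := X.one_of_mem_closedBall (by simpa [X] using hx₀.le)
    simp only [χ, θ, e1, e2, mul_one]
    positivity
  -- a closed ball on which the solution exceeds the supersolution
  obtain ⟨r, hr0, hrG, hrw⟩ : ∃ r > 0, Metric.closedBall (s₀, x₀) r ⊆ slabBall n t T (R + 2) ∧
      ∀ z ∈ Metric.closedBall (s₀, x₀) r, (J (s₀, x₀) - ψ (s₀, x₀)) / 2 ≤ J z - ψ z ∧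
        χ (s₀, x₀) / 2 ≤ χ z := by
    have hmemG : (s₀, x₀) ∈ slabBall n t T (R + 2) :=
      ⟨hs₀, by rw [Metric.mem_ball, dist_zero_right]; linarith⟩
    have hnhds := (isOpen_slabBall n t T (R + 2)).mem_nhds hmemG
    have hcJ : ContinuousAt (fun z => J z - ψ z) (s₀, x₀) :=
      ((hJ.continuousOn_slabBall (R + 2)).continuousAt hnhds).sub hψ.continuous.continuousAt
    have hev1 : ∀ᶠ z in 𝓝 (s₀, x₀), (J (s₀, x₀) - ψ (s₀, x₀)) / 2 ≤ J z - ψ z :=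
      Tendsto.eventually_const_le (half_lt_self (by linarith)) hcJ
    have hev2 : ∀ᶠ z in 𝓝 (s₀, x₀), χ (s₀, x₀) / 2 ≤ χ z :=
      Tendsto.eventually_const_le (half_lt_self hχz) hχ.continuous.continuousAt
    have hev := hev1.and (hev2.and hnhds)
    obtain ⟨r, hr, hsub⟩ := Metric.nhds_basis_closedBall.mem_iff.1 hev
    exact ⟨r, hr, fun z hz => (hsub hz).2.2, fun z hz => ⟨(hsub hz).1, (hsub hz).2.1⟩⟩
  set w₀ := J (s₀, x₀) - ψ (s₀, x₀) with hw₀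
  have hw₀0 : 0 < w₀ := by rw [hw₀]; linarith
  set Kr := Metric.closedBall (s₀, x₀) r with hKr
  have hKrc : IsCompact Kr := isCompact_closedBall _ _
  set V := volume.real Kr with hV
  have hV0 : 0 < V := by
    rw [hV, measureReal_def]
    exact ENNReal.toReal_pos (Metric.measure_closedBall_pos volume _ hr0).ne'
      hKrc.measure_lt_top.ne
  -- A bound for the factor `3 w₊² χ` that multiplies the approximation error.
  set D := 3 * (max (W + 1) 0) ^ 2 * Cχ with hD
  have hD0 : 0 ≤ D := by positivity
  set m := (w₀ / 4) ^ 3 * (χ (s₀, x₀) / 2) * V with hm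
  have hm0 : 0 < m := by positivity
  obtain ⟨κ, δ, ε, hκ⟩ := exists_isMollifierSeq n
  have hop := isOpen_slabBall n t T (R + 2)
  have hl := (hJ.integrable_indicator (R + 2)).locallyIntegrable
  -- On `S` an error of `ρ / 2` keeps the mollified difference negative on `Sb`, and an error of 1
  -- keeps it below `W + 1`. On the small ball, where the difference is at least `w₀ / 2`, an error
  -- of `w₀ / 4` leaves `w₀ / 4`. The `L¹` error is then so small that `D` times it is at most half
  -- the lower bound `m`.
  obtain ⟨k, ⟨hk1i, hk1⟩, hk2, hk3, hk4⟩ := ((hJ.eventually_approxError hκ hScomp hSG hGb0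
    (η := m / (2 * (D + 1))) (by positivity)).and
    ((hκ.eventually_abs_sub_le hScomp hop hSG (hJ.continuousOn_slabBall _) hl
      (η := min (ρ / 2) 1) (by positivity)).and
    ((hκ.eventually_abs_sub_le hKrc hop hrG (hJ.continuousOn_slabBall _) hl
      (η := w₀ / 4) (by positivity)).and
    (hκ.eventually_box_subset hScomp hop hSG)))).exists
  set v := mollify (κ k) ((slabBall n t T (R + 2)).indicator J) with hv
  have hvs : ContDiff ℝ ∞ v :=
    contDiff_mollify (hκ.isMollifier k).contDiff (hκ.isMollifier k).hasCompactSupport hl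
  set w := fun z => v z - ψ z with hw
  have hws : ContDiff ℝ ∞ w := hvs.sub hψ
  -- The third power is used because the second derivative of `max(r, 0)³` is still continuous.
  have hB1 : ∀ r, HasDerivAt (fun r : ℝ => max r 0 ^ 3) (3 * max r 0 ^ 2) r := fun r => by
    simpa using hasDerivAt_max_pow 3 (by norm_num) r
  have hB2 : ∀ r, HasDerivAt (fun r : ℝ => 3 * max r 0 ^ 2) (6 * max r 0) r := fun r => by
    have := (hasDerivAt_max_pow 2 le_rfl r).const_mul 3
    simp only [Nat.cast_ofNat, Nat.add_one_sub_one, pow_one] at this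
    rw [show (6 : ℝ) * max r 0 = 3 * (2 * max r 0) by ring]
    exact this
  obtain ⟨hI, hI0⟩ := integral_energy_identity a hws hχ hχc hB1 hB2
    (continuous_const.mul (continuous_id.max continuous_const))
  set I := fun z => max (w z) 0 ^ 3 * fderiv ℝ χ z (dirT n) +
      1 / 2 * (6 * max (w z) 0 * quadForm a (gradX w z) (gradX w z) * χ z) +
      1 / 2 * (3 * max (w z) 0 ^ 2 * quadForm a (gradX χ z) (gradX w z)) -
      parabolicOp a w z * (3 * max (w z) 0 ^ 2) * χ z with hIdef
  set e := approxError a g l DJ Gb v with he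
  have hkey : ∀ z, max (w z) 0 ^ 3 * χ z ≤ I z + S.indicator (fun z => D * e z) z := by
    intro z
    by_cases hzS : z ∈ S
    swap
    · have c1 : χ z = 0 := by
        by_contra h; exact hzS (hχS h)
      have c2 : ∀ v, fderiv ℝ χ z v = 0 := fun v => by
        by_contra h
        exact hzS (support_fderiv_apply_subset hScomp.isClosed hχS v h)
      have c3 : gradX χ z = 0 := funext fun i => c2 _
      simp [hIdef, c1, c2, c3, hzS, quadForm]
    rw [indicator_of_mem hzS]
    have he0 : 0 ≤ e z := approxError_nonneg hGb0
    by_cases hneg : w z < 0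
    · have : max (w z) 0 = 0 := max_eq_right hneg.le
      simp only [hIdef, this]
      have := mul_nonneg hD0 he0
      norm_num
      exact this
    have hvJ := hk2 z hzS
    -- Where `w ≥ 0` the point is outside `Sb`, so the space cutoff is constant and the time cutoff
    -- is not falling: only favourable derivatives of `χ` survive.
    have hgood : z.1 < s₃ ∧ ‖z.2‖ < R := by
      by_contra h
      have hzb : z ∈ Sb := ⟨hzS, by
        rw [mem_ofPred_eq]
        by_contra! h'
        exact h h'⟩
      have h1 := hρ z hzb
      have h2 := (abs_le.1 hvJ).2
      have h3 := min_le_left (ρ / 2) 1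
      have : w z = v z - ψ z := rfl
      linarith
    have hgX : gradX χ z = 0 := by
      ext i
      have hx : fderiv ℝ X z.2 = 0 := by
        have : X =ᶠ[𝓝 z.2] fun _ => 1 := by
          filter_upwards [Metric.isOpen_ball.mem_nhds
            (show z.2 ∈ Metric.ball 0 R by simpa using hgood.2)] with y hy
          exact X.one_of_mem_closedBall (Metric.ball_subset_closedBall hy)
        rw [this.fderiv_eq, fderiv_const_apply]
      rw [gradX, fderiv_prod_mul_dirX hθ hX, hx]
      simp
    have hχt : Λ * χ z ≤ fderiv ℝ χ z (dirT n) := by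
      have h1 : HasDerivAt (fun s : ℝ => Real.exp (Λ * s)) (Real.exp (Λ * z.1) * Λ) z.1 := by
        simpa using ((hasDerivAt_id z.1).const_mul Λ).exp
      have h2 := ((contDiff_timeCut s₁ s₀ s₃ s₄).differentiable (by simp) z.1).hasDerivAt
      have h3 : HasDerivAt θ _ z.1 := h1.mul h2
      rw [fderiv_prod_mul_dirT hθ hX, h3.deriv]
      have h4 := neg_deriv_riseCut_le_deriv_timeCut h12 h34 z.1
      rw [deriv_riseCut_eq_zero h34 (fun h => hgood.1.not_ge h.1), neg_zero] at h4
      have h5 : 0 ≤ Real.exp (Λ * z.1) * deriv (timeCut s₁ s₀ s₃ s₄) z.1 * X z.2 :=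
        mul_nonneg (mul_nonneg (Real.exp_pos _).le h4) X.nonneg
      simp only [χ, θ]
      linarith
    set p := max (w z) 0 with hp
    have hp0 : 0 ≤ p := le_max_right _ _
    have hpW : p ≤ max (W + 1) 0 := by
      refine max_le_max ?_ le_rfl
      have h1 := hW' z hzS
      have h2 := (abs_le.1 hvJ).2
      have h3 := min_le_right (ρ / 2) 1
      have : w z = v z - ψ z := rfl
      linarith
    have hL : parabolicOp a w z ≤ (∑ i, g z i * gradX w z i) + e z := by
      rw [hw, parabolicOp_sub a hvs hψ]
      have h1 := (abs_le.1 (abs_parabolicOp_sub_le (a := a) (l := l) (DJ := DJ) (v := v)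
        (hGbS z hzS))).2
      have h2 := hsup z (slabBall_subset_openSlab _ _ _ _ (hSG hzS))
      simp only [gradX_sub hvs hψ, mul_sub, Finset.sum_sub_distrib]
      linarith
    have hgsq : ∑ i, g z i ^ 2 ≤ Gb ^ 2 := by
      have := hGbS z hzS
      rw [← EuclideanSpace.real_norm_sq_eq]
      exact pow_le_pow_left₀ (norm_nonneg _) this 2
    have hy := mul_sum_le_of_ellipticity hc hp0 (g z) (gradX w z) hgsq
    have hq := hell (gradX w z)
    have hχz0 := hχ0 z
    have k1 := mul_le_mul_of_nonneg_left hχt (pow_nonneg hp0 3)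
    have k2 := mul_le_mul_of_nonneg_left hq (mul_nonneg (mul_nonneg zero_le_three hp0) hχz0)
    have k3 := mul_le_mul_of_nonneg_right hL (mul_nonneg (mul_nonneg zero_le_three
      (sq_nonneg p)) hχz0)
    have k4 := mul_le_mul_of_nonneg_right hy hχz0
    have k5 : 3 * p ^ 2 * χ z * e z ≤ D * e z := by
      refine mul_le_mul_of_nonneg_right ?_ he0
      rw [hD]
      have := hCχ' z
      gcongr
    have e1 : quadForm a (gradX χ z) (gradX w z) = 0 := by
      rw [hgX]; simp [quadForm]
    simp only [hIdef, e1]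
    rw [hΛ] at k1
    linarith
  have hDi : Integrable (S.indicator fun z => D * e z) :=
    (integrable_indicator_iff hScomp.measurableSet).2 (hk1i.const_mul D)
  have hlhs : Integrable fun z => max (w z) 0 ^ 3 * χ z := by
    refine Continuous.integrable_of_hasCompactSupport ?_ hχc.mul_left
    exact ((hws.continuous.max continuous_const).pow 3).mul hχ.continuous
  have hle : ∫ z, max (w z) 0 ^ 3 * χ z ≤ D * (m / (2 * (D + 1))) := by
    calc ∫ z, max (w z) 0 ^ 3 * χ z ≤ ∫ z, (I z + S.indicator (fun z => D * e z) z) :=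
          integral_mono hlhs (hI.add hDi) hkey
      _ = D * ∫ z in S, e z := by
          rw [integral_add hI hDi, hI0, zero_add, integral_indicator hScomp.measurableSet,
            integral_const_mul]
      _ ≤ _ := mul_le_mul_of_nonneg_left hk1 hD0
  have hge : m ≤ ∫ z, max (w z) 0 ^ 3 * χ z := by
    calc m = ∫ _z in Kr, (w₀ / 4) ^ 3 * (χ (s₀, x₀) / 2) := by
          rw [setIntegral_const, smul_eq_mul, hm, hV]; ring
      _ ≤ ∫ z in Kr, max (w z) 0 ^ 3 * χ z := by
          refine setIntegral_mono_on (integrableOn_const hKrc.measure_lt_top.ne)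
            hlhs.integrableOn hKrc.measurableSet fun z hz => ?_
          have h1 := hk3 z hz
          obtain ⟨h2, h3⟩ := hrw z hz
          have h4 : w₀ / 4 ≤ w z := by
            have := (abs_le.1 h1).1
            have : w z = v z - ψ z := rfl
            linarith
          have h5 : w₀ / 4 ≤ max (w z) 0 := h4.trans (le_max_left _ _)
          gcongr
      _ ≤ _ := setIntegral_le_integral hlhs (ae_of_all _ fun z =>
          mul_nonneg (pow_nonneg (le_max_right _ _) 3) (hχ0 z))
  have : D * (m / (2 * (D + 1))) ≤ m / 2 := by
    have e1 : D * (m / (2 * (D + 1))) = m / 2 * (D / (D + 1)) := by field_simp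
    rw [e1]
    exact mul_le_of_le_one_right (by positivity) ((div_le_one (by positivity)).2 (by linarith))
  linarith

end

/-! ### Barriers and the quadratic bound. -/

/-- The function `C e^{β (T - s)} (1 + |x|²)^m`. -/
noncomputable def barrier {n : ℕ} (C β T : ℝ) (m : ℕ) (z : ℝ × EuclideanSpace ℝ (Fin n)) : ℝ :=
  C * Real.exp (β * (T - z.1)) * (1 + ‖z.2‖ ^ 2) ^ m

section

variable {n : ℕ} {C β T : ℝ} {m : ℕ}

theorem contDiff_barrier : ContDiff ℝ ∞ (barrier C β T m : ℝ × EuclideanSpace ℝ (Fin n) → ℝ) := by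
  have h1 : ContDiff ℝ ∞ fun z : ℝ × EuclideanSpace ℝ (Fin n) => ‖z.2‖ ^ 2 :=
    (contDiff_norm_sq ℝ).comp contDiff_snd
  have h2 : ContDiff ℝ ∞ fun z : ℝ × EuclideanSpace ℝ (Fin n) => Real.exp (β * (T - z.1)) :=
    Real.contDiff_exp.comp (contDiff_const.mul (contDiff_const.sub contDiff_fst))
  exact (contDiff_const.mul h2).mul ((contDiff_const.add h1).pow m)

theorem fderiv_barrier (z v : ℝ × EuclideanSpace ℝ (Fin n)) :
    fderiv ℝ (barrier C β T m) z v =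
      C * Real.exp (β * (T - z.1)) * (m * (1 + ‖z.2‖ ^ 2) ^ (m - 1) * (2 * inner ℝ z.2 v.2)) -
        β * v.1 * barrier C β T m z := by
  have h1 : HasFDerivAt (fun z : ℝ × EuclideanSpace ℝ (Fin n) => 1 + ‖z.2‖ ^ 2)
      ((2 • innerSL ℝ z.2).comp (ContinuousLinearMap.snd ℝ ℝ _)) z :=
    ((hasStrictFDerivAt_norm_sq z.2).hasFDerivAt.comp z hasFDerivAt_snd).const_add 1
  have h2 : HasFDerivAt (fun z : ℝ × EuclideanSpace ℝ (Fin n) => Real.exp (β * (T - z.1))) _ z :=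
    ((hasFDerivAt_fst.const_sub T).const_mul β).exp
  have h3 : HasFDerivAt (barrier C β T m) _ z := (h2.const_mul C).mul (h1.pow m)
  rw [h3.fderiv]
  simp [barrier]
  ring

/-- The gradient is written with a barrier of lower degree as coefficient, so that the Hessian
follows by applying the same formula again. -/
theorem gradX_barrier (z : ℝ × EuclideanSpace ℝ (Fin n)) (j : Fin n) :
    gradX (barrier C β T m) z j = barrier (2 * m * C) β T (m - 1) z * z.2 j := by
  rw [gradX, fderiv_barrier, barrier]
  simp [barrier, EuclideanSpace.inner_single_right]
  ring

theorem hasFDerivAt_coord (z : ℝ × EuclideanSpace ℝ (Fin n)) (j : Fin n) :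
    HasFDerivAt (fun z : ℝ × EuclideanSpace ℝ (Fin n) => z.2 j)
      ((EuclideanSpace.proj j : EuclideanSpace ℝ (Fin n) →L[ℝ] ℝ).comp
        (ContinuousLinearMap.snd ℝ ℝ _)) z :=
  ((EuclideanSpace.proj j : EuclideanSpace ℝ (Fin n) →L[ℝ] ℝ).comp
        (ContinuousLinearMap.snd ℝ ℝ _)).hasFDerivAt

theorem hessX_barrier (z : ℝ × EuclideanSpace ℝ (Fin n)) (i j : Fin n) :
    hessX (barrier C β T m) z i j =
      barrier (2 * ↑(m - 1) * (2 * m * C)) β T (m - 1 - 1) z * (z.2 i * z.2 j) +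
        if i = j then barrier (2 * m * C) β T (m - 1) z else 0 := by
  have h : (fun y => fderiv ℝ (barrier C β T m) y (dirX j)) =
      fun y : ℝ × EuclideanSpace ℝ (Fin n) => barrier (2 * m * C) β T (m - 1) y * y.2 j :=
    funext fun y => gradX_barrier y j
  rw [hessX, h]
  have h1 : HasFDerivAt (fun y : ℝ × EuclideanSpace ℝ (Fin n) =>
      barrier (2 * m * C) β T (m - 1) y * y.2 j) _ z :=
    (contDiff_barrier.differentiable (by simp) z).hasFDerivAt.mul (hasFDerivAt_coord z j)
  rw [h1.fderiv]
  have h2 : fderiv ℝ (barrier (2 * m * C) β T (m - 1)) z (dirX i) =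
      barrier (2 * ↑(m - 1) * (2 * m * C)) β T (m - 1 - 1) z * z.2 i := gradX_barrier z i
  have h3 : (EuclideanSpace.proj j : EuclideanSpace ℝ (Fin n) →L[ℝ] ℝ)
      (EuclideanSpace.single i 1) = if j = i then 1 else 0 := by
    simp
  simp only [add_apply, smul_apply, smul_eq_mul, h2, ContinuousLinearMap.comp_apply,
    ContinuousLinearMap.coe_snd', h3]
  by_cases hij : i = j
  · simp [hij]; ring
  · simp [hij, Ne.symm hij]; ring

/-- The exponential rate which makes `barrier` a supersolution. -/
noncomputable def barrierRate (n : ℕ) (τ K : ℝ) (m : ℕ) : ℝ :=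
  m * n * τ + 2 * m ^ 2 * n * τ + 4 * m * K + 1

theorem barrier_nonneg (hC : 0 ≤ C) (z : ℝ × EuclideanSpace ℝ (Fin n)) :
    0 ≤ barrier C β T m z := by
  unfold barrier; positivity

/-- The time derivative contributes `β` times the barrier. The summands of `barrierRate` pay, in
order, for the trace term, for the remaining second-order term, for the drift, and for the extra
copy of the barrier on the left, which will dominate the source `l`. -/
theorem barrier_add_le_parabolicOp {a : Matrix (Fin n) (Fin n) ℝ} {τ K : ℝ} (hτ : 0 ≤ τ)
    (ha : ∀ i j, |a i j| ≤ τ) (hK : 0 ≤ K) (hC : 0 ≤ C) (hm : 1 ≤ m)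
    {b : EuclideanSpace ℝ (Fin n)} {z : ℝ × EuclideanSpace ℝ (Fin n)}
    (hb : ‖b‖ ≤ K * (1 + ‖z.2‖)) :
    barrier C (barrierRate n τ K m) T m z +
        ∑ i, b i * gradX (barrier C (barrierRate n τ K m) T m) z i ≤
      parabolicOp a (barrier C (barrierRate n τ K m) T m) z := by
  set β := barrierRate n τ K m with hβ
  set q := 1 + ‖z.2‖ ^ 2 with hq
  have hq1 : 1 ≤ q := by rw [hq]; nlinarith [sq_nonneg ‖z.2‖]
  have hq0 : 0 < q := by linarith
  set E := C * Real.exp (β * (T - z.1)) with hE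
  have hE0 : 0 ≤ E := by positivity
  have hdt : fderiv ℝ (barrier C β T m) z (dirT n) = -(β * (E * q ^ m)) := by
    rw [fderiv_barrier]
    simp [barrier, hE, hq]
  have hm1 : (0 : ℝ) ≤ ↑(m - 1) := Nat.cast_nonneg _
  have hm1' : ((m - 1 : ℕ) : ℝ) ≤ m := by exact_mod_cast Nat.sub_le _ _
  have hm0 : (0 : ℝ) ≤ m := Nat.cast_nonneg _
  have hqm1 : q ^ (m - 1) ≤ q ^ m := pow_le_pow_right₀ hq1 (Nat.sub_le _ _)
  have hqm1' : q ^ (m - 1) * q = q ^ m := by rw [← pow_succ, Nat.sub_add_cancel hm]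
  -- For `m = 1` truncated subtraction makes the exponent 0 and the bound is `q ≤ q`; the
  -- coefficient `m - 1` of the corresponding term vanishes then.
  have hqm2 : q ^ (m - 1 - 1) * q ≤ q ^ m := by
    rw [← pow_succ]
    exact pow_le_pow_right₀ hq1 (by omega)
  have hdiff : ∑ i, ∑ j, a i j * hessX (barrier C β T m) z i j =
      4 * m * ↑(m - 1) * E * q ^ (m - 1 - 1) * quadForm a z.2 z.2 +
        2 * m * E * q ^ (m - 1) * ∑ i, a i i := by
    simp only [hessX_barrier, mul_add, Finset.sum_add_distrib, mul_ite, mul_zero,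
      Finset.sum_ite_eq, Finset.mem_univ, if_true, quadForm, Finset.mul_sum]
    congr 1
    · refine Finset.sum_congr rfl fun i _ => Finset.sum_congr rfl fun j _ => ?_
      simp only [barrier, hE, hq]; ring
    · refine Finset.sum_congr rfl fun i _ => ?_
      simp only [barrier, hE, hq]; ring
  have hquad : quadForm a z.2 z.2 ≤ τ * n * q := by
    refine (le_abs_self _).trans ((abs_quadForm_le ha z.2 z.2 (c := 1 / 2) (by norm_num)).trans ?_)
    rw [← EuclideanSpace.real_norm_sq_eq]
    refine mul_le_mul_of_nonneg_left ?_ (by positivity)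
    rw [hq]; norm_num; linarith
  have htr : ∑ i, a i i ≤ n * τ := by
    calc ∑ i, a i i ≤ ∑ _i : Fin n, τ :=
          Finset.sum_le_sum fun i _ => (le_abs_self _).trans (ha i i)
      _ = n * τ := by simp
  have hgr : ∑ i, b i * gradX (barrier C β T m) z i = 2 * m * E * q ^ (m - 1) * inner ℝ b z.2 := by
    rw [inner_eq_sum_mul, Finset.mul_sum]
    refine Finset.sum_congr rfl fun i _ => ?_
    rw [gradX_barrier]
    simp only [barrier, hE, hq]; ring
  have hinner : inner ℝ b z.2 ≤ 2 * K * q := by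
    calc inner ℝ b z.2 ≤ ‖b‖ * ‖z.2‖ := real_inner_le_norm _ _
      _ ≤ K * (1 + ‖z.2‖) * ‖z.2‖ := mul_le_mul_of_nonneg_right hb (norm_nonneg _)
      _ = K * ((1 + ‖z.2‖) * ‖z.2‖) := by ring
      _ ≤ K * (2 * q) := by
          refine mul_le_mul_of_nonneg_left ?_ hK
          rw [hq]; nlinarith [sq_nonneg (‖z.2‖ - 1), sq_nonneg ‖z.2‖]
      _ = _ := by ring
  have hbar : barrier C β T m z = E * q ^ m := rfl
  rw [parabolicOp, diffusionOp, hdt, hdiff, hgr, hbar]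
  have k1 : 2 * m * E * q ^ (m - 1) * inner ℝ b z.2 ≤ 4 * m * K * (E * q ^ m) := by
    calc _ ≤ 2 * m * E * q ^ (m - 1) * (2 * K * q) :=
          mul_le_mul_of_nonneg_left hinner (by positivity)
      _ = 4 * m * K * (E * (q ^ (m - 1) * q)) := by ring
      _ = _ := by rw [hqm1']
  have k2 : 2 * m * E * q ^ (m - 1) * ∑ i, a i i ≤ 2 * (m * n * τ * (E * q ^ m)) := by
    calc _ ≤ 2 * m * E * q ^ (m - 1) * (n * τ) := mul_le_mul_of_nonneg_left htr (by positivity)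
      _ ≤ 2 * m * E * q ^ m * (n * τ) := by gcongr
      _ = _ := by ring
  have k3 : 4 * m * ↑(m - 1) * E * q ^ (m - 1 - 1) * quadForm a z.2 z.2 ≤
      2 * (2 * m ^ 2 * n * τ * (E * q ^ m)) := by
    calc _ ≤ 4 * m * ↑(m - 1) * E * q ^ (m - 1 - 1) * (τ * n * q) :=
          mul_le_mul_of_nonneg_left hquad (by positivity)
      _ = 4 * m * ↑(m - 1) * E * (τ * n) * (q ^ (m - 1 - 1) * q) := by ring
      _ ≤ 4 * m * m * E * (τ * n) * q ^ m := by gcongr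
      _ = _ := by ring
  have e : β * (E * q ^ m) = m * n * τ * (E * q ^ m) + 2 * m ^ 2 * n * τ * (E * q ^ m) +
      4 * m * K * (E * q ^ m) + E * q ^ m := by
    rw [hβ, barrierRate]; ring
  linarith

end

section

variable {n : ℕ} {a : Matrix (Fin n) (Fin n) ℝ} {t T : ℝ}
  {g : ℝ × EuclideanSpace ℝ (Fin n) → EuclideanSpace ℝ (Fin n)}
  {l : ℝ × EuclideanSpace ℝ (Fin n) → ℝ} {lT : EuclideanSpace ℝ (Fin n) → ℝ}
  {J Js : ℝ × EuclideanSpace ℝ (Fin n) → ℝ}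
  {DJ : ℝ × EuclideanSpace ℝ (Fin n) → EuclideanSpace ℝ (Fin n)}
  {HJ : ℝ × EuclideanSpace ℝ (Fin n) → Matrix (Fin n) (Fin n) ℝ}

theorem barrierRate_nonneg {n : ℕ} {τ K : ℝ} (hτ : 0 ≤ τ) (hK : 0 ≤ K) (m : ℕ) :
    0 ≤ barrierRate n τ K m := by
  unfold barrierRate; positivity

/-- The quadratic barrier alone need not dominate `J` at infinity. A barrier of degree `N + 1` with
small factor `η` is added, which does so outside a ball depending on `M`, `N` and `η`; then `η`
tends to 0 at a fixed point. -/
theorem IsStrongSolution.le_barrier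
    (hJ : IsStrongSolution a g l lT t T J Js DJ HJ) {c τ K : ℝ} (hc : 0 < c) (hτ : 0 ≤ τ)
    (hK : 0 ≤ K) (ha : ∀ i j, |a i j| ≤ τ)
    (hell : ∀ ξ : Fin n → ℝ, c * ∑ i, ξ i ^ 2 ≤ quadForm a ξ ξ)
    (hg : ∀ s ∈ Icc t T, ∀ x, ‖g (s, x)‖ ≤ K * (1 + ‖x‖))
    (hl : ∀ s ∈ Icc t T, ∀ x, l (s, x) ≤ K * (1 + ‖x‖ ^ 2))
    (hlT : ∀ x, lT x ≤ K * (1 + ‖x‖ ^ 2)) {M : ℝ} {N : ℕ}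
    (hgrowth : ∀ s ∈ Icc t T, ∀ x, J (s, x) ≤ M * (1 + ‖x‖) ^ N) :
    ∀ z ∈ openSlab n t T, J z ≤ barrier K (barrierRate n τ K 1) T 1 z := by
  intro z hz
  have hN : 1 ≤ N + 1 := by omega
  have hβ1 := barrierRate_nonneg (n := n) hτ hK 1
  have hβN := barrierRate_nonneg (n := n) hτ hK (N + 1)
  have key : ∀ η : ℝ, 0 < η → J z ≤ barrier K (barrierRate n τ K 1) T 1 z +
      η * barrier 1 (barrierRate n τ K (N + 1)) T (N + 1) z := by
    intro η hη
    have hlin : ∀ y : ℝ × EuclideanSpace ℝ (Fin n),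
        η * barrier 1 (barrierRate n τ K (N + 1)) T (N + 1) y =
        barrier η (barrierRate n τ K (N + 1)) T (N + 1) y := fun y => by simp [barrier]; ring
    rw [hlin]
    set u : ℝ × EuclideanSpace ℝ (Fin n) → ℝ := barrier K (barrierRate n τ K 1) T 1 with hu
    set v : ℝ × EuclideanSpace ℝ (Fin n) → ℝ := barrier η (barrierRate n τ K (N + 1)) T (N + 1)
      with hv
    have hus : ContDiff ℝ ∞ u := contDiff_barrier
    have hvs : ContDiff ℝ ∞ v := contDiff_barrier
    have huv : ContDiff ℝ ∞ fun y => u y + v y := hus.add hvs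
    have hsub : (fun y => (fun y => u y + v y) y - v y) = u := by ext y; simp
    have hP : ∀ y, parabolicOp a (fun y => u y + v y) y = parabolicOp a u y + parabolicOp a v y :=
      fun y => by
        have := parabolicOp_sub a huv hvs y
        rw [hsub] at this
        linarith
    have hD : ∀ y i, gradX (fun y => u y + v y) y i = gradX u y i + gradX v y i := fun y i => by
      have := gradX_sub huv hvs y i
      rw [hsub] at this
      linarith
    have hexp : ∀ β s : ℝ, 0 ≤ β → s ≤ T → 1 ≤ Real.exp (β * (T - s)) := fun β s hβ hs =>
      Real.one_le_exp (mul_nonneg hβ (by linarith))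
    have hu1 : ∀ y : ℝ × EuclideanSpace ℝ (Fin n), y.1 ≤ T → K * (1 + ‖y.2‖ ^ 2) ≤ u y := by
      intro y hy
      have h0 : 0 ≤ K * (1 + ‖y.2‖ ^ 2) := by positivity
      calc K * (1 + ‖y.2‖ ^ 2) ≤ K * (1 + ‖y.2‖ ^ 2) *
            Real.exp (barrierRate n τ K 1 * (T - y.1)) :=
            le_mul_of_one_le_right h0 (hexp _ _ hβ1 hy)
        _ = u y := by rw [hu, barrier]; ring
    have hv1 : ∀ y : ℝ × EuclideanSpace ℝ (Fin n), y.1 ≤ T →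
        η * (1 + ‖y.2‖ ^ 2) ^ (N + 1) ≤ v y := by
      intro y hy
      have h0 : 0 ≤ η * (1 + ‖y.2‖ ^ 2) ^ (N + 1) := by positivity
      calc η * (1 + ‖y.2‖ ^ 2) ^ (N + 1) ≤ η * (1 + ‖y.2‖ ^ 2) ^ (N + 1) *
            Real.exp (barrierRate n τ K (N + 1) * (T - y.1)) :=
            le_mul_of_one_le_right h0 (hexp _ _ hβN hy)
        _ = v y := by rw [hv, barrier]; ring
    -- Beyond this radius `|M| 2^N < η (1 + |x|²)`, while `(1 + |x|)^N ≤ 2^N (1 + |x|²)^N`; so the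
    -- auxiliary barrier exceeds the growth bound of `J`.
    refine hJ.le_of_supersolution hc hell (fun R => ⟨K * (1 + R), fun s hs x hx => ?_⟩) huv ?_ ?_
      (R := max 1 (|M| * 2 ^ N / η + 1)) (le_max_left _ _) ?_ z hz
    · exact (hg s hs x).trans (mul_le_mul_of_nonneg_left (by linarith) hK)
    · rintro ⟨s, x⟩ hy
      have hs : s ∈ Icc t T := Ioo_subset_Icc_self hy.1
      rw [hP]
      simp only [hD, mul_add, Finset.sum_add_distrib]
      have h1 := barrier_add_le_parabolicOp (T := T) hτ ha hK hK le_rfl (z := (s, x)) (hg s hs x)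
      have h2 := barrier_add_le_parabolicOp (T := T) hτ ha hK hη.le hN (z := (s, x)) (hg s hs x)
      have h3 := hu1 (s, x) hs.2
      have h4 := hl s hs x
      have h5 : 0 ≤ v (s, x) := barrier_nonneg hη.le _
      linarith
    · intro x
      have h1 := hu1 (T, x) le_rfl
      have h2 := hv1 (T, x) le_rfl
      have h3 : 0 < η * (1 + ‖x‖ ^ 2) ^ (N + 1) := by positivity
      linarith [hlT x]
    · intro s hs x hx
      have h1 : 0 ≤ u (s, x) := barrier_nonneg hK _
      have h2 := hv1 (s, x) hs.2
      have hx1 : 1 ≤ ‖x‖ := (le_max_left _ _).trans hx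
      have hx2 : |M| * 2 ^ N / η + 1 ≤ ‖x‖ := (le_max_right _ _).trans hx
      have h3 : (1 + ‖x‖) ^ N ≤ 2 ^ N * (1 + ‖x‖ ^ 2) ^ N := by
        rw [← mul_pow]
        refine pow_le_pow_left₀ (by positivity) ?_ N
        nlinarith [sq_nonneg (‖x‖ - 1)]
      have h4 : |M| * 2 ^ N < η * (1 + ‖x‖ ^ 2) := by
        have : |M| * 2 ^ N / η < 1 + ‖x‖ ^ 2 := by nlinarith
        rw [div_lt_iff₀ hη] at this
        linarith
      have h5 : 0 < (1 + ‖x‖ ^ 2) ^ N := by positivity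
      calc J (s, x) ≤ M * (1 + ‖x‖) ^ N := hgrowth s hs x
        _ ≤ |M| * (1 + ‖x‖) ^ N := mul_le_mul_of_nonneg_right (le_abs_self _) (by positivity)
        _ ≤ |M| * (2 ^ N * (1 + ‖x‖ ^ 2) ^ N) := mul_le_mul_of_nonneg_left h3 (abs_nonneg _)
        _ = |M| * 2 ^ N * (1 + ‖x‖ ^ 2) ^ N := by ring
        _ < η * (1 + ‖x‖ ^ 2) * (1 + ‖x‖ ^ 2) ^ N := mul_lt_mul_of_pos_right h4 h5
        _ = η * (1 + ‖x‖ ^ 2) ^ (N + 1) := by ring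
        _ ≤ u (s, x) + v (s, x) := by linarith
  set b := barrier 1 (barrierRate n τ K (N + 1)) T (N + 1) z with hb
  have hb0 : 0 ≤ b := barrier_nonneg zero_le_one _
  refine le_of_forall_pos_le_add fun η hη => (key (η / (b + 1)) (by positivity)).trans ?_
  have : η / (b + 1) * b ≤ η := by
    rw [div_mul_eq_mul_div, div_le_iff₀ (by positivity)]
    nlinarith
  linarith

/-- The quadratic bound for solutions of polynomial growth. -/
theorem IsStrongSolution.abs_le_quadratic
    (hJ : IsStrongSolution a g l lT t T J Js DJ HJ) {c τ K : ℝ} (hc : 0 < c) (hτ : 0 ≤ τ)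
    (hK : 0 ≤ K) (ha : ∀ i j, |a i j| ≤ τ)
    (hell : ∀ ξ : Fin n → ℝ, c * ∑ i, ξ i ^ 2 ≤ quadForm a ξ ξ) (ht : 0 ≤ t) (htT : t ≤ T)
    (hg : ∀ s ∈ Icc t T, ∀ x, ‖g (s, x)‖ ≤ K * (1 + ‖x‖))
    (hl : ∀ s ∈ Icc t T, ∀ x, |l (s, x)| ≤ K * (1 + ‖x‖ ^ 2))
    (hlT : ∀ x, |lT x| ≤ K * (1 + ‖x‖ ^ 2)) {M : ℝ} {N : ℕ}
    (hgrowth : ∀ s ∈ Icc t T, ∀ x, |J (s, x)| ≤ M * (1 + ‖x‖) ^ N) :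
    ∀ s ∈ Icc t T, ∀ x,
      |J (s, x)| ≤ K * Real.exp (barrierRate n τ K 1 * T) * (1 + ‖x‖ ^ 2) := by
  have hβ := barrierRate_nonneg (n := n) hτ hK 1
  rcases htT.eq_or_lt with rfl | htT
  · intro s hs x
    obtain rfl : s = t := le_antisymm hs.2 hs.1
    rw [hJ.terminal]
    refine (hlT x).trans (mul_le_mul_of_nonneg_right ?_ (by positivity))
    exact le_mul_of_one_le_right hK (Real.one_le_exp (mul_nonneg hβ ht))
  · have hup := hJ.le_barrier hc hτ hK ha hell hg (fun s hs x => (abs_le.1 (hl s hs x)).2)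
      (fun x => (abs_le.1 (hlT x)).2) (fun s hs x => (abs_le.1 (hgrowth s hs x)).2)
    have hlo := hJ.neg.le_barrier (M := M) (N := N) hc hτ hK ha hell hg
      (fun s hs x => by linarith [(abs_le.1 (hl s hs x)).1])
      (fun x => by linarith [(abs_le.1 (hlT x)).1])
      (fun s hs x => by linarith [(abs_le.1 (hgrowth s hs x)).1])
    intro s hs x
    have hIoo : ∀ s ∈ Ioo t T, |J (s, x)| ≤
        K * Real.exp (barrierRate n τ K 1 * T) * (1 + ‖x‖ ^ 2) := by
      intro s hs
      have hb : barrier K (barrierRate n τ K 1) T 1 (s, x) ≤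
          K * Real.exp (barrierRate n τ K 1 * T) * (1 + ‖x‖ ^ 2) := by
        simp only [barrier, pow_one]
        -- Here `t ≥ 0` removes the initial time from the constant.
        have : barrierRate n τ K 1 * (T - s) ≤ barrierRate n τ K 1 * T :=
          mul_le_mul_of_nonneg_left (by linarith [hs.1]) hβ
        gcongr
      rw [abs_le]
      constructor
      · linarith [hlo (s, x) ⟨hs, mem_univ _⟩]
      · linarith [hup (s, x) ⟨hs, mem_univ _⟩]
    have hcl : closure (Ioo t T) = Icc t T := closure_Ioo htT.ne
    refine le_on_closure (f := fun s => |J (s, x)|) hIoo ?_ continuousOn_const (hcl ▸ hs)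
    rw [hcl]
    exact (hJ.continuousOn.comp (by fun_prop) fun r hr => ⟨hr, mem_univ _⟩).abs

end

/-! ### The weighted gradient bound. -/

/-- Monotone exhaustion of the slab by compact cylinders. It reduces the global estimates to bounds
on compact cylinders that are uniform in the cylinder. -/
theorem lintegral_openSlab_le {n : ℕ} {t T : ℝ} (htT : t < T)
    {f : ℝ × EuclideanSpace ℝ (Fin n) → ENNReal} {C : ENNReal}
    (h : ∀ a b R : ℝ, t < a → a < b → b < T → 1 ≤ R →
      ∫⁻ z in Icc a b ×ˢ Metric.closedBall 0 R, f z ≤ C) :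
    ∫⁻ z in openSlab n t T, f z ≤ C := by
  set d := T - t with hd
  have hd0 : 0 < d := by rw [hd]; linarith
  -- The shift by 3 keeps the time interval nondegenerate already for `k = 0`.
  let A : ℕ → Set (ℝ × EuclideanSpace ℝ (Fin n)) := fun k =>
    Icc (t + d / (k + 3)) (T - d / (k + 3)) ×ˢ Metric.closedBall 0 ((k : ℝ) + 1)
  have hA : Monotone A := by
    intro j k hjk
    have hjk' : (j : ℝ) ≤ k := by exact_mod_cast hjk
    have h1 : d / (k + 3) ≤ d / ((j : ℝ) + 3) := by gcongr
    exact prod_mono (Icc_subset_Icc (by linarith) (by linarith))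
      (Metric.closedBall_subset_closedBall (by linarith))
  have hU : openSlab n t T ⊆ ⋃ k, A k := by
    rintro ⟨s, x⟩ ⟨⟨h1, h2⟩, -⟩
    have hm : 0 < min (s - t) (T - s) := lt_min (by linarith) (by linarith)
    obtain ⟨k, hk⟩ := exists_nat_gt (max (d / min (s - t) (T - s)) ‖x‖)
    have hk1 : d / min (s - t) (T - s) < k := (le_max_left _ _).trans_lt hk
    have hk2 : ‖x‖ < k := (le_max_right _ _).trans_lt hk
    have h3 : d / (k + 3) ≤ min (s - t) (T - s) := by
      rw [div_lt_iff₀ hm] at hk1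
      rw [div_le_iff₀ (by positivity)]
      nlinarith
    have h4 := h3.trans (min_le_left _ _)
    have h5 := h3.trans (min_le_right _ _)
    refine mem_iUnion.2 ⟨k, ⟨by simp only; linarith, by simp only; linarith⟩, ?_⟩
    rw [Metric.mem_closedBall, dist_zero_right]
    simp only
    linarith
  refine (lintegral_mono_set hU).trans ?_
  rw [setLIntegral_iUnion_of_directed _ hA.directed_le]
  refine iSup_le fun k => h _ _ _ ?_ ?_ ?_ ?_
  · have : 0 < d / ((k : ℝ) + 3) := by positivity
    linarith
  · have : d / ((k : ℝ) + 3) ≤ d / 3 := by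
      gcongr
      have : (0 : ℝ) ≤ k := Nat.cast_nonneg k
      linarith
    linarith
  · have : 0 < d / ((k : ℝ) + 3) := by positivity
    linarith
  · have : (0 : ℝ) ≤ k := Nat.cast_nonneg k
    linarith

theorem integrable_timeCut {a b c d : ℝ} (hab : a < b) (hcd : c < d) :
    Integrable (timeCut a b c d) :=
  (contDiff_timeCut a b c d).continuous.integrable_of_hasCompactSupport
    (hasCompactSupport_timeCut hab hcd)

theorem integral_timeCut_le {a b c d : ℝ} (hab : a < b) (hcd : c < d) (had : a ≤ d) :
    ∫ s, timeCut a b c d s ≤ d - a := by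
  rw [← setIntegral_eq_integral_of_forall_compl_eq_zero (s := Icc a d) fun s hs => by
    by_contra h; exact hs (timeCut_support hab hcd h)]
  calc ∫ s in Icc a d, timeCut a b c d s ≤ ∫ _s in Icc a d, (1 : ℝ) :=
        setIntegral_mono (integrable_timeCut hab hcd).integrableOn
          (integrableOn_const isCompact_Icc.measure_lt_top.ne) fun s => timeCut_le_one _ _ _ _ _
    _ = d - a := by simp [Real.volume_real_Icc_of_le had]

/-- The dominating weight `(1 + |x|²)³ (1 + |x|²)^(-γ)`. -/
noncomputable def domWeight {n : ℕ} (γ : ℝ) (x : EuclideanSpace ℝ (Fin n)) : ℝ :=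
  (1 + ‖x‖ ^ 2) ^ 3 * polyWeight γ x

theorem domWeight_nonneg {n : ℕ} (γ : ℝ) (x : EuclideanSpace ℝ (Fin n)) : 0 ≤ domWeight γ x :=
  mul_nonneg (by positivity) (polyWeight_pos γ x).le

theorem one_le_one_add_norm_sq {n : ℕ} (x : EuclideanSpace ℝ (Fin n)) : 1 ≤ 1 + ‖x‖ ^ 2 := by
  nlinarith [sq_nonneg ‖x‖]

theorem sq_mul_polyWeight_le_domWeight {n : ℕ} (γ : ℝ) (x : EuclideanSpace ℝ (Fin n)) :
    (1 + ‖x‖ ^ 2) ^ 2 * polyWeight γ x ≤ domWeight γ x :=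
  mul_le_mul_of_nonneg_right (pow_le_pow_right₀ (one_le_one_add_norm_sq x) (by norm_num))
    (polyWeight_pos γ x).le

/-- From `b² ≤ 2c² + 2(c - b)²` with a weight at most 1. It transfers weighted bounds between a
function and its mollification in both directions, without passing to a limit. -/
theorem sum_sq_integral_le {α : Type*} [MeasurableSpace α] {μ : Measure α} {n : ℕ} {wt : α → ℝ}
    (hwt : ∀ x, 0 ≤ wt x ∧ wt x ≤ 1) (hwm : AEStronglyMeasurable wt μ) {p v : Fin n → α → ℝ}
    (hv : ∀ i, MemLp (v i) 2 μ) (hd : ∀ i, MemLp (fun x => p i x - v i x) 2 μ) {η : ℝ}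
    (hη : ∀ i, ∫ x, (p i x - v i x) ^ 2 ∂μ ≤ η) :
    Integrable (fun x => (∑ i, v i x ^ 2) * wt x) μ ∧
    Integrable (fun x => (∑ i, p i x ^ 2) * wt x) μ ∧
    ∫ x, (∑ i, v i x ^ 2) * wt x ∂μ ≤ 2 * ∫ x, (∑ i, p i x ^ 2) * wt x ∂μ + 2 * (n * η) ∧
    ∫ x, (∑ i, p i x ^ 2) * wt x ∂μ ≤ 2 * ∫ x, (∑ i, v i x ^ 2) * wt x ∂μ + 2 * (n * η) := by
  have hp : ∀ i, MemLp (p i) 2 μ := fun i => by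
    have := (hd i).add (hv i)
    refine this.ae_eq (ae_of_all _ fun x => ?_)
    simp
  have hint : ∀ {f : α → ℝ}, Integrable f μ → Integrable (fun x => f x * wt x) μ := fun hf =>
    hf.mul_bdd (c := 1) hwm (ae_of_all _ fun x => by
      rw [Real.norm_eq_abs, abs_of_nonneg (hwt x).1]; exact (hwt x).2)
  have i1 : Integrable (fun x => (∑ i, v i x ^ 2) * wt x) μ :=
    hint (integrable_finsetSum _ fun i _ => (hv i).integrable_sq)
  have i2 : Integrable (fun x => (∑ i, p i x ^ 2) * wt x) μ :=
    hint (integrable_finsetSum _ fun i _ => (hp i).integrable_sq)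
  have i3 : Integrable (fun x => ∑ i, (p i x - v i x) ^ 2) μ :=
    integrable_finsetSum _ fun i _ => (hd i).integrable_sq
  have h3 : ∫ x, ∑ i, (p i x - v i x) ^ 2 ∂μ ≤ n * η := by
    rw [integral_finsetSum _ fun i _ => (hd i).integrable_sq]
    refine (Finset.sum_le_sum fun i _ => hη i).trans ?_
    simp
  have key : ∀ (b c : Fin n → ℝ) (r : ℝ), 0 ≤ r → r ≤ 1 → (∑ i, b i ^ 2) * r ≤
      2 * ((∑ i, c i ^ 2) * r) + 2 * ∑ i, (c i - b i) ^ 2 := by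
    intro b c r h0 h1
    have e1 : ∑ i, b i ^ 2 ≤ 2 * ∑ i, c i ^ 2 + 2 * ∑ i, (c i - b i) ^ 2 := by
      rw [Finset.mul_sum, Finset.mul_sum, ← Finset.sum_add_distrib]
      exact Finset.sum_le_sum fun i _ => by nlinarith [sq_nonneg (2 * c i - b i)]
    have e2 : 0 ≤ ∑ i, (c i - b i) ^ 2 := Finset.sum_nonneg fun _ _ => sq_nonneg _
    have e3 := mul_le_mul_of_nonneg_right e1 h0
    have e4 := mul_le_mul_of_nonneg_left h1 e2
    linarith
  refine ⟨i1, i2, ?_, ?_⟩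
  · calc ∫ x, (∑ i, v i x ^ 2) * wt x ∂μ ≤ ∫ x, (2 * ((∑ i, p i x ^ 2) * wt x) +
          2 * ∑ i, (p i x - v i x) ^ 2) ∂μ :=
          integral_mono i1 ((i2.const_mul 2).add (i3.const_mul 2)) fun x =>
            key (fun i => v i x) (fun i => p i x) (wt x) (hwt x).1 (hwt x).2
      _ = 2 * ∫ x, (∑ i, p i x ^ 2) * wt x ∂μ + 2 * ∫ x, ∑ i, (p i x - v i x) ^ 2 ∂μ := by
          rw [integral_add (i2.const_mul 2) (i3.const_mul 2), integral_const_mul,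
            integral_const_mul]
      _ ≤ _ := by linarith
  · calc ∫ x, (∑ i, p i x ^ 2) * wt x ∂μ ≤ ∫ x, (2 * ((∑ i, v i x ^ 2) * wt x) +
          2 * ∑ i, (p i x - v i x) ^ 2) ∂μ :=
          integral_mono i2 ((i1.const_mul 2).add (i3.const_mul 2)) fun x => by
            have := key (fun i => p i x) (fun i => v i x) (wt x) (hwt x).1 (hwt x).2
            refine this.trans (le_of_eq ?_)
            congr 2
            exact Finset.sum_congr rfl fun i _ => by ring
      _ = 2 * ∫ x, (∑ i, v i x ^ 2) * wt x ∂μ + 2 * ∫ x, ∑ i, (p i x - v i x) ^ 2 ∂μ := by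
          rw [integral_add (i1.const_mul 2) (i3.const_mul 2), integral_const_mul,
            integral_const_mul]
      _ ≤ _ := by linarith

section

variable {n : ℕ}

/-- The derivative of the cutoff has integral one for every `c < d`, so the layer where the cutoff
falls costs a fixed amount, however thin it is and however close to the terminal time. -/
theorem integral_rise_term_le {u : ℝ × EuclideanSpace ℝ (Fin n) → ℝ} (hu : Continuous u)
    {Y W : EuclideanSpace ℝ (Fin n) → ℝ} (hY : Continuous Y) (hYc : HasCompactSupport Y)
    (hW : Integrable W) (hW0 : ∀ x, 0 ≤ W x) {c d B : ℝ} (hcd : c < d) (hB : 0 ≤ B)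
    (h : ∀ z : ℝ × EuclideanSpace ℝ (Fin n), z.1 ∈ Icc c d → Y z.2 ≠ 0 →
      u z ^ 2 * Y z.2 ^ 2 ≤ B * W z.2) :
    ∫ z : ℝ × EuclideanSpace ℝ (Fin n), 1 / 2 * u z ^ 2 *
      (deriv (riseCut c d) z.1 * Y z.2 ^ 2) ≤ 1 / 2 * B * ∫ x, W x := by
  have hdr : Continuous (deriv (riseCut c d)) := (contDiff_riseCut c d).continuous_deriv (by simp)
  have hY2c : HasCompactSupport fun x => Y x ^ 2 :=
    hYc.comp_left (g := fun r : ℝ => r ^ 2) (by simp)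
  have i1 : Integrable fun z : ℝ × EuclideanSpace ℝ (Fin n) => 1 / 2 * u z ^ 2 *
        (deriv (riseCut c d) z.1 * Y z.2 ^ 2) := by
    refine Continuous.integrable_of_hasCompactSupport ?_ (hasCompactSupport_prod_mul
      (hasCompactSupport_deriv_riseCut hcd) hY2c).mul_left
    exact (continuous_const.mul (hu.pow 2)).mul
      ((hdr.comp continuous_fst).mul ((hY.pow 2).comp continuous_snd))
  have i2 : Integrable fun z : ℝ × EuclideanSpace ℝ (Fin n) =>
      1 / 2 * B * (deriv (riseCut c d) z.1 * W z.2) :=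
    ((integrable_deriv_riseCut hcd).mul_prod hW).const_mul _
  calc _ ≤ ∫ z : ℝ × EuclideanSpace ℝ (Fin n), 1 / 2 * B * (deriv (riseCut c d) z.1 * W z.2) := by
        refine integral_mono i1 i2 fun z => ?_
        have hd := deriv_riseCut_nonneg hcd z.1
        simp only
        by_cases hz : z.1 ∈ Icc c d
        · by_cases hy : Y z.2 = 0
          · rw [hy]
            have := mul_nonneg hB (mul_nonneg hd (hW0 z.2))
            norm_num
            linarith
          · have := mul_le_mul_of_nonneg_left (h z hz hy) hd
            linarith
        · rw [deriv_riseCut_eq_zero hcd hz]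
          simp
    _ = _ := by
        rw [integral_const_mul, Measure.volume_eq_prod, integral_prod_mul,
          integral_deriv_riseCut hcd, one_mul]

theorem integral_timeCut_mul_le {a b c d : ℝ} (hab : a < b) (hcd : c < d) (had : a ≤ d)
    {W : EuclideanSpace ℝ (Fin n) → ℝ} (hW0 : ∀ x, 0 ≤ W x) :
    ∫ z : ℝ × EuclideanSpace ℝ (Fin n), timeCut a b c d z.1 * W z.2 ≤ (d - a) * ∫ x, W x := by
  rw [Measure.volume_eq_prod, integral_prod_mul]
  exact mul_le_mul_of_nonneg_right (integral_timeCut_le hab hcd had)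
    (integral_nonneg hW0)

theorem one_add_norm_sq_le (x : EuclideanSpace ℝ (Fin n)) :
    (1 + ‖x‖) ^ 2 ≤ 2 * (1 + ‖x‖ ^ 2) := by
  nlinarith [sq_nonneg (‖x‖ - 1)]

theorem eq_zero_of_gradSq {Y : EuclideanSpace ℝ (Fin n) → ℝ} {r : ℝ}
    (hY : ∀ x, Y x ≠ 0 → ‖x‖ ≤ r) {x : EuclideanSpace ℝ (Fin n)} (hx : r < ‖x‖) :
    gradSq Y x = 0 := by
  have h : fderiv ℝ Y x = 0 := by
    by_contra hne
    have : x ∈ tsupport Y := support_fderiv_subset ℝ hne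
    have h2 : tsupport Y ⊆ Metric.closedBall 0 r :=
      closure_minimal (fun y hy => by simpa using hY y hy) Metric.isClosed_closedBall
    have h3 := h2 this
    rw [Metric.mem_closedBall, dist_zero_right] at h3
    linarith
  simp [gradSq, h]

/-- Here `L` stands for the operator applied to the mollified solution, split into source, drift and
error. Young's inequality for the drift spends `c / 8` of the gradient; the remainder `|g|² u²`,
with `q = 1 + |x|²`, has order `q³`, which fixes the power in `domWeight`. -/
theorem drift_term_le {c K B q u e l : ℝ} (hc : 0 < c) (hB : 0 ≤ B) (hK : 0 ≤ K)
    (hq1 : 1 ≤ q) (hu : |u| ≤ B * q) (hl : |l| ≤ K * q) (g ξ : Fin n → ℝ)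
    (hg : ∑ i, g i ^ 2 ≤ 2 * K ^ 2 * q) {L : ℝ} (hL : |L - l - ∑ i, g i * ξ i| ≤ e) :
    L * u ≤ c / 8 * (∑ i, ξ i ^ 2) + (K * B + 4 * K ^ 2 * B ^ 2 / c) * q ^ 3 + e * (B * q) := by
  have he : 0 ≤ e := (abs_nonneg _).trans hL
  have hu2 : u ^ 2 ≤ (B * q) ^ 2 := sq_le_sq' (by linarith [(abs_le.1 hu).1]) (abs_le.1 hu).2
  have h1 : l * u ≤ K * B * q ^ 3 := by
    calc l * u ≤ |l| * |u| := by rw [← abs_mul]; exact le_abs_self _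
      _ ≤ K * q * (B * q) := mul_le_mul hl hu (abs_nonneg _) (by positivity)
      _ = K * B * q ^ 2 := by ring
      _ ≤ K * B * q ^ 3 :=
          mul_le_mul_of_nonneg_left (pow_le_pow_right₀ hq1 (by norm_num)) (by positivity)
  have h2 : (∑ i, g i * ξ i) * u ≤ c / 8 * (∑ i, ξ i ^ 2) + 2 / c * ((∑ i, g i ^ 2) * u ^ 2) := by
    rw [Finset.sum_mul, Finset.sum_mul, Finset.mul_sum, Finset.mul_sum, ← Finset.sum_add_distrib]
    refine Finset.sum_le_sum fun i _ => ?_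
    have : c / 8 * ξ i ^ 2 + 2 / c * (g i ^ 2 * u ^ 2) - g i * ξ i * u =
        (c * ξ i - 4 * g i * u) ^ 2 / (8 * c) := by field_simp; ring
    have h0 : 0 ≤ (c * ξ i - 4 * g i * u) ^ 2 / (8 * c) := by positivity
    linarith
  have h3 : 2 / c * ((∑ i, g i ^ 2) * u ^ 2) ≤ 4 * K ^ 2 * B ^ 2 / c * q ^ 3 := by
    calc 2 / c * ((∑ i, g i ^ 2) * u ^ 2) ≤ 2 / c * (2 * K ^ 2 * q * (B * q) ^ 2) := by gcongr
      _ = _ := by ring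
  have h4 : (L - l - ∑ i, g i * ξ i) * u ≤ e * (B * q) := by
    calc _ ≤ |L - l - ∑ i, g i * ξ i| * |u| := by rw [← abs_mul]; exact le_abs_self _
      _ ≤ _ := mul_le_mul hL hu (abs_nonneg _) he
  have : L * u = l * u + (∑ i, g i * ξ i) * u + (L - l - ∑ i, g i * ξ i) * u := by ring
  linarith

theorem sum_sq_le_of_linear_growth {b : EuclideanSpace ℝ (Fin n)} {K : ℝ}
    {x : EuclideanSpace ℝ (Fin n)} (hb : ‖b‖ ≤ K * (1 + ‖x‖)) :
    ∑ i, b i ^ 2 ≤ 2 * K ^ 2 * (1 + ‖x‖ ^ 2) := by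
  rw [← EuclideanSpace.real_norm_sq_eq]
  calc ‖b‖ ^ 2 ≤ (K * (1 + ‖x‖)) ^ 2 := pow_le_pow_left₀ (norm_nonneg _) hb 2
    _ = K ^ 2 * (1 + ‖x‖) ^ 2 := by ring
    _ ≤ K ^ 2 * (2 * (1 + ‖x‖ ^ 2)) := mul_le_mul_of_nonneg_left (one_add_norm_sq_le x)
        (sq_nonneg _)
    _ = _ := by ring

set_option maxHeartbeats 1000000 in
/-- The weighted `L²` bound for the space gradient on compact cylinders. -/
theorem exists_gradient_bound (T K τ c C₀ γ : ℝ) (hγ : (n : ℝ) / 2 + 3 < γ) (hc : 0 < c)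
    (hτ : 0 ≤ τ) (hK : 0 ≤ K) (hC₀ : 0 ≤ C₀) :
    ∃ C₁ : ℝ, 0 ≤ C₁ ∧ ∀ (a : Matrix (Fin n) (Fin n) ℝ) (t : ℝ)
      (g : ℝ × EuclideanSpace ℝ (Fin n) → EuclideanSpace ℝ (Fin n))
      (l : ℝ × EuclideanSpace ℝ (Fin n) → ℝ) (lT : EuclideanSpace ℝ (Fin n) → ℝ)
      (J Js : ℝ × EuclideanSpace ℝ (Fin n) → ℝ)
      (DJ : ℝ × EuclideanSpace ℝ (Fin n) → EuclideanSpace ℝ (Fin n))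
      (HJ : ℝ × EuclideanSpace ℝ (Fin n) → Matrix (Fin n) (Fin n) ℝ),
      (∀ i j, |a i j| ≤ τ) → (∀ ξ : Fin n → ℝ, c * ∑ i, ξ i ^ 2 ≤ quadForm a ξ ξ) →
      0 ≤ t → (∀ s ∈ Icc t T, ∀ x, ‖g (s, x)‖ ≤ K * (1 + ‖x‖)) →
      (∀ s ∈ Icc t T, ∀ x, |l (s, x)| ≤ K * (1 + ‖x‖ ^ 2)) →
      IsStrongSolution a g l lT t T J Js DJ HJ →
      (∀ s ∈ Icc t T, ∀ x, |J (s, x)| ≤ C₀ * (1 + ‖x‖ ^ 2)) →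
      ∀ s₂ s₃ R : ℝ, t < s₂ → s₂ < s₃ → s₃ < T → 1 ≤ R →
        IntegrableOn (fun z => (∑ i, DJ z i ^ 2) * polyWeight γ z.2)
          (Icc s₂ s₃ ×ˢ Metric.closedBall 0 R) ∧
        ∫ z in Icc s₂ s₃ ×ˢ Metric.closedBall 0 R, (∑ i, DJ z i ^ 2) * polyWeight γ z.2 ≤ C₁ := by
  obtain ⟨Cc, hCc0, hcut⟩ := exists_spaceCutoff n γ
  set I := ∫ x : EuclideanSpace ℝ (Fin n), domWeight γ x with hI
  have hWi : Integrable (domWeight γ : EuclideanSpace ℝ (Fin n) → ℝ) :=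
    integrable_pow_three_mul_polyWeight hγ
  have hI0 : 0 ≤ I := integral_nonneg (domWeight_nonneg γ)
  set B := C₀ + 1 with hB
  have hB0 : 0 ≤ B := by positivity
  have hcac0 : 0 ≤ cacConst n τ c := by unfold cacConst; positivity
  set C₃ := K * B + 4 * K ^ 2 * B ^ 2 / c with hC₃
  have hC₃0 : 0 ≤ C₃ := by positivity
  -- The three summands bound the falling part of the time cutoff, the gradient of the space cutoff,
  -- and the source with the drift. The use of `B = C₀ + 1` allows for an error 1 in the
  -- mollification.
  set Ctot := 1 / 2 * B ^ 2 * I + cacConst n τ c * B ^ 2 * Cc * (|T| * I) + C₃ * (|T| * I)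
    with hCtot
  have hCtot0 : 0 ≤ Ctot := by positivity
  have hγ0 : 0 ≤ γ := by
    have : (0 : ℝ) ≤ n / 2 := by positivity
    linarith
  refine ⟨2 * (4 / c * (Ctot + 1)) + 2, by positivity, ?_⟩
  intro a t g l lT J Js DJ HJ ha hell ht hg hl hJ hbd s₂ s₃ R hts h23 h3T hR
  obtain ⟨Y, hY, hYsupp, hYle, hYeq, hYgrad⟩ := hcut R hR
  have hYc : HasCompactSupport Y := HasCompactSupport.of_support_subset_isCompact
    (isCompact_closedBall 0 (2 * R)) fun x hx => by simpa using hYsupp x hx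
  set s₁ := (t + s₂) / 2 with hs₁
  set s₄ := (s₃ + T) / 2 with hs₄
  have h12 : s₁ < s₂ := by rw [hs₁]; linarith
  have ht1 : t < s₁ := by rw [hs₁]; linarith
  have h34 : s₃ < s₄ := by rw [hs₄]; linarith
  have h4T : s₄ < T := by rw [hs₄]; linarith
  -- As `t ≥ 0`, the length of the time interval is bounded by `T` alone.
  have h41 : s₄ - s₁ ≤ |T| := (by linarith : s₄ - s₁ ≤ T).trans (le_abs_self T)
  set S : Set (ℝ × EuclideanSpace ℝ (Fin n)) := Icc s₁ s₄ ×ˢ Metric.closedBall 0 (2 * R) with hS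
  have hSc : IsCompact S := isCompact_Icc.prod (isCompact_closedBall _ _)
  have hSG : S ⊆ slabBall n t T (2 * R + 1) := prod_mono
    (fun s hs => ⟨ht1.trans_le hs.1, hs.2.trans_lt h4T⟩)
    (Metric.closedBall_subset_ball (by linarith))
  have hSI : ∀ z ∈ S, z.1 ∈ Icc t T := fun z hz =>
    ⟨ht1.le.trans hz.1.1, hz.1.2.trans h4T.le⟩
  set S' : Set (ℝ × EuclideanSpace ℝ (Fin n)) := Icc s₂ s₃ ×ˢ Metric.closedBall 0 R with hS'
  have hS'c : IsCompact S' := isCompact_Icc.prod (isCompact_closedBall _ _)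
  have hS'S : S' ⊆ S := prod_mono (Icc_subset_Icc h12.le h34.le)
    (Metric.closedBall_subset_closedBall (by linarith))
  set Gb := K * (1 + 2 * R) with hGb
  have hGb0 : 0 ≤ Gb := by positivity
  have hgS : ∀ z ∈ S, ‖g z‖ ≤ Gb := fun z hz => by
    refine (hg z.1 (hSI z hz) z.2).trans (mul_le_mul_of_nonneg_left ?_ hK)
    have : ‖z.2‖ ≤ 2 * R := by simpa using hz.2
    linarith
  set Q := B * (1 + (2 * R) ^ 2) with hQ
  have hQ0 : 0 ≤ Q := by positivity
  obtain ⟨κ, δ, ε, hκ⟩ := exists_isMollifierSeq n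
  have hop := isOpen_slabBall n t T (2 * R + 1)
  have hΩ := slabBall_subset_openSlab n t T (2 * R + 1)
  have hloc := (hJ.integrable_indicator (2 * R + 1)).locallyIntegrable
  have hgradL2 := eventually_all.2 fun i => hκ.eventually_local_L2 (hJ.weakDeriv_space i).2.1
    hS'c hop (hS'S.trans hSG) hΩ (η := 1 / (n + 1)) (by positivity)
  -- `Q` bounds the mollified solution on `S`, so the total contribution of the approximation error
  -- is at most 1. The tolerance `1 / (n + 1)` for each component of the gradient makes the sum over
  -- components at most 1.
  obtain ⟨k, ⟨hk1i, hk1⟩, hk2, hk3, hk4⟩ := ((hJ.eventually_approxError hκ hSc hSG hGb0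
    (η := 1 / (Q + 1)) (by positivity)).and
    ((hκ.eventually_abs_sub_le hSc hop hSG (hJ.continuousOn_slabBall _) hloc one_pos).and
    (hgradL2.and (hκ.eventually_box_subset hSc hop hSG)))).exists
  set u := mollify (κ k) ((slabBall n t T (2 * R + 1)).indicator J) with hu
  have hus : ContDiff ℝ ∞ u :=
    contDiff_mollify (hκ.isMollifier k).contDiff (hκ.isMollifier k).hasCompactSupport hloc
  have hgradu : ∀ z ∈ S', ∀ i, gradX u z i =
      mollify (κ k) ((slabBall n t T (2 * R + 1)).indicator fun y => DJ y i) z := fun z hz i => by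
    have hb := hk4 z (hS'S hz)
    exact fderiv_mollify_eq_of_hasWeakDeriv (hJ.weakDeriv_space i) (hκ.isMollifier k) hloc hb
      (hb.trans hΩ)
  have huB : ∀ z ∈ S, |u z| ≤ B * (1 + ‖z.2‖ ^ 2) := by
    intro z hz
    have h1 := hk2 z hz
    have h2 := hbd z.1 (hSI z hz) z.2
    have h3 : |u z| ≤ |J z| + |u z - J z| := by
      have := abs_add_le (J z) (u z - J z)
      rwa [add_sub_cancel] at this
    have h4 := one_le_one_add_norm_sq z.2
    rw [hB, add_mul, one_mul]
    exact h3.trans (add_le_add h2 (h1.trans h4))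
  have huB2 : ∀ z ∈ S, u z ^ 2 ≤ B ^ 2 * (1 + ‖z.2‖ ^ 2) ^ 2 := fun z hz => by
    rw [← mul_pow, ← sq_abs]
    exact pow_le_pow_left₀ (abs_nonneg _) (huB z hz) 2
  set e := approxError a g l DJ Gb u with he
  have hcacc := caccioppoli hc ha hτ hell hus hY hYc h12 h34
  set θ := timeCut s₁ s₂ s₃ s₄ with hθ
  have hθ0 : ∀ s, 0 ≤ θ s := timeCut_nonneg _ _ _ _
  have hθi : Integrable θ := integrable_timeCut h12 h34
  have hY2c : HasCompactSupport fun x => Y x ^ 2 :=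
    hYc.comp_left (g := fun r : ℝ => r ^ 2) (by simp)
  have hχ : ContDiff ℝ ∞ fun z : ℝ × EuclideanSpace ℝ (Fin n) => θ z.1 * Y z.2 ^ 2 :=
    contDiff_prod_mul (contDiff_timeCut _ _ _ _) (hY.pow 2)
  have hχc : HasCompactSupport fun z : ℝ × EuclideanSpace ℝ (Fin n) => θ z.1 * Y z.2 ^ 2 :=
    hasCompactSupport_prod_mul (hasCompactSupport_timeCut h12 h34) hY2c
  have hgu : Continuous fun z => ∑ i, gradX u z i ^ 2 :=
    continuous_finsetSum _ fun i _ => (contDiff_fderiv_apply hus _).continuous.pow 2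
  have hmemS : ∀ z : ℝ × EuclideanSpace ℝ (Fin n), θ z.1 ≠ 0 → ‖z.2‖ ≤ 2 * R → z ∈ S :=
    fun z h1 h2 => ⟨timeCut_support h12 h34 h1, by simpa using h2⟩
  have hθW : Integrable fun z : ℝ × EuclideanSpace ℝ (Fin n) => θ z.1 * domWeight γ z.2 :=
    hθi.mul_prod hWi
  have hθWle : ∫ z : ℝ × EuclideanSpace ℝ (Fin n), θ z.1 * domWeight γ z.2 ≤ |T| * I :=
    (integral_timeCut_mul_le h12 h34 (by linarith) (domWeight_nonneg γ)).trans
      (mul_le_mul_of_nonneg_right h41 hI0)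
  -- the three terms on the right of the Caccioppoli inequality
  have hT1 : ∫ z : ℝ × EuclideanSpace ℝ (Fin n), 1 / 2 * u z ^ 2 *
        (deriv (riseCut s₃ s₄) z.1 * Y z.2 ^ 2) ≤ 1 / 2 * B ^ 2 * I := by
    refine integral_rise_term_le hus.continuous hY.continuous hYc hWi (domWeight_nonneg γ) h34
      (sq_nonneg B) fun z hz hy => ?_
    have hzS : z ∈ S := ⟨⟨h12.le.trans (h23.le.trans hz.1), hz.2⟩, by simpa using hYsupp _ hy⟩
    calc u z ^ 2 * Y z.2 ^ 2 ≤ B ^ 2 * (1 + ‖z.2‖ ^ 2) ^ 2 * polyWeight γ z.2 :=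
          mul_le_mul (huB2 z hzS) (hYle _) (sq_nonneg _) (by positivity)
      _ = B ^ 2 * ((1 + ‖z.2‖ ^ 2) ^ 2 * polyWeight γ z.2) := by ring
      _ ≤ _ := mul_le_mul_of_nonneg_left (sq_mul_polyWeight_le_domWeight γ _) (sq_nonneg B)
  have hT2 : ∫ z : ℝ × EuclideanSpace ℝ (Fin n), cacConst n τ c * u z ^ 2 *
        (θ z.1 * gradSq Y z.2) ≤ cacConst n τ c * B ^ 2 * Cc * (|T| * I) := by
    have i1 : Integrable fun z : ℝ × EuclideanSpace ℝ (Fin n) => cacConst n τ c * u z ^ 2 *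
        (θ z.1 * gradSq Y z.2) := by
      refine Continuous.integrable_of_hasCompactSupport ?_ (hasCompactSupport_prod_mul
        (hasCompactSupport_timeCut h12 h34) (hasCompactSupport_gradSq hYc)).mul_left
      exact (continuous_const.mul (hus.continuous.pow 2)).mul
        (((contDiff_timeCut _ _ _ _).continuous.comp continuous_fst).mul
          ((continuous_gradSq hY).comp continuous_snd))
    calc _ ≤ ∫ z : ℝ × EuclideanSpace ℝ (Fin n),
          cacConst n τ c * B ^ 2 * Cc * (θ z.1 * domWeight γ z.2) := by
          refine integral_mono i1 (hθW.const_mul _) fun z => ?_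
          have hr : 0 ≤ cacConst n τ c * B ^ 2 * Cc * (θ z.1 * domWeight γ z.2) :=
            mul_nonneg (by positivity) (mul_nonneg (hθ0 _) (domWeight_nonneg γ _))
          by_cases h1 : θ z.1 = 0
          · simp [h1]
          by_cases h2 : ‖z.2‖ ≤ 2 * R
          swap
          · simp only [eq_zero_of_gradSq hYsupp (not_le.1 h2), mul_zero]
            exact hr
          have hzS := hmemS z h1 h2
          have h3 : u z ^ 2 * gradSq Y z.2 ≤ B ^ 2 * Cc * domWeight γ z.2 := by
            calc u z ^ 2 * gradSq Y z.2 ≤ B ^ 2 * (1 + ‖z.2‖ ^ 2) ^ 2 * (Cc * polyWeight γ z.2) :=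
                  mul_le_mul (huB2 z hzS) (hYgrad _) (gradSq_nonneg _ _) (by positivity)
              _ = B ^ 2 * Cc * ((1 + ‖z.2‖ ^ 2) ^ 2 * polyWeight γ z.2) := by ring
              _ ≤ _ := mul_le_mul_of_nonneg_left (sq_mul_polyWeight_le_domWeight γ _)
                  (by positivity)
          calc cacConst n τ c * u z ^ 2 * (θ z.1 * gradSq Y z.2)
              = cacConst n τ c * θ z.1 * (u z ^ 2 * gradSq Y z.2) := by ring
            _ ≤ cacConst n τ c * θ z.1 * (B ^ 2 * Cc * domWeight γ z.2) :=
                mul_le_mul_of_nonneg_left h3 (mul_nonneg hcac0 (hθ0 _))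
            _ = _ := by ring
      _ ≤ _ := by
          rw [integral_const_mul]
          exact mul_le_mul_of_nonneg_left hθWle (by positivity)
  have i4 : Integrable fun z : ℝ × EuclideanSpace ℝ (Fin n) =>
      (∑ i, gradX u z i ^ 2) * (θ z.1 * Y z.2 ^ 2) :=
    (hgu.mul hχ.continuous).integrable_of_hasCompactSupport hχc.mul_left
  have hT3 : ∫ z : ℝ × EuclideanSpace ℝ (Fin n), parabolicOp a u z * u z *
        (θ z.1 * Y z.2 ^ 2) ≤ c / 8 * (∫ z : ℝ × EuclideanSpace ℝ (Fin n),
          (∑ i, gradX u z i ^ 2) * (θ z.1 * Y z.2 ^ 2)) + C₃ * (|T| * I) + 1 := by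
    have i1 : Integrable fun z : ℝ × EuclideanSpace ℝ (Fin n) => parabolicOp a u z * u z *
        (θ z.1 * Y z.2 ^ 2) :=
      (((contDiff_parabolicOp a hus).continuous.mul hus.continuous).mul
        hχ.continuous).integrable_of_hasCompactSupport hχc.mul_left
    have i5 : Integrable (S.indicator fun z => Q * e z) :=
      (integrable_indicator_iff hSc.measurableSet).2 (hk1i.const_mul Q)
    have i6 : Integrable fun z : ℝ × EuclideanSpace ℝ (Fin n) =>
        c / 8 * ((∑ i, gradX u z i ^ 2) * (θ z.1 * Y z.2 ^ 2)) +
          C₃ * (θ z.1 * domWeight γ z.2) := (i4.const_mul _).add (hθW.const_mul _)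
    calc _ ≤ ∫ z : ℝ × EuclideanSpace ℝ (Fin n),
          (c / 8 * ((∑ i, gradX u z i ^ 2) * (θ z.1 * Y z.2 ^ 2)) +
          C₃ * (θ z.1 * domWeight γ z.2) + S.indicator (fun z => Q * e z) z) := by
          refine integral_mono i1 (i6.add i5) fun z => ?_
          have he0 : 0 ≤ S.indicator (fun z => Q * e z) z :=
            indicator_nonneg (fun z _ => mul_nonneg hQ0 (approxError_nonneg hGb0)) z
          have hw0 := mul_nonneg hC₃0 (mul_nonneg (hθ0 z.1) (domWeight_nonneg γ z.2))
          by_cases h1 : θ z.1 = 0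
          · simp only [h1]; norm_num; exact he0
          by_cases h2 : Y z.2 = 0
          · simp only [h2]; norm_num; linarith
          have hzR := hYsupp _ h2
          have hzS := hmemS z h1 hzR
          rw [indicator_of_mem hzS]
          have hL := abs_parabolicOp_sub_le (a := a) (l := l) (DJ := DJ) (v := u) (hgS z hzS)
          have hd := drift_term_le hc hB0 hK (one_le_one_add_norm_sq z.2) (huB z hzS)
            (hl z.1 (hSI z hzS) z.2) (g z) (gradX u z)
            (sum_sq_le_of_linear_growth (hg z.1 (hSI z hzS) z.2)) hL
          have hχ0 : 0 ≤ θ z.1 * Y z.2 ^ 2 := mul_nonneg (hθ0 _) (sq_nonneg _)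
          have hχ1 : θ z.1 * Y z.2 ^ 2 ≤ 1 :=
            mul_le_one₀ (timeCut_le_one _ _ _ _ _) (sq_nonneg _)
              ((hYle _).trans (polyWeight_le_one hγ0 _))
          have k1 := mul_le_mul_of_nonneg_right hd hχ0
          have k2 : C₃ * (1 + ‖z.2‖ ^ 2) ^ 3 * (θ z.1 * Y z.2 ^ 2) ≤
              C₃ * (θ z.1 * domWeight γ z.2) := by
            have := mul_le_mul_of_nonneg_left (hYle z.2)
              (by have := hθ0 z.1; positivity : 0 ≤ C₃ * (1 + ‖z.2‖ ^ 2) ^ 3 * θ z.1)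
            rw [domWeight]
            linarith
          have k3 : e z * (B * (1 + ‖z.2‖ ^ 2)) * (θ z.1 * Y z.2 ^ 2) ≤ Q * e z := by
            have h0 : 0 ≤ e z := approxError_nonneg hGb0
            have h1 : B * (1 + ‖z.2‖ ^ 2) ≤ Q := by rw [hQ]; gcongr
            calc e z * (B * (1 + ‖z.2‖ ^ 2)) * (θ z.1 * Y z.2 ^ 2)
                ≤ e z * (B * (1 + ‖z.2‖ ^ 2)) * 1 :=
                  mul_le_mul_of_nonneg_left hχ1 (by positivity)
              _ ≤ e z * Q := by rw [mul_one]; exact mul_le_mul_of_nonneg_left h1 h0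
              _ = Q * e z := mul_comm _ _
          simp only [← he] at k1
          linarith
      _ = c / 8 * (∫ z : ℝ × EuclideanSpace ℝ (Fin n),
          (∑ i, gradX u z i ^ 2) * (θ z.1 * Y z.2 ^ 2)) +
          C₃ * (∫ z : ℝ × EuclideanSpace ℝ (Fin n), θ z.1 * domWeight γ z.2) +
          Q * ∫ z in S, e z := by
          rw [integral_add i6 i5, integral_add (i4.const_mul _) (hθW.const_mul _),
            integral_const_mul, integral_const_mul, integral_indicator hSc.measurableSet,
            integral_const_mul]
      _ ≤ _ := by
          have e1 := mul_le_mul_of_nonneg_left hθWle hC₃0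
          have e2 := mul_le_mul_of_nonneg_left hk1 hQ0
          have e3 : Q * (1 / (Q + 1)) ≤ 1 := by
            rw [mul_one_div, div_le_one (by positivity)]; linarith
          linarith
  have hcacc' : ∫ z : ℝ × EuclideanSpace ℝ (Fin n),
      (∑ i, gradX u z i ^ 2) * (θ z.1 * Y z.2 ^ 2) ≤ 4 / c * (Ctot + 1) := by
    simp only [mul_assoc (3 / 8 * c)] at hcacc
    rw [integral_const_mul] at hcacc
    -- Of the `3c / 8` in the Caccioppoli inequality, `c / 8` has been spent on the drift.
    have : c / 4 * (∫ z : ℝ × EuclideanSpace ℝ (Fin n),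
      (∑ i, gradX u z i ^ 2) * (θ z.1 * Y z.2 ^ 2)) ≤ Ctot + 1 := by
      rw [hCtot]; linarith
    rw [div_mul_eq_mul_div, le_div_iff₀ hc]
    linarith
  have hle : ∫ z in S', (∑ i, gradX u z i ^ 2) * polyWeight γ z.2 ≤ 4 / c * (Ctot + 1) := by
    refine le_trans ?_ hcacc'
    rw [setIntegral_congr_fun (g := fun z => (∑ i, gradX u z i ^ 2) * (θ z.1 * Y z.2 ^ 2))
      hS'c.measurableSet]
    · refine setIntegral_le_integral i4 (ae_of_all _ fun z => ?_)
      exact mul_nonneg (Finset.sum_nonneg fun _ _ => sq_nonneg _)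
        (mul_nonneg (hθ0 _) (sq_nonneg _))
    · intro z hz
      have h1 : θ z.1 = 1 := timeCut_eq_one h12 h34 hz.1
      simp only [h1, hYeq z.2 (by simpa using hz.2), one_mul]
  obtain ⟨j1, -, j3, -⟩ := sum_sq_integral_le (μ := volume.restrict S')
    (wt := fun z => polyWeight γ z.2)
    (p := fun i z => gradX u z i) (v := fun i z => DJ z i)
    (fun z => ⟨(polyWeight_pos γ _).le, polyWeight_le_one hγ0 _⟩)
    ((continuous_polyWeight γ).comp continuous_snd).aestronglyMeasurable
    (fun i => (hJ.weakDeriv_space i).2.1 S' hS'c ((hS'S.trans hSG).trans hΩ))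
    (fun i => (hk3 i).1.ae_eq ((ae_restrict_iff' hS'c.measurableSet).2 (ae_of_all _ fun z hz => by
      simp only [hgradu z hz i])))
    (fun i => le_trans (le_of_eq (setIntegral_congr_fun hS'c.measurableSet fun z hz => by
      simp only [hgradu z hz i])) (hk3 i).2)
  refine ⟨j1, j3.trans ?_⟩
  have : (n : ℝ) * (1 / (n + 1)) ≤ 1 := by
    rw [mul_one_div, div_le_one (by positivity)]; linarith
  linarith

end

/-! ### Estimates up to the terminal time. -/

section

variable {n : ℕ}

theorem IsL2Loc.aestronglyMeasurable {t T : ℝ} {w : ℝ × EuclideanSpace ℝ (Fin n) → ℝ}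
    (hw : IsL2Loc (openSlab n t T) w) :
    AEStronglyMeasurable w (volume.restrict (openSlab n t T)) := by
  let A : ℕ → Set (ℝ × EuclideanSpace ℝ (Fin n)) := fun k =>
    Icc (t + 1 / (k + 1)) (T - 1 / (k + 1)) ×ˢ Metric.closedBall 0 (k : ℝ)
  have hU : openSlab n t T ⊆ ⋃ k, A k := by
    rintro ⟨s, x⟩ ⟨⟨h1, h2⟩, -⟩
    obtain ⟨k1, hk1⟩ := exists_nat_one_div_lt (show 0 < min (s - t) (T - s) from
      lt_min (by linarith) (by linarith))
    obtain ⟨k2, hk2⟩ := exists_nat_gt ‖x‖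
    have e1 : 1 / ((max k1 k2 : ℕ) + 1 : ℝ) ≤ 1 / ((k1 : ℝ) + 1) := by
      have : (k1 : ℝ) ≤ (max k1 k2 : ℕ) := by exact_mod_cast le_max_left _ _
      gcongr
    have e2 : (k2 : ℝ) ≤ (max k1 k2 : ℕ) := by exact_mod_cast le_max_right _ _
    have e3 := min_le_left (s - t) (T - s)
    have e4 := min_le_right (s - t) (T - s)
    refine mem_iUnion.2 ⟨max k1 k2, ⟨by simp only; linarith, by simp only; linarith⟩, ?_⟩
    rw [Metric.mem_closedBall, dist_zero_right]
    simp only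
    linarith
  refine AEStronglyMeasurable.mono_set hU ?_
  refine (aestronglyMeasurable_iUnion_iff).2 fun k => ?_
  refine (hw (A k) (isCompact_Icc.prod (isCompact_closedBall _ _)) ?_).1
  refine prod_mono (fun s hs => ?_) (subset_univ _)
  have : (0 : ℝ) < 1 / ((k : ℝ) + 1) := by positivity
  exact ⟨by linarith [hs.1], by linarith [hs.2]⟩

theorem box_subset_openSlab {t T a b R : ℝ} (ha : t < a) (hb : b < T) :
    Icc a b ×ˢ Metric.closedBall (0 : EuclideanSpace ℝ (Fin n)) R ⊆ openSlab n t T :=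
  prod_mono (fun _ hs => ⟨ha.trans_le hs.1, hs.2.trans_lt hb⟩) (subset_univ _)

theorem lintegral_openSlab_ofReal_le {t T : ℝ} (htT : t < T)
    {f : ℝ × EuclideanSpace ℝ (Fin n) → ℝ} (hf0 : ∀ z, 0 ≤ f z) {C : ℝ}
    (h : ∀ a b R : ℝ, t < a → a < b → b < T → 1 ≤ R →
      IntegrableOn f (Icc a b ×ˢ Metric.closedBall 0 R) ∧
      ∫ z in Icc a b ×ˢ Metric.closedBall 0 R, f z ≤ C) :
    ∫⁻ z in openSlab n t T, ENNReal.ofReal (f z) ≤ ENNReal.ofReal C := by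
  refine lintegral_openSlab_le htT fun a b R h1 h2 h3 h4 => ?_
  obtain ⟨h5, h6⟩ := h a b R h1 h2 h3 h4
  rw [← ofReal_integral_eq_lintegral_ofReal h5 (ae_of_all _ hf0)]
  exact ENNReal.ofReal_le_ofReal h6

theorem IsL2Loc.integrableOn_sq_mul {t T : ℝ} {w : ℝ × EuclideanSpace ℝ (Fin n) → ℝ}
    (hw : IsL2Loc (openSlab n t T) w) (γ : ℝ) {S : Set (ℝ × EuclideanSpace ℝ (Fin n))}
    (hS : IsCompact S) (hSΩ : S ⊆ openSlab n t T) :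
    IntegrableOn (fun z => w z ^ 2 * polyWeight γ z.2) S :=
  IntegrableOn.mul_continuousOn (hw S hS hSΩ).integrable_sq
    ((continuous_polyWeight γ).comp continuous_snd).continuousOn hS

/-- Uniform bounds on compact cylinders give square integrability on a bounded cylinder up to both
time ends, the weight being bounded below there. Consequently mollifications converge in `L²` of the
whole space, which is needed because the cutoffs in the Hessian estimate move towards `T` together
with the mollification parameter. -/
theorem IsL2Loc.memLp_indicator_slabBall {t T : ℝ} (htT : t < T)
    {w : ℝ × EuclideanSpace ℝ (Fin n) → ℝ} (hw : IsL2Loc (openSlab n t T) w) {γ C : ℝ}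
    (hγ : 0 ≤ γ) (hC : 0 ≤ C)
    (h : ∀ a b R : ℝ, t < a → a < b → b < T → 1 ≤ R →
      ∫ z in Icc a b ×ˢ Metric.closedBall 0 R, w z ^ 2 * polyWeight γ z.2 ≤ C) (R : ℝ) :
    MemLp ((slabBall n t T R).indicator w) 2 ∧
      ∫ z, (slabBall n t T R).indicator w z ^ 2 * polyWeight γ z.2 ≤ C := by
  have hGm := (isOpen_slabBall n t T R).measurableSet
  have hGΩ := slabBall_subset_openSlab n t T R
  have h1 : ∫⁻ z in openSlab n t T, ENNReal.ofReal (w z ^ 2 * polyWeight γ z.2) ≤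
      ENNReal.ofReal C :=
    lintegral_openSlab_ofReal_le htT (fun z => mul_nonneg (sq_nonneg _) (polyWeight_pos γ _).le)
      fun a b R' h1 h2 h3 h4 => ⟨hw.integrableOn_sq_mul γ
        (isCompact_Icc.prod (isCompact_closedBall _ _)) (box_subset_openSlab h1 h3),
        h a b R' h1 h2 h3 h4⟩
  have hm : AEStronglyMeasurable w (volume.restrict (slabBall n t T R)) :=
    hw.aestronglyMeasurable.mono_set hGΩ
  have h2 : ∫⁻ z in slabBall n t T R, ENNReal.ofReal (w z ^ 2 * polyWeight γ z.2) ≤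
      ENNReal.ofReal C := (lintegral_mono_set hGΩ).trans h1
  have hi : IntegrableOn (fun z => w z ^ 2 * polyWeight γ z.2) (slabBall n t T R) := by
    refine ⟨(hm.pow 2).mul
      ((continuous_polyWeight γ).comp continuous_snd).aestronglyMeasurable, ?_⟩
    rw [hasFiniteIntegral_iff_ofReal (ae_of_all _ fun z =>
      mul_nonneg (sq_nonneg _) (polyWeight_pos γ _).le)]
    exact h2.trans_lt ENNReal.ofReal_lt_top
  constructor
  · rw [memLp_indicator_iff_restrict hGm, memLp_two_iff_integrable_sq hm]
    refine Integrable.mono' (hi.mul_const ((1 + R ^ 2) ^ γ)) (hm.pow 2) ?_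
    refine (ae_restrict_iff' hGm).2 (ae_of_all _ fun z hz => ?_)
    rw [Real.norm_eq_abs, abs_of_nonneg (sq_nonneg _), mul_assoc]
    refine le_mul_of_one_le_right (sq_nonneg _) ?_
    have hx : ‖z.2‖ < R := by simpa using hz.2
    have : (1 + ‖z.2‖ ^ 2) ^ γ ≤ (1 + R ^ 2) ^ γ := by gcongr
    rw [polyWeight, one_div, inv_mul_eq_div, one_le_div (by positivity)]
    exact this
  · have e : ∀ z, (slabBall n t T R).indicator w z ^ 2 * polyWeight γ z.2 =
        (slabBall n t T R).indicator (fun z => w z ^ 2 * polyWeight γ z.2) z := by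
      intro z
      by_cases hz : z ∈ slabBall n t T R <;> simp [hz]
    simp only [e]
    rw [integral_indicator hGm]
    rw [← ofReal_integral_eq_lintegral_ofReal hi (ae_of_all _ fun z =>
      mul_nonneg (sq_nonneg _) (polyWeight_pos γ _).le)] at h2
    exact (ENNReal.ofReal_le_ofReal_iff hC).1 h2

theorem setIntegral_box_le {t T a b R : ℝ} (ht : 0 ≤ t) (hta : t < a) (hab : a < b) (hbT : b < T)
    {W : EuclideanSpace ℝ (Fin n) → ℝ} (hW : Integrable W) (hW0 : ∀ x, 0 ≤ W x) :
    IntegrableOn (fun z : ℝ × EuclideanSpace ℝ (Fin n) => W z.2)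
      (Icc a b ×ˢ Metric.closedBall 0 R) ∧
    ∫ z in Icc a b ×ˢ Metric.closedBall (0 : EuclideanSpace ℝ (Fin n)) R, W z.2 ≤
      |T| * ∫ x, W x := by
  have h12 : (t + a) / 2 < a := by linarith
  have h34 : b < (b + T) / 2 := by linarith
  set θ := timeCut ((t + a) / 2) a b ((b + T) / 2)
  have hi : Integrable fun z : ℝ × EuclideanSpace ℝ (Fin n) => θ z.1 * W z.2 :=
    (integrable_timeCut h12 h34).mul_prod hW
  have hS : MeasurableSet (Icc a b ×ˢ Metric.closedBall (0 : EuclideanSpace ℝ (Fin n)) R) :=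
    (isCompact_Icc.prod (isCompact_closedBall _ _)).measurableSet
  have heq : ∀ z ∈ Icc a b ×ˢ Metric.closedBall (0 : EuclideanSpace ℝ (Fin n)) R,
      W z.2 = θ z.1 * W z.2 := fun z hz => by
    rw [show θ z.1 = 1 from timeCut_eq_one h12 h34 hz.1, one_mul]
  refine ⟨(integrableOn_congr_fun heq hS).2 hi.integrableOn, ?_⟩
  rw [setIntegral_congr_fun hS heq]
  refine (setIntegral_le_integral hi (ae_of_all _ fun z =>
    mul_nonneg (timeCut_nonneg _ _ _ _ _) (hW0 _))).trans
    ((integral_timeCut_mul_le h12 h34 (by linarith) hW0).trans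
    (mul_le_mul_of_nonneg_right ?_ (integral_nonneg hW0)))
  exact (by linarith : (b + T) / 2 - (t + a) / 2 ≤ T).trans (le_abs_self T)

theorem fderiv_fderiv_comm {V : Type*} [NormedAddCommGroup V] [NormedSpace ℝ V] {f : V → ℝ}
    (hf : ContDiff ℝ ∞ f) (v w z : V) :
    fderiv ℝ (fun y => fderiv ℝ f y v) z w = fderiv ℝ (fun y => fderiv ℝ f y w) z v := by
  have hd : DifferentiableAt ℝ (fderiv ℝ f) z :=
    (hf.fderiv_right (m := ∞) (by simp)).differentiable (by simp) z
  have h : ∀ v w, fderiv ℝ (fun y => fderiv ℝ f y v) z w = fderiv ℝ (fderiv ℝ f) z w v := by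
    intro v w
    rw [fderiv_clm_apply hd (differentiableAt_const v)]
    simp
  rw [h, h]
  have hs : IsSymmSndFDerivAt ℝ f z :=
    hf.contDiffAt.isSymmSndFDerivAt (by simpa using ENat.LEInfty.out)
  exact hs w v

theorem parabolicOp_fderiv (a : Matrix (Fin n) (Fin n) ℝ)
    {v : ℝ × EuclideanSpace ℝ (Fin n) → ℝ} (hv : ContDiff ℝ ∞ v) (i : Fin n)
    (z : ℝ × EuclideanSpace ℝ (Fin n)) :
    parabolicOp a (fun y => fderiv ℝ v y (dirX i)) z =
      fderiv ℝ (parabolicOp a v) z (dirX i) := by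
  have hs := fun w => contDiff_fderiv_apply hv w
  have hss := fun w w' => contDiff_fderiv_apply (hs w) w'
  have hH : ∀ p q, hessX (fun y => fderiv ℝ v y (dirX i)) z p q =
      fderiv ℝ (fun y => hessX v y p q) z (dirX i) := by
    intro p q
    unfold hessX
    have e1 : (fun y => fderiv ℝ (fun y => fderiv ℝ v y (dirX i)) y (dirX q)) =
        fun y => fderiv ℝ (fun y => fderiv ℝ v y (dirX q)) y (dirX i) :=
      funext fun y => fderiv_fderiv_comm hv _ _ _
    rw [e1, fderiv_fderiv_comm (hs (dirX q))]
  have hd : ∀ p q, HasFDerivAt (fun y => hessX v y p q) (fderiv ℝ (fun y => hessX v y p q) z) z :=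
    fun p q => ((hss (dirX q) (dirX p)).differentiable (by simp) z).hasFDerivAt
  have h1 : HasFDerivAt (fun y => fderiv ℝ v y (dirT n))
      (fderiv ℝ (fun y => fderiv ℝ v y (dirT n)) z) z :=
    ((hs _).differentiable (by simp) z).hasFDerivAt
  have h2 : HasFDerivAt (parabolicOp a v) _ z := h1.neg.add
    ((HasFDerivAt.fun_sum fun p (_ : p ∈ Finset.univ) =>
      HasFDerivAt.fun_sum fun q (_ : q ∈ Finset.univ) => (hd p q).const_mul (a p q)).const_mul
      (-(1 / 2)))
  rw [h2.fderiv, parabolicOp, diffusionOp, fderiv_fderiv_comm hv]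
  simp only [hH, add_apply, neg_apply, smul_apply, sum_apply, smul_eq_mul]

/-- The mean value inequality bounds increments of `lT`, hence increments of the mollification,
hence its derivative; no integral of the derivative of `lT` is formed. The constant 3 is the
original 1, plus the radius `ε ≤ 1` of the kernel, plus the radius 1 of the ball of increments. -/
theorem abs_fderiv_mollify_comp_snd_le {κ : ℝ × EuclideanSpace ℝ (Fin n) → ℝ} {δ ε : ℝ}
    (hκ : IsMollifier κ δ ε) (hε : ε ≤ 1) {lT : EuclideanSpace ℝ (Fin n) → ℝ}
    (hlT : Differentiable ℝ lT) {K : ℝ} (hK : 0 ≤ K)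
    (hb : ∀ x, ‖fderiv ℝ lT x‖ ≤ K * (1 + ‖x‖)) (i : Fin n)
    (z : ℝ × EuclideanSpace ℝ (Fin n)) :
    |mollify (fun y => fderiv ℝ κ y (dirX i)) (fun y => lT y.2) z| ≤ K * (3 + ‖z.2‖) := by
  set L : ℝ × EuclideanSpace ℝ (Fin n) → ℝ := fun y => lT y.2 with hL
  have hLc : Continuous L := hlT.continuous.comp continuous_snd
  have hloc : LocallyIntegrable L := hLc.locallyIntegrable
  have hint : ∀ z, Integrable fun h => κ h * L (z - h) := fun z => by
    refine Continuous.integrable_of_hasCompactSupport ?_ hκ.hasCompactSupport.mul_right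
    exact hκ.contDiff.continuous.mul (hLc.comp (by fun_prop))
  rw [← fderiv_mollify hκ.contDiff hκ.hasCompactSupport hloc]
  have hd : HasFDerivAt (mollify κ L) (fderiv ℝ (mollify κ L) z) z :=
    ((contDiff_mollify hκ.contDiff hκ.hasCompactSupport hloc).differentiable
      (by simp) z).hasFDerivAt
  have hC0 : 0 ≤ K * (3 + ‖z.2‖) := by positivity
  have hlip : ∀ᶠ y in 𝓝 z, ‖mollify κ L y - mollify κ L z‖ ≤ K * (3 + ‖z.2‖) * ‖y - z‖ := by
    filter_upwards [Metric.ball_mem_nhds z one_pos] with y hy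
    rw [mollify_eq_integral_sub, mollify_eq_integral_sub, ← integral_sub (hint y) (hint z)]
    have e2 : K * (3 + ‖z.2‖) * ‖y - z‖ = ∫ h, κ h * (K * (3 + ‖z.2‖) * ‖y - z‖) := by
      rw [integral_mul_const, hκ.integral_eq_one, one_mul]
    rw [e2]
    refine norm_integral_le_of_norm_le
      ((hκ.contDiff.continuous.integrable_of_hasCompactSupport hκ.hasCompactSupport).mul_const _)
      (ae_of_all _ fun h => ?_)
    rw [← mul_sub, norm_mul, Real.norm_of_nonneg (hκ.nonneg h)]
    by_cases hh : κ h = 0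
    · simp [hh]
    refine mul_le_mul_of_nonneg_left ?_ (hκ.nonneg h)
    have hh2 := (hκ.supp h hh).2
    have hyz : ‖y.2 - z.2‖ ≤ ‖y - z‖ := norm_snd_le (y - z)
    have hy1 : ‖y - z‖ < 1 := by rwa [Metric.mem_ball, dist_eq_norm] at hy
    have hmv := Convex.norm_image_sub_le_of_norm_fderiv_le (𝕜 := ℝ) (f := lT)
      (s := Metric.ball (z.2 - h.2) 1) (C := K * (3 + ‖z.2‖)) (x := z.2 - h.2) (y := y.2 - h.2)
      (fun x _ => hlT x) (fun x hx => ?_) (convex_ball _ _) (Metric.mem_ball_self one_pos) ?_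
    · have e : (y - h).2 - (z - h).2 = y.2 - z.2 := by simp
      calc ‖L (y - h) - L (z - h)‖ ≤ K * (3 + ‖z.2‖) * ‖y.2 - h.2 - (z.2 - h.2)‖ := hmv
        _ ≤ _ := by
          rw [sub_sub_sub_cancel_right]
          exact mul_le_mul_of_nonneg_left hyz hC0
    · refine (hb x).trans (mul_le_mul_of_nonneg_left ?_ hK)
      rw [Metric.mem_ball, dist_eq_norm] at hx
      have h1 : ‖x‖ ≤ ‖x - (z.2 - h.2)‖ + ‖z.2 - h.2‖ := norm_le_norm_sub_add _ _
      have h2 := norm_sub_le z.2 h.2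
      linarith
    · rw [Metric.mem_ball, dist_eq_norm, sub_sub_sub_cancel_right]
      exact hyz.trans_lt hy1
  have := hd.le_of_lip' hC0 hlip
  refine ((fderiv ℝ (mollify κ L) z).le_opNorm _).trans ?_
  have hn : ‖(dirX i : ℝ × EuclideanSpace ℝ (Fin n))‖ = 1 := by simp [Prod.norm_def]
  rw [hn, mul_one]
  exact this

/-- With the derivative on the kernel, replacing `f` by `lT` costs at most the `L¹` norm of the
kernel times the distance of the two functions, that is at most 1. -/
theorem abs_mollify_fderiv_le {κ : ℝ × EuclideanSpace ℝ (Fin n) → ℝ} {δ ε : ℝ}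
    (hκ : IsMollifier κ δ ε) (hε : ε ≤ 1) {lT : EuclideanSpace ℝ (Fin n) → ℝ}
    (hlT : Differentiable ℝ lT) {K : ℝ} (hK : 0 ≤ K)
    (hb : ∀ x, ‖fderiv ℝ lT x‖ ≤ K * (1 + ‖x‖)) {i : Fin n} {C : ℝ} (hC : 0 ≤ C)
    (hκC : ∫ z, |fderiv ℝ κ z (dirX i)| ≤ C) {f : ℝ × EuclideanSpace ℝ (Fin n) → ℝ}
    (hf : LocallyIntegrable f) {z : ℝ × EuclideanSpace ℝ (Fin n)}
    (h : ∀ y ∈ box z δ ε, |f y - lT y.2| ≤ 1 / (C + 1)) :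
    |mollify (fun y => fderiv ℝ κ y (dirX i)) f z| ≤ 1 + K * (3 + ‖z.2‖) := by
  have hs := contDiff_fderiv_apply hκ.contDiff (dirX i)
  have hc : HasCompactSupport fun y => fderiv ℝ κ y (dirX i) :=
    hκ.hasCompactSupport.fderiv_apply' _
  have hloc : LocallyIntegrable fun y : ℝ × EuclideanSpace ℝ (Fin n) => lT y.2 :=
    (hlT.continuous.comp continuous_snd).locallyIntegrable
  have hint : ∀ f : ℝ × EuclideanSpace ℝ (Fin n) → ℝ, LocallyIntegrable f →
      Integrable fun h => fderiv ℝ κ h (dirX i) * f (z - h) := fun f hf => by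
    have := (hc.convolutionExists_left (ContinuousLinearMap.lsmul ℝ ℝ) hs.continuous hf z)
    simpa [ConvolutionExistsAt] using this
  have h1 : |mollify (fun y => fderiv ℝ κ y (dirX i)) f z -
      mollify (fun y => fderiv ℝ κ y (dirX i)) (fun y => lT y.2) z| ≤ 1 := by
    rw [mollify_eq_integral_sub, mollify_eq_integral_sub, ← integral_sub (hint f hf) (hint _ hloc),
      ← Real.norm_eq_abs]
    have hi : Integrable fun h => |fderiv ℝ κ h (dirX i)| * (1 / (C + 1)) :=
      (hs.continuous.integrable_of_hasCompactSupport hc).abs.mul_const _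
    refine (norm_integral_le_of_norm_le hi (ae_of_all _ fun y => ?_)).trans ?_
    · rw [← mul_sub, norm_mul, Real.norm_eq_abs, Real.norm_eq_abs]
      by_cases hy : fderiv ℝ κ y (dirX i) = 0
      · simp [hy]
      refine mul_le_mul_of_nonneg_left (h _ ?_) (abs_nonneg _)
      have hy' : y ∈ box 0 δ ε := support_fderiv_apply_subset (isCompact_box _ _ _).isClosed
        hκ.support_subset (dirX i) hy
      refine sub_mem_box_iff.1 ?_
      rwa [sub_sub_cancel]
    · rw [integral_mul_const, mul_one_div, div_le_one (by positivity)]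
      linarith
  have h2 := abs_fderiv_mollify_comp_snd_le hκ hε hlT hK hb i z
  have h3 := abs_add_le (mollify (fun y => fderiv ℝ κ y (dirX i)) f z -
      mollify (fun y => fderiv ℝ κ y (dirX i)) (fun y => lT y.2) z)
      (mollify (fun y => fderiv ℝ κ y (dirX i)) (fun y => lT y.2) z)
  rw [sub_add_cancel] at h3
  linarith

end

/-! ### The weighted Hessian bound. -/

section

variable {n : ℕ}

/-- A Caccioppoli inequality for a space derivative of a smooth function. -/
theorem caccioppoli_fderiv {a : Matrix (Fin n) (Fin n) ℝ} {τ c : ℝ} (hc : 0 < c)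
    (ha : ∀ i j, |a i j| ≤ τ) (hτ : 0 ≤ τ)
    (hell : ∀ ξ : Fin n → ℝ, c * ∑ i, ξ i ^ 2 ≤ quadForm a ξ ξ)
    {v : ℝ × EuclideanSpace ℝ (Fin n) → ℝ} (hv : ContDiff ℝ ∞ v) (i : Fin n)
    {Y : EuclideanSpace ℝ (Fin n) → ℝ} (hY : ContDiff ℝ ∞ Y) (hYc : HasCompactSupport Y)
    {s₁ s₂ s₃ s₄ : ℝ} (h₁₂ : s₁ < s₂) (h₃₄ : s₃ < s₄) :
    c / 4 * ∫ z : ℝ × EuclideanSpace ℝ (Fin n),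
        (∑ j, gradX (fun y => gradX v y i) z j ^ 2) * (timeCut s₁ s₂ s₃ s₄ z.1 * Y z.2 ^ 2) ≤
      (∫ z : ℝ × EuclideanSpace ℝ (Fin n), 1 / 2 * gradX v z i ^ 2 *
        (deriv (riseCut s₃ s₄) z.1 * Y z.2 ^ 2)) +
      (cacConst n τ c + 1) * (∫ z : ℝ × EuclideanSpace ℝ (Fin n), gradX v z i ^ 2 *
        (timeCut s₁ s₂ s₃ s₄ z.1 * gradSq Y z.2)) +
      (2 / c + 1) * ∫ z : ℝ × EuclideanSpace ℝ (Fin n), parabolicOp a v z ^ 2 *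
        (timeCut s₁ s₂ s₃ s₄ z.1 * Y z.2 ^ 2) := by
  set u : ℝ × EuclideanSpace ℝ (Fin n) → ℝ := fun y => gradX v y i with hudef
  set F := parabolicOp a v with hFdef
  set θ := timeCut s₁ s₂ s₃ s₄ with hθdef
  have hu : ContDiff ℝ ∞ u := contDiff_fderiv_apply hv _
  have hF : ContDiff ℝ ∞ F := contDiff_parabolicOp a hv
  have hθ : ContDiff ℝ ∞ θ := contDiff_timeCut _ _ _ _
  have hθ0 : ∀ s, 0 ≤ θ s := timeCut_nonneg _ _ _ _
  have hθc : HasCompactSupport θ := hasCompactSupport_timeCut h₁₂ h₃₄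
  have hY2 : ContDiff ℝ ∞ fun x => Y x ^ 2 := hY.pow 2
  have hY2c : HasCompactSupport fun x => Y x ^ 2 :=
    hYc.comp_left (g := fun r : ℝ => r ^ 2) (by simp)
  have hχ := contDiff_prod_mul hθ hY2
  have hχc := hasCompactSupport_prod_mul hθc hY2c
  have hgu : Continuous fun z => ∑ i, gradX u z i ^ 2 :=
    continuous_finsetSum _ fun i _ => (contDiff_fderiv_apply hu _).continuous.pow 2
  have hcac := caccioppoli hc ha hτ hell hu hY hYc h₁₂ h₃₄
  set χ : ℝ × EuclideanSpace ℝ (Fin n) → ℝ := fun z => θ z.1 * Y z.2 ^ 2 with hχdef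
  have i1 : Integrable fun z => (∑ j, gradX u z j ^ 2) * χ z :=
    (hgu.mul hχ.continuous).integrable_of_hasCompactSupport hχc.mul_left
  have i2 : Integrable fun z => F z ^ 2 * χ z :=
    ((hF.continuous.pow 2).mul hχ.continuous).integrable_of_hasCompactSupport hχc.mul_left
  have i3 : Integrable fun z : ℝ × EuclideanSpace ℝ (Fin n) => u z ^ 2 *
      (θ z.1 * gradSq Y z.2) := by
    refine Continuous.integrable_of_hasCompactSupport ?_ (hasCompactSupport_prod_mul
      hθc (hasCompactSupport_gradSq hYc)).mul_left
    exact (hu.continuous.pow 2).mul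
      ((hθ.continuous.comp continuous_fst).mul ((continuous_gradSq hY).comp continuous_snd))
  have i4 : Integrable fun z => parabolicOp a u z * u z * χ z :=
    (((contDiff_parabolicOp a hu).continuous.mul hu.continuous).mul
      hχ.continuous).integrable_of_hasCompactSupport hχc.mul_left
  -- The equation for `u = ∂ᵢv` has right side `∂ᵢF`, on which there is no control. Integrating the
  -- derivative of this product moves `∂ᵢ` onto `u χ`, so that only `F` itself has to be square
  -- integrable.
  have hw : ContDiff ℝ ∞ fun z => F z * (u z * χ z) := hF.mul (hu.mul hχ)
  have hwc : HasCompactSupport fun z => F z * (u z * χ z) := (hχc.mul_left).mul_left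
  have i5 : Integrable fun z => fderiv ℝ (fun z => F z * (u z * χ z)) z (dirX i) :=
    (contDiff_fderiv_apply hw _).continuous.integrable_of_hasCompactSupport (hwc.fderiv_apply' _)
  have h0 : ∫ z, fderiv ℝ (fun z => F z * (u z * χ z)) z (dirX i) = 0 :=
    integral_fderiv_apply_eq_zero (fun z => (hw.differentiable (by simp) z).hasFDerivAt)
      (hw.continuous.integrable_of_hasCompactSupport hwc) i5
  have hexp : ∀ z, fderiv ℝ (fun z => F z * (u z * χ z)) z (dirX i) =
      parabolicOp a u z * u z * χ z + F z * (gradX u z i * χ z +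
        u z * (θ z.1 * (2 * Y z.2 * fderiv ℝ Y z.2 (EuclideanSpace.single i 1)))) := by
    intro z
    have dF := hF.differentiable (by simp) z
    have du := hu.differentiable (by simp) z
    have dχ := hχ.differentiable (by simp) z
    have e1 : fderiv ℝ χ z (dirX i) =
        θ z.1 * (2 * Y z.2 * fderiv ℝ Y z.2 (EuclideanSpace.single i 1)) := by
      rw [hχdef, fderiv_prod_mul_dirX hθ hY2,
        (((hY.differentiable (by simp)) z.2).hasFDerivAt.pow 2).fderiv]
      simp
    have e2 : parabolicOp a u z = fderiv ℝ F z (dirX i) := parabolicOp_fderiv a hv i z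
    rw [fderiv_fun_mul dF (du.fun_mul dχ), fderiv_fun_mul du dχ, e2]
    simp only [add_apply, smul_apply, smul_eq_mul, e1, gradX]
    ring
  have hT3 : ∫ z, parabolicOp a u z * u z * χ z ≤
      c / 8 * (∫ z, (∑ j, gradX u z j ^ 2) * χ z) + (2 / c + 1) * (∫ z, F z ^ 2 * χ z) +
        ∫ z : ℝ × EuclideanSpace ℝ (Fin n), u z ^ 2 * (θ z.1 * gradSq Y z.2) := by
    rw [← integral_const_mul, ← integral_const_mul]
    refine integral_le_integral_add_three i4 (i1.const_mul _) (i2.const_mul _) i3 i5 h0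
      (ae_of_all _ fun z => ?_)
    rw [hexp]
    have k1 : gradX u z i ^ 2 ≤ ∑ j, gradX u z j ^ 2 :=
      Finset.single_le_sum (f := fun j => gradX u z j ^ 2) (fun _ _ => sq_nonneg _)
        (Finset.mem_univ i)
    have k2 : fderiv ℝ Y z.2 (EuclideanSpace.single i 1) ^ 2 ≤ gradSq Y z.2 :=
      Finset.single_le_sum (f := fun j => fderiv ℝ Y z.2 (EuclideanSpace.single j 1) ^ 2)
        (fun _ _ => sq_nonneg _) (Finset.mem_univ i)
    have hχ0 : 0 ≤ χ z := mul_nonneg (hθ0 _) (sq_nonneg _)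
    set p := gradX u z i
    set q := fderiv ℝ Y z.2 (EuclideanSpace.single i 1)
    have k3 := mul_le_mul_of_nonneg_right
      (mul_le_mul_of_nonneg_left k1 (by positivity : 0 ≤ c / 8)) hχ0
    have k4 := mul_le_mul_of_nonneg_left k2 (mul_nonneg (sq_nonneg (u z)) (hθ0 z.1))
    -- Absorbs `F ∂ᵢu` with `c / 8` of the gradient of `u`; the next square absorbs the term in
    -- which the derivative falls on the space cutoff. Together they produce the coefficients `2 / c
    -- + 1` and `cacConst + 1`.
    have k5 : 0 ≤ (c / 8 * p ^ 2 + F z * p + 2 / c * F z ^ 2) * χ z := by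
      refine mul_nonneg ?_ hχ0
      have : c / 8 * p ^ 2 + F z * p + 2 / c * F z ^ 2 = (c * p + 4 * F z) ^ 2 / (8 * c) := by
        field_simp; ring
      rw [this]; positivity
    have k6 : 0 ≤ θ z.1 * (F z * Y z.2 + u z * q) ^ 2 := mul_nonneg (hθ0 _) (sq_nonneg _)
    have k7 : θ z.1 * (F z * Y z.2 + u z * q) ^ 2 = F z ^ 2 * χ z +
        F z * (u z * (θ z.1 * (2 * Y z.2 * q))) + u z ^ 2 * θ z.1 * q ^ 2 := by
      simp only [hχdef]; ring
    nlinarith [k3, k4, k5, k6, k7]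
  have e1 : ∫ z : ℝ × EuclideanSpace ℝ (Fin n), cacConst n τ c * u z ^ 2 *
      (θ z.1 * gradSq Y z.2) = cacConst n τ c *
        ∫ z : ℝ × EuclideanSpace ℝ (Fin n), u z ^ 2 * (θ z.1 * gradSq Y z.2) := by
    rw [← integral_const_mul]; simp only [mul_assoc]
  have e2 : ∫ z : ℝ × EuclideanSpace ℝ (Fin n), 3 / 8 * c * (∑ j, gradX u z j ^ 2) * χ z =
      3 / 8 * c * ∫ z, (∑ j, gradX u z j ^ 2) * χ z := by
    rw [← integral_const_mul]; simp only [mul_assoc]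
  rw [e1, e2] at hcac
  linarith

/-- A mollifying sequence whose time scale is so small that the space derivatives of the
mollified solution satisfy, near the terminal time, the bound satisfied by the terminal value. -/
theorem IsStrongSolution.exists_mollifierSeq {a : Matrix (Fin n) (Fin n) ℝ} {t T : ℝ}
    {g : ℝ × EuclideanSpace ℝ (Fin n) → EuclideanSpace ℝ (Fin n)}
    {l : ℝ × EuclideanSpace ℝ (Fin n) → ℝ} {lT : EuclideanSpace ℝ (Fin n) → ℝ}
    {J Js : ℝ × EuclideanSpace ℝ (Fin n) → ℝ}
    {DJ : ℝ × EuclideanSpace ℝ (Fin n) → EuclideanSpace ℝ (Fin n)}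
    {HJ : ℝ × EuclideanSpace ℝ (Fin n) → Matrix (Fin n) (Fin n) ℝ}
    (hJ : IsStrongSolution a g l lT t T J Js DJ HJ) (htT : t < T) (hlT : Differentiable ℝ lT)
    {K : ℝ} (hK : 0 ≤ K) (hb : ∀ x, ‖fderiv ℝ lT x‖ ≤ K * (1 + ‖x‖)) (R : ℝ) :
    ∃ κ : ℕ → ℝ × EuclideanSpace ℝ (Fin n) → ℝ, ∃ δ ε : ℕ → ℝ, IsMollifierSeq κ δ ε ∧
      (∀ k, 0 < δ k) ∧ (∀ k, ε k ≤ 1) ∧ ∀ k z i, z.1 ∈ Icc (T - 3 * δ k) (T - 2 * δ k) →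
        box z (δ k) (ε k) ⊆ slabBall n t T R →
        |gradX (mollify (κ k) ((slabBall n t T R).indicator J)) z i| ≤ 1 + K * (3 + ‖z.2‖) := by
  have hunif : UniformContinuousOn J (Icc t T ×ˢ Metric.closedBall 0 R) :=
    (isCompact_Icc.prod (isCompact_closedBall _ _)).uniformContinuousOn_of_continuous
      (hJ.continuousOn.mono (prod_mono subset_rfl (subset_univ _)))
  have hloc := (hJ.integrable_indicator R).locallyIntegrable
  have h : ∀ k : ℕ, ∃ δ, ∃ κ : ℝ × EuclideanSpace ℝ (Fin n) → ℝ, 0 < δ ∧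
      δ ≤ 1 / ((k : ℝ) + 1) ∧ IsMollifier κ δ (1 / ((k : ℝ) + 1)) ∧
      ∀ z i, z.1 ∈ Icc (T - 3 * δ) (T - 2 * δ) →
        box z δ (1 / ((k : ℝ) + 1)) ⊆ slabBall n t T R →
        |gradX (mollify κ ((slabBall n t T R).indicator J)) z i| ≤ 1 + K * (3 + ‖z.2‖) := by
    intro k
    have hk1 : 1 / ((k : ℝ) + 1) ≤ 1 := by
      rw [div_le_one (by positivity)]
      linarith [(Nat.cast_nonneg k : (0 : ℝ) ≤ k)]
    obtain ⟨C, hC0, hC⟩ := exists_isMollifier (n := n) (ε := 1 / ((k : ℝ) + 1)) (by positivity)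
    obtain ⟨ρ, hρ, hJρ⟩ := Metric.uniformContinuousOn_iff.1 hunif (1 / (C + 1)) (by positivity)
    -- The time scale is chosen last, after `C` and after the modulus of continuity of `J` for
    -- accuracy `1 / (C + 1)`. Every time in the box is within `4δ ≤ ρ / 2` of `T`, hence `J`
    -- differs there from `lT` by less than that accuracy.
    set δ := min (1 / ((k : ℝ) + 1)) (ρ / 8) with hδ
    have hδ0 : 0 < δ := lt_min (by positivity) (by positivity)
    obtain ⟨κ, hκ, hκC⟩ := hC δ hδ0
    refine ⟨δ, κ, hδ0, min_le_left _ _, hκ, fun z i hz hbox => ?_⟩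
    rw [gradX, fderiv_mollify hκ.contDiff hκ.hasCompactSupport hloc]
    refine abs_mollify_fderiv_le hκ hk1 hlT hK hb hC0 (hκC i) hloc fun y hy => ?_
    have hyG := hbox hy
    have hyS := slabBall_subset_compact n t T R hyG
    rw [indicator_of_mem hyG, ← hJ.terminal, ← Real.dist_eq]
    refine (hJρ y hyS (T, y.2) ⟨right_mem_Icc.2 htT.le, hyS.2⟩ ?_).le
    have h8 : δ ≤ ρ / 8 := min_le_right _ _
    rw [Prod.dist_eq, max_lt_iff]
    refine ⟨?_, by simpa using hρ⟩
    rw [Real.dist_eq, abs_lt]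
    have h1 := hy.1.1
    have h2 := hyS.1.2
    constructor <;> simp only <;> linarith [hz.1]
  choose δ κ h1 h2 h3 h4 using h
  refine ⟨κ, δ, fun k => 1 / ((k : ℝ) + 1), ⟨h3, ?_, tendsto_one_div_add_atTop_nhds_zero_nat⟩, h1,
    fun k => ?_, h4⟩
  · exact squeeze_zero (fun k => (h1 k).le) h2 tendsto_one_div_add_atTop_nhds_zero_nat
  · rw [div_le_one (by positivity)]
    linarith [(Nat.cast_nonneg k : (0 : ℝ) ≤ k)]

/-- Scalar form of `sum_sq_integral_le`, used to estimate terms containing a mollification by the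
weighted norm of the mollified function. -/
theorem integral_le_of_le_mul_sq {α : Type*} [MeasurableSpace α] {μ : Measure α}
    {f m φ wt : α → ℝ} (hwt : ∀ x, 0 ≤ wt x ∧ wt x ≤ 1) (hwm : AEStronglyMeasurable wt μ)
    (hf : MemLp f 2 μ) (hd : MemLp (fun x => m x - f x) 2 μ) {η C D : ℝ}
    (hη : ∫ x, (m x - f x) ^ 2 ∂μ ≤ η) (hC : ∫ x, f x ^ 2 * wt x ∂μ ≤ C) (hD : 0 ≤ D)
    (hφ : Integrable φ μ) (hle : ∀ x, φ x ≤ D * (m x ^ 2 * wt x)) :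
    ∫ x, φ x ∂μ ≤ D * (2 * C + 2 * η) := by
  obtain ⟨-, i2, -, h⟩ := sum_sq_integral_le (n := 1) hwt hwm (p := fun _ => m) (v := fun _ => f)
    (fun _ => hf) (fun _ => hd) (fun _ => hη)
  simp only [Finset.univ_unique, Finset.sum_singleton, Nat.cast_one, one_mul] at i2 h
  calc ∫ x, φ x ∂μ ≤ ∫ x, D * (m x ^ 2 * wt x) ∂μ := integral_mono hφ (i2.const_mul D) hle
    _ = D * ∫ x, m x ^ 2 * wt x ∂μ := integral_const_mul _ _
    _ ≤ _ := mul_le_mul_of_nonneg_left (by linarith) hD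

theorem polyWeight_add_one_le (γ : ℝ) (x : EuclideanSpace ℝ (Fin n)) :
    polyWeight (γ + 1) x ≤ polyWeight γ x := by
  rw [← polyWeight_add_one γ x]
  exact le_mul_of_one_le_left (polyWeight_pos _ _).le (one_le_one_add_norm_sq x)

theorem mul_polyWeight_le_domWeight (γ : ℝ) (x : EuclideanSpace ℝ (Fin n)) :
    (1 + ‖x‖ ^ 2) * polyWeight γ x ≤ domWeight γ x :=
  (mul_le_mul_of_nonneg_right (le_self_pow₀ (one_le_one_add_norm_sq x) two_ne_zero)
    (polyWeight_pos γ x).le).trans (sq_mul_polyWeight_le_domWeight γ x)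

theorem polyWeight_le_domWeight (γ : ℝ) (x : EuclideanSpace ℝ (Fin n)) :
    polyWeight γ x ≤ domWeight γ x :=
  (le_mul_of_one_le_left (polyWeight_pos γ x).le (one_le_one_add_norm_sq x)).trans
    (mul_polyWeight_le_domWeight γ x)

theorem sq_inner_le_of_linear_growth {K : ℝ} {x b p : EuclideanSpace ℝ (Fin n)}
    (hb : ‖b‖ ≤ K * (1 + ‖x‖)) :
    inner ℝ b p ^ 2 ≤ 2 * K ^ 2 * (1 + ‖x‖ ^ 2) * ∑ i, p i ^ 2 := by
  rw [inner_eq_sum_mul]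
  exact (Finset.sum_mul_sq_le_sq_mul_sq _ _ _).trans
    (mul_le_mul_of_nonneg_right (sum_sq_le_of_linear_growth hb)
      (Finset.sum_nonneg fun _ _ => sq_nonneg _))

/-- The weighted bound for the right side `l + g · DJ` of the equation on compact cylinders. -/
theorem IsStrongSolution.integral_rhs_sq_le {a : Matrix (Fin n) (Fin n) ℝ} {t T : ℝ}
    {g : ℝ × EuclideanSpace ℝ (Fin n) → EuclideanSpace ℝ (Fin n)}
    {l : ℝ × EuclideanSpace ℝ (Fin n) → ℝ} {lT : EuclideanSpace ℝ (Fin n) → ℝ}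
    {J Js : ℝ × EuclideanSpace ℝ (Fin n) → ℝ}
    {DJ : ℝ × EuclideanSpace ℝ (Fin n) → EuclideanSpace ℝ (Fin n)}
    {HJ : ℝ × EuclideanSpace ℝ (Fin n) → Matrix (Fin n) (Fin n) ℝ}
    (hJ : IsStrongSolution a g l lT t T J Js DJ HJ) {K C₁ γ : ℝ} (hγ : (n : ℝ) / 2 + 3 < γ)
    (ht : 0 ≤ t) (hg : ∀ s ∈ Icc t T, ∀ x, ‖g (s, x)‖ ≤ K * (1 + ‖x‖))
    (hl : ∀ s ∈ Icc t T, ∀ x, |l (s, x)| ≤ K * (1 + ‖x‖ ^ 2)) {s₂ s₃ R : ℝ}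
    (h2 : t < s₂) (h23 : s₂ < s₃) (h3 : s₃ < T)
    (hi : IntegrableOn (fun z => (∑ i, DJ z i ^ 2) * polyWeight γ z.2)
      (Icc s₂ s₃ ×ˢ Metric.closedBall 0 R))
    (hD : ∫ z in Icc s₂ s₃ ×ˢ Metric.closedBall 0 R, (∑ i, DJ z i ^ 2) * polyWeight γ z.2 ≤ C₁) :
    ∫ z in Icc s₂ s₃ ×ˢ Metric.closedBall 0 R,
      (l z + inner ℝ (g z) (DJ z)) ^ 2 * polyWeight (γ + 1) z.2 ≤
      2 * K ^ 2 * (|T| * ∫ x : EuclideanSpace ℝ (Fin n), domWeight γ x) + 4 * K ^ 2 * C₁ := by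
  have hSc : IsCompact (Icc s₂ s₃ ×ˢ Metric.closedBall (0 : EuclideanSpace ℝ (Fin n)) R) :=
    isCompact_Icc.prod (isCompact_closedBall _ _)
  obtain ⟨j1, j2⟩ := setIntegral_box_le (R := R) ht h2 h23 h3
    (integrable_pow_three_mul_polyWeight hγ : Integrable (domWeight γ)) (domWeight_nonneg γ)
  calc _ ≤ ∫ z in Icc s₂ s₃ ×ˢ Metric.closedBall 0 R, (2 * K ^ 2 * domWeight γ z.2 +
        4 * K ^ 2 * ((∑ i, DJ z i ^ 2) * polyWeight γ z.2)) := by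
        refine setIntegral_mono_on (hJ.isL2Loc_rhs.integrableOn_sq_mul _ hSc
          (box_subset_openSlab h2 h3)) ((j1.const_mul _).add (hi.const_mul _)) hSc.measurableSet
          fun z hz => ?_
        have hs : z.1 ∈ Icc t T := ⟨h2.le.trans hz.1.1, hz.1.2.trans h3.le⟩
        have k1 : l z ^ 2 ≤ (K * (1 + ‖z.2‖ ^ 2)) ^ 2 := by
          rw [← sq_abs]
          exact pow_le_pow_left₀ (abs_nonneg _) (hl z.1 hs z.2) 2
        have k2 := sq_inner_le_of_linear_growth (p := DJ z) (hg z.1 hs z.2)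
        have k3 : (l z + inner ℝ (g z) (DJ z)) ^ 2 ≤ 2 * l z ^ 2 + 2 * inner ℝ (g z) (DJ z) ^ 2 := by
          nlinarith [sq_nonneg (l z - inner ℝ (g z) (DJ z))]
        -- The factor `1 + |x|²` from `|g|²` turns the weight `γ + 1` into the weight `γ` of the
        -- gradient bound.
        have hw := polyWeight_add_one γ z.2
        have hp := (polyWeight_pos (γ + 1) z.2).le
        calc _ ≤ (2 * (K * (1 + ‖z.2‖ ^ 2)) ^ 2 +
              2 * (2 * K ^ 2 * (1 + ‖z.2‖ ^ 2) * ∑ i, DJ z i ^ 2)) * polyWeight (γ + 1) z.2 :=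
              mul_le_mul_of_nonneg_right (by linarith) hp
          _ = 2 * K ^ 2 * ((1 + ‖z.2‖ ^ 2) * ((1 + ‖z.2‖ ^ 2) * polyWeight (γ + 1) z.2)) +
              4 * K ^ 2 * ((∑ i, DJ z i ^ 2) *
                ((1 + ‖z.2‖ ^ 2) * polyWeight (γ + 1) z.2)) := by ring
          _ ≤ _ := by
              rw [hw]
              have := mul_le_mul_of_nonneg_left (mul_polyWeight_le_domWeight γ z.2)
                (by positivity : 0 ≤ 2 * K ^ 2)
              linarith
    _ = 2 * K ^ 2 * (∫ z in Icc s₂ s₃ ×ˢ Metric.closedBall (0 : EuclideanSpace ℝ (Fin n)) R,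
          domWeight γ z.2) + 4 * K ^ 2 * ∫ z in Icc s₂ s₃ ×ˢ Metric.closedBall 0 R,
            (∑ i, DJ z i ^ 2) * polyWeight γ z.2 := by
        rw [integral_add (j1.const_mul _) (hi.const_mul _), integral_const_mul, integral_const_mul]
    _ ≤ _ := add_le_add (mul_le_mul_of_nonneg_left j2 (by positivity))
        (mul_le_mul_of_nonneg_left hD (by positivity))

end

section

variable {n : ℕ}

theorem sq_le_of_abs_le_linear {p K r : ℝ} (h : |p| ≤ 1 + K * (3 + r)) :
    p ^ 2 ≤ (2 + 20 * K ^ 2) * (1 + r ^ 2) := by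
  rw [← sq_abs]
  refine (pow_le_pow_left₀ (abs_nonneg _) h 2).trans ?_
  have e1 : (1 + K * (3 + r)) ^ 2 ≤ 2 + 2 * K ^ 2 * (3 + r) ^ 2 := by
    nlinarith [sq_nonneg (1 - K * (3 + r))]
  have e2 : (3 + r) ^ 2 ≤ 10 * (1 + r ^ 2) := by nlinarith [sq_nonneg (1 - 3 * r)]
  have e3 := mul_le_mul_of_nonneg_left e2 (by positivity : 0 ≤ 2 * K ^ 2)
  nlinarith [sq_nonneg r]

set_option maxHeartbeats 1000000 in
/-- The weighted `L²` bound for the space Hessian on compact cylinders. -/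
theorem exists_hessian_bound (T K τ c C₁ γ : ℝ) (hγ : (n : ℝ) / 2 + 3 < γ) (hc : 0 < c)
    (hτ : 0 ≤ τ) (hK : 0 ≤ K) (hC₁ : 0 ≤ C₁) :
    ∃ C₂ : ℝ, 0 ≤ C₂ ∧ ∀ (a : Matrix (Fin n) (Fin n) ℝ) (t : ℝ)
      (g : ℝ × EuclideanSpace ℝ (Fin n) → EuclideanSpace ℝ (Fin n))
      (l : ℝ × EuclideanSpace ℝ (Fin n) → ℝ) (lT : EuclideanSpace ℝ (Fin n) → ℝ)
      (J Js : ℝ × EuclideanSpace ℝ (Fin n) → ℝ)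
      (DJ : ℝ × EuclideanSpace ℝ (Fin n) → EuclideanSpace ℝ (Fin n))
      (HJ : ℝ × EuclideanSpace ℝ (Fin n) → Matrix (Fin n) (Fin n) ℝ),
      (∀ i j, |a i j| ≤ τ) → (∀ ξ : Fin n → ℝ, c * ∑ i, ξ i ^ 2 ≤ quadForm a ξ ξ) →
      0 ≤ t → t < T → (∀ s ∈ Icc t T, ∀ x, ‖g (s, x)‖ ≤ K * (1 + ‖x‖)) →
      (∀ s ∈ Icc t T, ∀ x, |l (s, x)| ≤ K * (1 + ‖x‖ ^ 2)) →
      Differentiable ℝ lT → (∀ x, ‖fderiv ℝ lT x‖ ≤ K * (1 + ‖x‖)) →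
      IsStrongSolution a g l lT t T J Js DJ HJ →
      (∀ s₂ s₃ R : ℝ, t < s₂ → s₂ < s₃ → s₃ < T → 1 ≤ R →
        IntegrableOn (fun z => (∑ i, DJ z i ^ 2) * polyWeight γ z.2)
          (Icc s₂ s₃ ×ˢ Metric.closedBall 0 R) ∧
        ∫ z in Icc s₂ s₃ ×ˢ Metric.closedBall 0 R,
          (∑ i, DJ z i ^ 2) * polyWeight γ z.2 ≤ C₁) →
      ∀ (i : Fin n) (s₂ s₃ R : ℝ), t < s₂ → s₂ < s₃ → s₃ < T → 1 ≤ R →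
        IntegrableOn (fun z => (∑ j, HJ z j i ^ 2) * polyWeight (γ + 1) z.2)
          (Icc s₂ s₃ ×ˢ Metric.closedBall 0 R) ∧
        ∫ z in Icc s₂ s₃ ×ˢ Metric.closedBall 0 R,
          (∑ j, HJ z j i ^ 2) * polyWeight (γ + 1) z.2 ≤ C₂ := by
  obtain ⟨Cc, hCc0, hcut⟩ := exists_spaceCutoff n (γ + 1)
  set I := ∫ x : EuclideanSpace ℝ (Fin n), domWeight γ x with hI
  have hWi : Integrable (domWeight γ : EuclideanSpace ℝ (Fin n) → ℝ) :=
    integrable_pow_three_mul_polyWeight hγ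
  have hI0 : 0 ≤ I := integral_nonneg (domWeight_nonneg γ)
  have hcac0 : 0 ≤ cacConst n τ c := by unfold cacConst; positivity
  set B := 2 + 20 * K ^ 2 with hB
  have hB0 : 0 ≤ B := by positivity
  set CF := 2 * K ^ 2 * (|T| * I) + 4 * K ^ 2 * C₁ with hCF
  have hCF0 : 0 ≤ CF := by positivity
  -- The summands bound the terminal layer, the gradient of the space cutoff, and the right side of
  -- the equation. The bounds `C₁` and `CF` appear doubled and increased by 2 because they are
  -- transferred to mollifications with error 1.
  set Ctot := 1 / 2 * B * I + (cacConst n τ c + 1) * (Cc * (2 * C₁ + 2 * 1)) +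
    (2 / c + 1) * (1 * (2 * CF + 2 * 1)) with hCtot
  have hCtot0 : 0 ≤ Ctot := by positivity
  have hγ0 : 0 ≤ γ := by
    have : (0 : ℝ) ≤ n / 2 := by positivity
    linarith
  refine ⟨2 * (4 / c * Ctot) + 2, by positivity, ?_⟩
  intro a t g l lT J Js DJ HJ ha hell ht htT hg hl hlT hlT' hJ hDJ i s₂ s₃ R hts h23 h3T hR
  obtain ⟨Y, hY, hYsupp, hYle, hYeq, hYgrad⟩ := hcut R hR
  have hYc : HasCompactSupport Y := HasCompactSupport.of_support_subset_isCompact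
    (isCompact_closedBall 0 (2 * R)) fun x hx => by simpa using hYsupp x hx
  set s₁ := (t + s₂) / 2 with hs₁
  have h12 : s₁ < s₂ := by rw [hs₁]; linarith
  have ht1 : t < s₁ := by rw [hs₁]; linarith
  set G := slabBall n t T (2 * R + 2) with hG
  have hop : IsOpen G := isOpen_slabBall n t T (2 * R + 2)
  have hΩ : G ⊆ openSlab n t T := slabBall_subset_openSlab n t T (2 * R + 2)
  set S' : Set (ℝ × EuclideanSpace ℝ (Fin n)) := Icc s₂ s₃ ×ˢ Metric.closedBall 0 R with hS'
  have hS'c : IsCompact S' := isCompact_Icc.prod (isCompact_closedBall _ _)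
  have hS'G : S' ⊆ G := prod_mono
    (fun s hs => ⟨hts.trans_le hs.1, hs.2.trans_lt h3T⟩)
    (Metric.closedBall_subset_ball (by linarith))
  have hloc := (hJ.integrable_indicator (2 * R + 2)).locallyIntegrable
  obtain ⟨hDm, hDle⟩ : MemLp (G.indicator fun y => DJ y i) 2 ∧
      ∫ z, G.indicator (fun y => DJ y i) z ^ 2 * polyWeight γ z.2 ≤ C₁ :=
    (hJ.weakDeriv_space i).2.1.memLp_indicator_slabBall htT hγ0 hC₁
    (fun s₂ s₃ R h1 h2 h3 h4 => by
      obtain ⟨j1, j2⟩ := hDJ s₂ s₃ R h1 h2 h3 h4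
      refine le_trans ?_ j2
      have hSc : IsCompact (Icc s₂ s₃ ×ˢ Metric.closedBall (0 : EuclideanSpace ℝ (Fin n)) R) :=
        isCompact_Icc.prod (isCompact_closedBall _ _)
      refine setIntegral_mono ((hJ.weakDeriv_space i).2.1.integrableOn_sq_mul _ hSc
        (box_subset_openSlab h1 h3)) j1 fun z => mul_le_mul_of_nonneg_right ?_
          (polyWeight_pos _ _).le
      exact Finset.single_le_sum (f := fun j => DJ z j ^ 2) (fun _ _ => sq_nonneg _)
        (Finset.mem_univ i)) (2 * R + 2)
  obtain ⟨hFm, hFle⟩ : MemLp (G.indicator fun y => l y + inner ℝ (g y) (DJ y)) 2 ∧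
      ∫ z, G.indicator (fun y => l y + inner ℝ (g y) (DJ y)) z ^ 2 *
        polyWeight (γ + 1) z.2 ≤ CF := hJ.isL2Loc_rhs.memLp_indicator_slabBall htT
    (by linarith : 0 ≤ γ + 1) hCF0 (fun s₂ s₃ R h1 h2 h3 h4 =>
      hJ.integral_rhs_sq_le hγ ht hg hl h1 h2 h3 (hDJ s₂ s₃ R h1 h2 h3 h4).1
        (hDJ s₂ s₃ R h1 h2 h3 h4).2) (2 * R + 2)
  obtain ⟨κ, δ, ε, hκ, hδ0, hε1, hbdry⟩ := hJ.exists_mollifierSeq htT hlT hK hlT' (2 * R + 2)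
  have hHess := eventually_all.2 fun j => hκ.eventually_local_L2 (hJ.weakDeriv_hess j i).2.1
    hS'c hop hS'G hΩ (η := 1 / (n + 1)) (by positivity)
  have hsmall : ∀ᶠ k in atTop, δ k < s₁ - t ∧ δ k < (T - s₃) / 3 :=
    (hκ.tendsto_time.eventually_lt_const (by linarith)).and
      (hκ.tendsto_time.eventually_lt_const (by linarith))
  -- The two smallness conditions on `δ k` keep all kernels inside the slab and let the cutoff fall
  -- on `[T - 3δ, T - 2δ]`, after `s₃`, where the gradient of the mollified solution is controlled
  -- by the terminal data.
  obtain ⟨k, hk1, ⟨hk2D, hk2⟩, ⟨hk3F, hk3⟩, hk4, hδ1, hδ2⟩ := (hHess.and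
    ((hκ.tendsto_L2 hDm one_pos).and ((hκ.tendsto_L2 hFm one_pos).and
      ((hκ.eventually_box_subset hS'c hop hS'G).and hsmall)))).exists
  have hδk := hδ0 k
  have hεk := hε1 k
  have h34 : T - 3 * δ k < T - 2 * δ k := by linarith
  have h3' : s₃ ≤ T - 3 * δ k := by linarith
  have hboxG : ∀ z : ℝ × EuclideanSpace ℝ (Fin n), z.1 ∈ Icc s₁ (T - 2 * δ k) →
      ‖z.2‖ ≤ 2 * R → box z (δ k) (ε k) ⊆ G := fun z hz1 hz2 => prod_mono
    (fun s hs => ⟨by linarith [hs.1, hz1.1], by linarith [hs.2, hz1.2]⟩)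
    (fun y hy => by
      rw [Metric.mem_closedBall, dist_eq_norm] at hy
      rw [Metric.mem_ball, dist_zero_right]
      have := norm_le_norm_sub_add y z.2
      linarith)
  set v := mollify (κ k) (G.indicator J) with hv
  have hvs : ContDiff ℝ ∞ v :=
    contDiff_mollify (hκ.isMollifier k).contDiff (hκ.isMollifier k).hasCompactSupport hloc
  have hus : ContDiff ℝ ∞ fun z => gradX v z i := contDiff_fderiv_apply hvs _
  have hcacc := caccioppoli_fderiv hc ha hτ hell hvs i hY hYc h12 h34
  set θ := timeCut s₁ s₂ (T - 3 * δ k) (T - 2 * δ k) with hθ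
  have h12' : s₂ ≤ T - 3 * δ k := by linarith
  have hθ0 : ∀ s, 0 ≤ θ s := timeCut_nonneg _ _ _ _
  have hθ1 : ∀ s, θ s ≤ 1 := timeCut_le_one _ _ _ _
  have hY2c : HasCompactSupport fun x => Y x ^ 2 :=
    hYc.comp_left (g := fun r : ℝ => r ^ 2) (by simp)
  have hχ : ContDiff ℝ ∞ fun z : ℝ × EuclideanSpace ℝ (Fin n) => θ z.1 * Y z.2 ^ 2 :=
    contDiff_prod_mul (contDiff_timeCut _ _ _ _) (hY.pow 2)
  have hχc : HasCompactSupport fun z : ℝ × EuclideanSpace ℝ (Fin n) => θ z.1 * Y z.2 ^ 2 :=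
    hasCompactSupport_prod_mul (hasCompactSupport_timeCut h12 h34) hY2c
  have hT1 : ∫ z : ℝ × EuclideanSpace ℝ (Fin n), 1 / 2 * gradX v z i ^ 2 *
        (deriv (riseCut (T - 3 * δ k) (T - 2 * δ k)) z.1 * Y z.2 ^ 2) ≤ 1 / 2 * B * I := by
    refine integral_rise_term_le hus.continuous hY.continuous hYc hWi (domWeight_nonneg γ) h34
      hB0 fun z hz hy => ?_
    have h1 := hbdry k z i hz (hboxG z ⟨by linarith [hz.1], hz.2⟩ (hYsupp _ hy))
    have h2 : gradX v z i ^ 2 ≤ B * (1 + ‖z.2‖ ^ 2) := sq_le_of_abs_le_linear h1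
    calc gradX v z i ^ 2 * Y z.2 ^ 2 ≤ B * (1 + ‖z.2‖ ^ 2) * polyWeight (γ + 1) z.2 :=
          mul_le_mul h2 (hYle _) (sq_nonneg _) (by positivity)
      _ = B * polyWeight γ z.2 := by rw [mul_assoc, polyWeight_add_one]
      _ ≤ _ := mul_le_mul_of_nonneg_left (polyWeight_le_domWeight γ _) hB0
  have hT2 : ∫ z : ℝ × EuclideanSpace ℝ (Fin n), gradX v z i ^ 2 * (θ z.1 * gradSq Y z.2) ≤
      Cc * (2 * C₁ + 2 * 1) := by
    refine integral_le_of_le_mul_sq (f := G.indicator fun y => DJ y i)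
      (m := mollify (κ k) (G.indicator fun y => DJ y i)) (η := 1) (C := C₁) (D := Cc)
      (wt := fun z => polyWeight γ z.2)
      (fun z => ⟨(polyWeight_pos γ _).le, polyWeight_le_one hγ0 _⟩)
      ((continuous_polyWeight γ).comp continuous_snd).aestronglyMeasurable hDm hk2D hk2 hDle hCc0
      ?_ fun z => ?_
    · refine Continuous.integrable_of_hasCompactSupport ?_ (hasCompactSupport_prod_mul
        (hasCompactSupport_timeCut h12 h34) (hasCompactSupport_gradSq hYc)).mul_left
      exact (hus.continuous.pow 2).mul
        (((contDiff_timeCut _ _ _ _).continuous.comp continuous_fst).mul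
          ((continuous_gradSq hY).comp continuous_snd))
    · have hr : 0 ≤ Cc * (mollify (κ k) (G.indicator fun y => DJ y i) z ^ 2 *
          polyWeight γ z.2) := mul_nonneg hCc0 (mul_nonneg (sq_nonneg _) (polyWeight_pos _ _).le)
      by_cases h1 : θ z.1 = 0
      · simpa only [h1, zero_mul, mul_zero] using hr
      by_cases h2 : ‖z.2‖ ≤ 2 * R
      swap
      · simpa only [eq_zero_of_gradSq hYsupp (not_le.1 h2), mul_zero] using hr
      have hb := hboxG z (timeCut_support h12 h34 h1) h2
      rw [show gradX v z i = mollify (κ k) (G.indicator fun y => DJ y i) z from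
        fderiv_mollify_eq_of_hasWeakDeriv (hJ.weakDeriv_space i) (hκ.isMollifier k) hloc hb
          (hb.trans hΩ)]
      rw [mul_left_comm Cc]
      refine mul_le_mul_of_nonneg_left ?_ (sq_nonneg _)
      calc θ z.1 * gradSq Y z.2 ≤ 1 * gradSq Y z.2 :=
            mul_le_mul_of_nonneg_right (hθ1 _) (gradSq_nonneg _ _)
        _ ≤ Cc * polyWeight (γ + 1) z.2 := by rw [one_mul]; exact hYgrad _
        _ ≤ _ := mul_le_mul_of_nonneg_left (polyWeight_add_one_le γ _) hCc0
  have hT3 : ∫ z : ℝ × EuclideanSpace ℝ (Fin n), parabolicOp a v z ^ 2 *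
      (θ z.1 * Y z.2 ^ 2) ≤ 1 * (2 * CF + 2 * 1) := by
    refine integral_le_of_le_mul_sq (f := G.indicator fun y => l y + inner ℝ (g y) (DJ y))
      (m := mollify (κ k) (G.indicator fun y => l y + inner ℝ (g y) (DJ y)))
      (η := 1) (C := CF) (D := 1) (wt := fun z => polyWeight (γ + 1) z.2)
      (fun z => ⟨(polyWeight_pos _ _).le, polyWeight_le_one (by linarith) _⟩)
      ((continuous_polyWeight _).comp continuous_snd).aestronglyMeasurable hFm hk3F hk3 hFle
      zero_le_one ?_ fun z => ?_
    · exact (((contDiff_parabolicOp a hvs).continuous.pow 2).mul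
        hχ.continuous).integrable_of_hasCompactSupport hχc.mul_left
    · rw [one_mul]
      have hr : 0 ≤ mollify (κ k) (G.indicator fun y => l y + inner ℝ (g y) (DJ y)) z ^ 2 *
          polyWeight (γ + 1) z.2 := mul_nonneg (sq_nonneg _) (polyWeight_pos _ _).le
      by_cases h1 : θ z.1 = 0
      · simpa only [h1, zero_mul, mul_zero] using hr
      by_cases h2 : Y z.2 = 0
      · simp only [h2]
        norm_num
        exact hr
      have hb := hboxG z (timeCut_support h12 h34 h1) (hYsupp _ h2)
      rw [hJ.parabolicOp_mollify (hκ.isMollifier k) hloc hb (hb.trans hΩ)]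
      refine mul_le_mul_of_nonneg_left ?_ (sq_nonneg _)
      exact (mul_le_of_le_one_left (sq_nonneg _) (hθ1 _)).trans (hYle _)
  have i4 : Integrable fun z : ℝ × EuclideanSpace ℝ (Fin n) =>
      (∑ j, gradX (fun y => gradX v y i) z j ^ 2) * (θ z.1 * Y z.2 ^ 2) :=
    ((continuous_finsetSum _ fun j _ => (contDiff_fderiv_apply hus _).continuous.pow 2).mul
      hχ.continuous).integrable_of_hasCompactSupport hχc.mul_left
  have hcacc' : ∫ z : ℝ × EuclideanSpace ℝ (Fin n),
      (∑ j, gradX (fun y => gradX v y i) z j ^ 2) * (θ z.1 * Y z.2 ^ 2) ≤ 4 / c * Ctot := by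
    have e2 := mul_le_mul_of_nonneg_left hT2 (by positivity : 0 ≤ cacConst n τ c + 1)
    have e3 := mul_le_mul_of_nonneg_left hT3 (by positivity : 0 ≤ 2 / c + 1)
    rw [div_mul_eq_mul_div, le_div_iff₀ hc]
    linarith
  have hle : ∫ z in S', (∑ j, gradX (fun y => gradX v y i) z j ^ 2) * polyWeight (γ + 1) z.2 ≤
      4 / c * Ctot := by
    refine le_trans ?_ hcacc'
    rw [setIntegral_congr_fun (g := fun z =>
      (∑ j, gradX (fun y => gradX v y i) z j ^ 2) * (θ z.1 * Y z.2 ^ 2)) hS'c.measurableSet]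
    · refine setIntegral_le_integral i4 (ae_of_all _ fun z => ?_)
      exact mul_nonneg (Finset.sum_nonneg fun _ _ => sq_nonneg _)
        (mul_nonneg (hθ0 _) (sq_nonneg _))
    · intro z hz
      have h1 : θ z.1 = 1 := timeCut_eq_one h12 h34 ⟨hz.1.1, hz.1.2.trans h3'⟩
      simp only [h1, hYeq z.2 (by simpa using hz.2), one_mul]
  have hgradu : ∀ z ∈ S', ∀ j, gradX (fun y => gradX v y i) z j =
      mollify (κ k) (G.indicator fun y => HJ y j i) z := fun z hz j => by
    have hb := hk4 z hz
    exact hJ.hessX_mollify (hκ.isMollifier k) hloc hb (hb.trans hΩ) j i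
  obtain ⟨j1, -, j3, -⟩ := sum_sq_integral_le (μ := volume.restrict S')
    (wt := fun z => polyWeight (γ + 1) z.2)
    (p := fun j z => gradX (fun y => gradX v y i) z j) (v := fun j z => HJ z j i)
    (fun z => ⟨(polyWeight_pos _ _).le, polyWeight_le_one (by linarith) _⟩)
    ((continuous_polyWeight _).comp continuous_snd).aestronglyMeasurable
    (fun j => (hJ.weakDeriv_hess j i).2.1 S' hS'c (hS'G.trans hΩ))
    (fun j => (hk1 j).1.ae_eq ((ae_restrict_iff' hS'c.measurableSet).2 (ae_of_all _ fun z hz => by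
      simp only [hgradu z hz j])))
    (fun j => le_trans (le_of_eq (setIntegral_congr_fun hS'c.measurableSet fun z hz => by
      simp only [hgradu z hz j])) (hk1 j).2)
  refine ⟨j1, j3.trans ?_⟩
  have : (n : ℝ) * (1 / (n + 1)) ≤ 1 := by
    rw [mul_one_div, div_le_one (by positivity)]; linarith
  linarith

end

/-! ### The time derivative and the conclusion. -/

section

variable {n : ℕ}

theorem sq_diffusionOp_le {a H : Matrix (Fin n) (Fin n) ℝ} {τ : ℝ} (ha : ∀ i j, |a i j| ≤ τ) :
    diffusionOp a H ^ 2 ≤ 1 / 4 * τ ^ 2 * n ^ 2 * ∑ i, ∑ j, H j i ^ 2 := by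
  have h1 : (∑ i, ∑ j, a i j * H i j) ^ 2 ≤ (n : ℝ) * ∑ i, (∑ j, a i j * H i j) ^ 2 := by
    simpa using sq_sum_le_card_mul_sum_sq (s := Finset.univ) (f := fun i => ∑ j, a i j * H i j)
  have h2 : ∀ i, (∑ j, a i j * H i j) ^ 2 ≤ (n : ℝ) * τ ^ 2 * ∑ j, H i j ^ 2 := fun i => by
    have e : (∑ j, a i j * H i j) ^ 2 ≤ (n : ℝ) * ∑ j, (a i j * H i j) ^ 2 := by
      simpa using sq_sum_le_card_mul_sum_sq (s := Finset.univ) (f := fun j => a i j * H i j)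
    refine e.trans ?_
    rw [mul_assoc, Finset.mul_sum _ _ (τ ^ 2)]
    refine mul_le_mul_of_nonneg_left (Finset.sum_le_sum fun j _ => ?_) (Nat.cast_nonneg n)
    rw [mul_pow, ← sq_abs (a i j)]
    exact mul_le_mul_of_nonneg_right (pow_le_pow_left₀ (abs_nonneg _) (ha i j) 2) (sq_nonneg _)
  have h3 := mul_le_mul_of_nonneg_left (Finset.sum_le_sum fun i (_ : i ∈ Finset.univ) => h2 i)
    (Nat.cast_nonneg n : (0 : ℝ) ≤ n)
  rw [← Finset.mul_sum] at h3
  rw [diffusionOp, mul_pow, Finset.sum_comm (f := fun i j => H j i ^ 2)]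
  nlinarith [h1.trans h3]

/-- The equation expresses `Js` through the Hessian and `l + g · DJ`, both already bounded with the
same weight. -/
theorem integral_timeDeriv_sq_le {a : Matrix (Fin n) (Fin n) ℝ} {t T : ℝ}
    {g : ℝ × EuclideanSpace ℝ (Fin n) → EuclideanSpace ℝ (Fin n)}
    {l : ℝ × EuclideanSpace ℝ (Fin n) → ℝ} {lT : EuclideanSpace ℝ (Fin n) → ℝ}
    {J Js : ℝ × EuclideanSpace ℝ (Fin n) → ℝ}
    {DJ : ℝ × EuclideanSpace ℝ (Fin n) → EuclideanSpace ℝ (Fin n)}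
    {HJ : ℝ × EuclideanSpace ℝ (Fin n) → Matrix (Fin n) (Fin n) ℝ}
    (hJ : IsStrongSolution a g l lT t T J Js DJ HJ) {τ γ A B : ℝ} (ha : ∀ i j, |a i j| ≤ τ)
    {S : Set (ℝ × EuclideanSpace ℝ (Fin n))} (hS : IsCompact S) (hSΩ : S ⊆ openSlab n t T)
    (hF : ∫ z in S, (l z + inner ℝ (g z) (DJ z)) ^ 2 * polyWeight γ z.2 ≤ A)
    (hi : ∀ i, IntegrableOn (fun z => (∑ j, HJ z j i ^ 2) * polyWeight γ z.2) S)
    (hH : ∀ i, ∫ z in S, (∑ j, HJ z j i ^ 2) * polyWeight γ z.2 ≤ B) :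
    ∫ z in S, Js z ^ 2 * polyWeight γ z.2 ≤ 1 / 2 * τ ^ 2 * n ^ 2 * (n * B) + 2 * A := by
  have hiF := hJ.isL2Loc_rhs.integrableOn_sq_mul γ hS hSΩ
  have hiH : IntegrableOn (fun z => ∑ i, (∑ j, HJ z j i ^ 2) * polyWeight γ z.2) S :=
    integrable_finsetSum _ fun i _ => hi i
  have heq : ∀ᵐ z ∂(volume.restrict S),
      -Js z + diffusionOp a (HJ z) - inner ℝ (g z) (DJ z) = l z :=
    ae_restrict_of_ae_restrict_of_subset hSΩ hJ.equation
  calc _ ≤ ∫ z in S, (1 / 2 * τ ^ 2 * n ^ 2 * (∑ i, (∑ j, HJ z j i ^ 2) * polyWeight γ z.2) +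
        2 * ((l z + inner ℝ (g z) (DJ z)) ^ 2 * polyWeight γ z.2)) := by
        refine integral_mono_ae (hJ.weakDeriv_time.2.1.integrableOn_sq_mul γ hS hSΩ)
          ((hiH.const_mul _).add (hiF.const_mul _)) ?_
        filter_upwards [heq] with z hz
        have h1 := sq_diffusionOp_le (H := HJ z) ha
        have h2 : Js z ^ 2 ≤ 2 * diffusionOp a (HJ z) ^ 2 +
            2 * (l z + inner ℝ (g z) (DJ z)) ^ 2 := by
          rw [show Js z = diffusionOp a (HJ z) - (l z + inner ℝ (g z) (DJ z)) by linarith]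
          nlinarith [sq_nonneg (diffusionOp a (HJ z) + (l z + inner ℝ (g z) (DJ z)))]
        have h3 := mul_le_mul_of_nonneg_right
          (show Js z ^ 2 ≤ 1 / 2 * τ ^ 2 * n ^ 2 * (∑ i, ∑ j, HJ z j i ^ 2) +
            2 * (l z + inner ℝ (g z) (DJ z)) ^ 2 by linarith) (polyWeight_pos γ z.2).le
        rw [← Finset.sum_mul]
        linarith
    _ = 1 / 2 * τ ^ 2 * n ^ 2 * (∑ i, ∫ z in S, (∑ j, HJ z j i ^ 2) * polyWeight γ z.2) +
          2 * ∫ z in S, (l z + inner ℝ (g z) (DJ z)) ^ 2 * polyWeight γ z.2 := by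
        rw [integral_add (hiH.const_mul _) (hiF.const_mul _), integral_const_mul,
          integral_const_mul, integral_finsetSum _ fun i _ => hi i]
    _ ≤ _ := by
        refine add_le_add (mul_le_mul_of_nonneg_left ?_ (by positivity)) (by linarith)
        refine (Finset.sum_le_sum fun i _ => hH i).trans ?_
        simp

theorem lintegral_lintegral_le {t T : ℝ} {f : ℝ × EuclideanSpace ℝ (Fin n) → ℝ}
    (hf : AEStronglyMeasurable f (volume.restrict (openSlab n t T))) {C : ENNReal}
    (h : ∫⁻ z in openSlab n t T, ENNReal.ofReal (f z) ≤ C) :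
    ∫⁻ s in Ioo t T, ∫⁻ x, ENNReal.ofReal (f (s, x)) ≤ C := by
  have e : (volume : Measure (ℝ × EuclideanSpace ℝ (Fin n))).restrict (openSlab n t T) =
      (volume.restrict (Ioo t T)).prod volume := by
    rw [openSlab, Measure.volume_eq_prod, ← Measure.prod_restrict, Measure.restrict_univ]
  rw [e] at hf h
  rwa [lintegral_prod _ hf.aemeasurable.ennreal_ofReal] at h

/-- Ellipticity is fixed first, in terms of `n`, `τ` and `d`; then the gradient constant, and the
Hessian constant in terms of it. A single `C₁` is the maximum of the two resulting bounds. -/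
theorem exists_strongSolution_bound (T K τ d γ : ℝ) (hd : d ≠ 0) (hγ : (n : ℝ) / 2 + 3 < γ)
    (hτ : 0 ≤ τ) (hK : 0 ≤ K) :
    ∃ C₁ : ℝ, ∀ σ : Matrix (Fin n) (Fin n) ℝ,
      (σ * σ.transpose).trace = τ → (σ * σ.transpose).det = d →
      ∀ (t : ℝ) (g : ℝ × EuclideanSpace ℝ (Fin n) → EuclideanSpace ℝ (Fin n))
        (l : ℝ × EuclideanSpace ℝ (Fin n) → ℝ) (lT : EuclideanSpace ℝ (Fin n) → ℝ)
        (J Js : ℝ × EuclideanSpace ℝ (Fin n) → ℝ)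
        (DJ : ℝ × EuclideanSpace ℝ (Fin n) → EuclideanSpace ℝ (Fin n))
        (HJ : ℝ × EuclideanSpace ℝ (Fin n) → Matrix (Fin n) (Fin n) ℝ),
        0 ≤ t → t < T → Differentiable ℝ lT →
        (∀ s ∈ Icc t T, ∀ x, ‖g (s, x)‖ ≤ K * (1 + ‖x‖)) →
        (∀ s ∈ Icc t T, ∀ x, |l (s, x)| ≤ K * (1 + ‖x‖ ^ 2)) →
        (∀ x, ‖fderiv ℝ lT x‖ ≤ K * (1 + ‖x‖)) →
        IsStrongSolution (σ * σ.transpose) g l lT t T J Js DJ HJ →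
        (∀ s ∈ Icc t T, ∀ x,
          |J (s, x)| ≤ K * Real.exp (barrierRate n τ K 1 * T) * (1 + ‖x‖ ^ 2)) →
        (∫⁻ s in Ioo t T, ∫⁻ x, ENNReal.ofReal (‖DJ (s, x)‖ ^ 2 * polyWeight γ x))
          ≤ ENNReal.ofReal C₁ ∧
        (∫⁻ s in Ioo t T, ∫⁻ x, ENNReal.ofReal (|Js (s, x)| ^ 2 * polyWeight (γ + 1) x))
          ≤ ENNReal.ofReal C₁ := by
  obtain ⟨c, hc, hell⟩ := exists_ellipticity n τ d hd
  obtain ⟨C₁, hC₁, hgrad⟩ := exists_gradient_bound (n := n) T K τ c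
    (K * Real.exp (barrierRate n τ K 1 * T)) γ hγ hc hτ hK (by positivity)
  obtain ⟨C₂, -, hhess⟩ := exists_hessian_bound (n := n) T K τ c C₁ γ hγ hc hτ hK hC₁
  refine ⟨max C₁ (1 / 2 * τ ^ 2 * n ^ 2 * (n * C₂) +
    2 * (2 * K ^ 2 * (|T| * ∫ x : EuclideanSpace ℝ (Fin n), domWeight γ x) + 4 * K ^ 2 * C₁)),
    fun σ htr hdet t g l lT J Js DJ HJ ht htT hlT hg hl hlT' hJ hbd => ?_⟩
  have ha : ∀ i j, |(σ * σ.transpose) i j| ≤ τ := fun i j =>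
    htr ▸ abs_mul_transpose_le_trace σ i j
  have h1 := hgrad _ t g l lT J Js DJ HJ ha (hell σ htr hdet) ht hg hl hJ hbd
  have h2 := hhess _ t g l lT J Js DJ HJ ha (hell σ htr hdet) ht htT hg hl hlT hlT' hJ h1
  constructor
  · have hm : AEStronglyMeasurable (fun z => (∑ i, DJ z i ^ 2) * polyWeight γ z.2)
        (volume.restrict (openSlab n t T)) :=
      (Finset.aestronglyMeasurable_fun_sum _ fun i _ =>
        (hJ.weakDeriv_space i).2.1.aestronglyMeasurable.pow 2).mul
        ((continuous_polyWeight γ).comp continuous_snd).aestronglyMeasurable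
    simp only [EuclideanSpace.real_norm_sq_eq]
    refine lintegral_lintegral_le hm ((lintegral_openSlab_ofReal_le htT (fun z => ?_) h1).trans
      (ENNReal.ofReal_le_ofReal (le_max_left _ _)))
    exact mul_nonneg (Finset.sum_nonneg fun _ _ => sq_nonneg _) (polyWeight_pos γ _).le
  · have hm : AEStronglyMeasurable (fun z => Js z ^ 2 * polyWeight (γ + 1) z.2)
        (volume.restrict (openSlab n t T)) :=
      (hJ.weakDeriv_time.2.1.aestronglyMeasurable.pow 2).mul
        ((continuous_polyWeight (γ + 1)).comp continuous_snd).aestronglyMeasurable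
    simp only [sq_abs]
    refine lintegral_lintegral_le hm ((lintegral_openSlab_ofReal_le htT (fun z =>
      mul_nonneg (sq_nonneg _) (polyWeight_pos _ _).le) fun s₂ s₃ R k1 k2 k3 k4 => ?_).trans
      (ENNReal.ofReal_le_ofReal (le_max_right _ _)))
    have hSc : IsCompact (Icc s₂ s₃ ×ˢ Metric.closedBall (0 : EuclideanSpace ℝ (Fin n)) R) :=
      isCompact_Icc.prod (isCompact_closedBall _ _)
    have hSΩ := box_subset_openSlab (n := n) (R := R) k1 k3
    exact ⟨hJ.weakDeriv_time.2.1.integrableOn_sq_mul _ hSc hSΩ,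
      integral_timeDeriv_sq_le hJ ha hSc hSΩ
        (hJ.integral_rhs_sq_le hγ ht hg hl k1 k2 k3 (h1 s₂ s₃ R k1 k2 k3 k4).1
          (h1 s₂ s₃ R k1 k2 k3 k4).2)
        (fun i => (h2 i s₂ s₃ R k1 k2 k3 k4).1) (fun i => (h2 i s₂ s₃ R k1 k2 k3 k4).2)⟩

end

end

theorem mainTheorem11 (n : ℕ) (T K τ : ℝ) :
    ∃ C₀ : ℝ, ∀ d : ℝ, d ≠ 0 → ∀ γ : ℝ, (n : ℝ) / 2 + 3 < γ →
      ∃ C₁ : ℝ, ∀ σ : Matrix (Fin n) (Fin n) ℝ,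
        (σ * σ.transpose).trace = τ → (σ * σ.transpose).det = d →
        ∀ (t : ℝ) (g : ℝ × EuclideanSpace ℝ (Fin n) → EuclideanSpace ℝ (Fin n))
          (l : ℝ × EuclideanSpace ℝ (Fin n) → ℝ) (lT : EuclideanSpace ℝ (Fin n) → ℝ)
          (J Js : ℝ × EuclideanSpace ℝ (Fin n) → ℝ)
          (DJ : ℝ × EuclideanSpace ℝ (Fin n) → EuclideanSpace ℝ (Fin n))
          (HJ : ℝ × EuclideanSpace ℝ (Fin n) → Matrix (Fin n) (Fin n) ℝ),
          0 ≤ t → t ≤ T → Measurable g → Measurable l → Differentiable ℝ lT →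
          (∀ s ∈ Icc t T, ∀ x, ‖g (s, x)‖ ≤ K * (1 + ‖x‖)) →
          (∀ s ∈ Icc t T, ∀ x, |l (s, x)| ≤ K * (1 + ‖x‖ ^ 2)) →
          (∀ x, |lT x| ≤ K * (1 + ‖x‖ ^ 2)) →
          (∀ x, ‖fderiv ℝ lT x‖ ≤ K * (1 + ‖x‖)) →
          IsStrongSolution (σ * σ.transpose) g l lT t T J Js DJ HJ →
          (∃ (M : ℝ) (N : ℕ), ∀ s ∈ Icc t T, ∀ x, |J (s, x)| ≤ M * (1 + ‖x‖) ^ N) →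
          (∀ s ∈ Icc t T, ∀ x, |J (s, x)| ≤ C₀ * (1 + ‖x‖ ^ 2)) ∧
          (∫⁻ s in Ioo t T, ∫⁻ x, ENNReal.ofReal (‖DJ (s, x)‖ ^ 2 * polyWeight γ x))
            ≤ ENNReal.ofReal C₁ ∧
          (∫⁻ s in Ioo t T, ∫⁻ x, ENNReal.ofReal (|Js (s, x)| ^ 2 * polyWeight (γ + 1) x))
            ≤ ENNReal.ofReal C₁ := by
  -- This is the quadratic barrier at time 0 without its factor `1 + |x|²`; it is fixed before `d`
  -- and `γ` are introduced.
  refine ⟨K * Real.exp (barrierRate n τ K 1 * T), fun d hd γ hγ => ?_⟩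
  -- A negative trace is impossible for `σσᵀ`, and a negative `K` contradicts the bound for `lT` at
  -- the origin; any constant serves in these cases.
  rcases lt_or_ge τ 0 with hτ | hτ
  · refine ⟨0, fun σ htr => ?_⟩
    linarith [trace_mul_transpose_nonneg σ]
  rcases lt_or_ge K 0 with hK | hK
  · refine ⟨0, fun σ _ _ t g l lT J Js DJ HJ _ _ _ _ _ _ _ hlT => ?_⟩
    have h := (abs_nonneg _).trans (hlT 0)
    simp only [norm_zero] at h
    norm_num at h
    linarith
  obtain ⟨c, hc, hell⟩ := exists_ellipticity n τ d hd
  obtain ⟨C₁, hC₁⟩ := exists_strongSolution_bound (n := n) T K τ d γ hd hγ hτ hK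
  refine ⟨C₁, fun σ htr hdet t g l lT J Js DJ HJ ht htT _ _ hlTd hg hl hlT hlT' hJ hgr => ?_⟩
  obtain ⟨M, N, hgr⟩ := hgr
  have hbd := hJ.abs_le_quadratic hc hτ hK (fun i j => htr ▸ abs_mul_transpose_le_trace σ i j)
    (hell σ htr hdet) ht htT hg hl hlT hgr
  refine ⟨hbd, ?_⟩
  -- For `t = T` the time interval is empty and both integrals vanish.
  rcases htT.eq_or_lt with rfl | htT
  · simp
  · exact hC₁ σ htr hdet t g l lT J Js DJ HJ ht htT hlTd hg hl hlT' hJ hbd
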